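/- Let $q\ge 4$ be even, $k\ge 2$ and $d\ge 5q^k$ be integers, $\Delta=d+1$, $p=\Delta/(\Delta-1)$ and $t=(q^k-q)^{1/\Delta}$. Let $\mathbf B=(B_{ij})_{0\le i,j\le q}$ be the symmetric matrix with $B_{00}=t^2$, $B_{0i}=B_{i0}=t$ and $B_{ii}=0$ for $1\le i\le q$, and $B_{ij}=1$ for distinct $i,j\in\{1,\dots,q\}$. For probability vectors $\alpha,\beta$ on $\{0,\dots,q\}$ let $\Psi_1(\alpha,\beta)=\lim_{n\to\infty}\frac1n\log \mathbf E[Z^{\alpha,\beta}(G)]$, where $G$ is a random $\Delta$-regular bipartite graph with $n$ vertices on each side (the union of $\Delta$ independent uniformly random perfect matchings) and $Z^{\alpha,\beta}(G)$ is the total weight $\prod_{uv\in E(G)}B_{\sigma(u)\sigma(v)}$ of the assignments $\sigma$ whose spin fractions on the two sides are $\alpha$ and $\beta$; for real $\alpha,\beta$ the limit is taken as the upper limit over integer spin counts $a,b$ with $a/n\to\alpha$, $b/n\to\beta$, and $\log 0=-\infty$. A *fixpoint* is a pair of positive vectors $R=(R_0,\dots,R_q)$, $C=(C_0,\dots,C_q)$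 with $R_i\propto(\sum_jB_{ij}C_j)^d$ and $C_j\propto(\sum_iB_{ij}R_i)^d$. It is of *type $(q/2,q/2,0)$* if $R_1,\dots,R_q$ take exactly two values, each $q/2$ times. Its *phase* is $(\alpha,\beta)$ with $\alpha_i=R_i^p/\sum_jR_j^p$ and $\beta_i=C_i^p/\sum_jC_j^p$. Let $\Phi(R,C)=\Delta\ln\frac{R^{\top}\mathbf BC}{\|R\|_p\|C\|_p}$. For real $m_1,m_2,m_3\ge 0$ with sum $q$ and $R_0,C_0,r_i,c_i\ge 0$ put $$S=R_0C_0t^2+tC_0\sum_i m_ir_i+tR_0\sum_i m_ic_i+\Big(\sum_i m_ir_i\Big)\Big(\sum_i m_ic_i\Big)-\sum_i m_ir_ic_i,$$ $$\overline{\Phi^S}=(d+1)\ln S-d\ln\Big(R_0^{p}+\sum_i m_ir_i^{p}\Big)-d\ln\Big(C_0^{p}+\sum_i m_ic_i^{p}\Big).$$ A fixpoint $(R,C)$ of type $(q/2,q/2,0)$ is *maximal* if $\Phi(R,C)\ge\overline{\Phi^S}$ for all such $m,R_0,C_0,r,c$ with $S>0$, and *balanced* if $R_i/R_j=C_j/C_i$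 for all $i,j\in\{1,\dots,q\}$. Then: 1. Every maximal fixpoint of type $(q/2,q/2,0)$ is balanced, and its phase is a dominant phase, that is, a global maximizer of $\Psi_1$ over pairs of probability vectors. 2. Balanced fixpoints of type $(q/2,q/2,0)$ exist. They are unique up to scaling and permutation: for any two of them, $(R,C)$ and $(R',C')$, there are a permutation $\pi$ of $\{0,\dots,q\}$ with $B_{\pi(i)\pi(j)}=B_{ij}$ for all $i,j$ and constants $a,b>0$ with $R_i=aR'_{\pi(i)}$ and $C_i=bC'_{\pi(i)}$ for all $i$. In particular their phases are permutation symmetric (they agree up to a permutation that preserves $\mathbf B$ and, possibly, an exchange of $\alpha$ and $\beta$). 3. The phase of a balanced fixpoint of type $(q/2,q/2,0)$ is a Hessian dominant maximum of $\Psi_1$: it is a local maximum over pairs of probability vectors, near it $\Psi_1$ is finite and twice continuously differentiable, and the Hessian there (on the directions with $\sum_iu_i=\sum_iv_i=0$) is negative definite. Moreover the second largest eigenvalue, counted with multiplicity, of $\mathbf L=\begin{bmatrix}0&\mathbf A\\ \mathbf A^{\top}&0\end{bmatrix}$ is less than $1/d$, where $\mathbf A_{ij}=B_{ij}R_iC_j/\sqrt{a_ib_j}$,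 $a_i=\sum_jB_{ij}R_iC_j$ and $b_j=\sum_iB_{ij}R_iC_j$. In particular, the maximal fixpoints of type $(q/2,q/2,0)$ are unique up to scaling and permutation, and their phases are Hessian dominant global maximizers of $\Psi_1$. -/

import Mathlib

open Filter Topology

noncomputable section

namespace SpinPhase

section Growth

variable {I : Type*} [Fintype I] [DecidableEq I]

/-- The number of vertices that receive each spin. -/
def spinCount {n : ℕ} (σ : Fin n → I) (i : I) : ℕ :=
  (Finset.univ.filter fun v => σ v = i).card

/-- A `Δ`-regular bipartite (multi)graph with `n` vertices on each side, given as the union of the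
`Δ` perfect matchings `v ↦ G e v`. This is the total weight of the spin assignments (`σ` on the
left side, `τ` on the right side) with exactly `a i` left and `b i` right vertices of spin `i`; the
weight of an assignment is the product of `B` over all edges. -/
def partitionFunction {Δ n : ℕ} (B : Matrix I I ℝ) (G : Fin Δ → Equiv.Perm (Fin n))
    (a b : I → ℕ) : ℝ :=
  ∑ σ ∈ (Finset.univ.filter fun σ : Fin n → I => spinCount σ = a),
    ∑ τ ∈ (Finset.univ.filter fun τ : Fin n → I => spinCount τ = b),
      ∏ e : Fin Δ, ∏ v : Fin n, B (σ v) (τ (G e v))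

/-- Expectation of `partitionFunction` over a random `Δ`-regular bipartite graph, the union of `Δ`
independent uniformly random perfect matchings. -/
def expectedPartition (Δ n : ℕ) (B : Matrix I I ℝ) (a b : I → ℕ) : ℝ :=
  (∑ G : Fin Δ → Equiv.Perm (Fin n), partitionFunction B G a b) /
    (Fintype.card (Fin Δ → Equiv.Perm (Fin n)) : ℝ)

/-- `(1/n) log E[Z]`, with `log 0 = -∞`. The argument is `(n, a, b)`. -/
def growthRate (Δ : ℕ) (B : Matrix I I ℝ) (p : ℕ × (I → ℕ) × (I → ℕ)) : EReal :=
  (((p.1 : ℝ)⁻¹ : ℝ) : EReal) *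
    ENNReal.log (ENNReal.ofReal (expectedPartition Δ p.1 B p.2.1 p.2.2))

/-- `n → ∞`, `a / n → α` and `b / n → β`. -/
def phaseFilter (α β : I → ℝ) : Filter (ℕ × (I → ℕ) × (I → ℕ)) :=
  comap (fun p => p.1) atTop ⊓
    (comap (fun p i => (p.2.1 i : ℝ) / (p.1 : ℝ)) (𝓝 α) ⊓
      comap (fun p i => (p.2.2 i : ℝ) / (p.1 : ℝ)) (𝓝 β))

/-- The exponential growth rate `Ψ₁(α, β)` of `E[Z^{α,β}]`. For fractions that `n` does not turn
into integers, the spin counts are required to approach `α n` and `β n`. -/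
def Psi1 (Δ : ℕ) (B : Matrix I I ℝ) (α β : I → ℝ) : EReal :=
  limsup (growthRate Δ B) (phaseFilter α β)

variable (I) in
/-- Directions tangent to the set of pairs of probability vectors. -/
def tangent : Submodule ℝ ((I → ℝ) × (I → ℝ)) where
  carrier := {w | ∑ i, w.1 i = 0 ∧ ∑ i, w.2 i = 0}
  add_mem' := by
    rintro w z ⟨h1, h2⟩ ⟨h3, h4⟩
    simp [Finset.sum_add_distrib, h1, h2, h3, h4]
  zero_mem' := by simp
  smul_mem' := by
    rintro c w ⟨h1, h2⟩
    simp [← Finset.mul_sum, h1, h2]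

/-- `Ψ₁` around `(α, β)`, as a real function of the displacement inside the pairs of probability
vectors. -/
def psiNear (Δ : ℕ) (B : Matrix I I ℝ) (α β : I → ℝ) (w : tangent I) : ℝ :=
  (Psi1 Δ B (α + w.1.1) (β + w.1.2)).toReal

/-- The Hessian of `Ψ₁` at `(α, β)`, on the pairs of probability vectors, exists and is negative
definite: `Ψ₁` is finite and twice continuously differentiable near the point, and its second
derivative there is a negative definite quadratic form. -/
def HessianNegDef (Δ : ℕ) (B : Matrix I I ℝ) (α β : I → ℝ) : Prop :=
  (∀ᶠ w : tangent I in 𝓝 0, Psi1 Δ B (α + w.1.1) (β + w.1.2) ≠ ⊥ ∧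
    Psi1 Δ B (α + w.1.1) (β + w.1.2) ≠ ⊤) ∧
  ContDiffAt ℝ 2 (psiNear Δ B α β) 0 ∧
  ∀ w : tangent I, w ≠ 0 → iteratedFDeriv ℝ 2 (psiNear Δ B α β) 0 ![w, w] < 0

/-- `(α, β)` is a local maximum of `Ψ₁` among the pairs of probability vectors. -/
def IsLocalMaxPhase (Δ : ℕ) (B : Matrix I I ℝ) (α β : I → ℝ) : Prop :=
  α ∈ stdSimplex ℝ I ∧ β ∈ stdSimplex ℝ I ∧
    IsLocalMaxOn (fun p : (I → ℝ) × (I → ℝ) => Psi1 Δ B p.1 p.2)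
      (stdSimplex ℝ I ×ˢ stdSimplex ℝ I) (α, β)

/-- `(α, β)` is a dominant phase: a global maximizer of `Ψ₁` among the pairs of probability
vectors. -/
def IsDominantPhase (Δ : ℕ) (B : Matrix I I ℝ) (α β : I → ℝ) : Prop :=
  α ∈ stdSimplex ℝ I ∧ β ∈ stdSimplex ℝ I ∧
    IsMaxOn (fun p : (I → ℝ) × (I → ℝ) => Psi1 Δ B p.1 p.2)
      (stdSimplex ℝ I ×ˢ stdSimplex ℝ I) (α, β)

/-- Two phases agree up to a relabelling of the spins that preserves `B` and, possibly, an exchange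
of the two sides. -/
def PermutationSymmetric (B : Matrix I I ℝ) (α₁ β₁ α₂ β₂ : I → ℝ) : Prop :=
  ∃ π : Equiv.Perm I, B.submatrix π π = B ∧
    ((α₁ = α₂ ∘ π ∧ β₁ = β₂ ∘ π) ∨ (α₁ = β₂ ∘ π ∧ β₁ = α₂ ∘ π))

/-- Two pairs of vectors agree up to a relabelling of the spins that preserves `B` and a rescaling
of each of the two vectors. -/
def EqUpToScalingPerm (B : Matrix I I ℝ) (R₁ C₁ R₂ C₂ : I → ℝ) : Prop :=
  ∃ π : Equiv.Perm I, B.submatrix π π = B ∧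
    ∃ a b : ℝ, 0 < a ∧ 0 < b ∧ R₁ = a • (R₂ ∘ π) ∧ C₁ = b • (C₂ ∘ π)

/-- A positive fixpoint of the tree recursion `R_i ∝ (∑_j B_ij C_j)^d`, `C_j ∝ (∑_i B_ij R_i)^d`. -/
def IsFixpoint (d : ℕ) (B : Matrix I I ℝ) (R C : I → ℝ) : Prop :=
  (∀ i, 0 < R i) ∧ (∀ i, 0 < C i) ∧
    (∃ A : ℝ, ∀ i, R i = A * (∑ j, B i j * C j) ^ d) ∧
    (∃ A : ℝ, ∀ j, C j = A * (∑ i, B i j * R i) ^ d)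

/-- The probability vector `R_i^p / ‖R‖_p^p` with `p = Δ / (Δ - 1) = (d + 1) / d`. -/
def phaseOf (d : ℕ) (R : I → ℝ) (i : I) : ℝ :=
  R i ^ (((d : ℝ) + 1) / d) / ∑ j, R j ^ (((d : ℝ) + 1) / d)

/-- `Φ(R, C) = Δ ln (Rᵀ B C / (‖R‖_p ‖C‖_p))` with `Δ = d + 1` and `p = Δ / (Δ - 1)`, on
nonnegative vectors. -/
def Phi (d : ℕ) (B : Matrix I I ℝ) (R C : I → ℝ) : ℝ :=
  ((d : ℝ) + 1) * Real.log ((∑ i, ∑ j, R i * B i j * C j) /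
    ((∑ i, R i ^ (((d : ℝ) + 1) / d)) ^ ((d : ℝ) / ((d : ℝ) + 1)) *
      (∑ i, C i ^ (((d : ℝ) + 1) / d)) ^ ((d : ℝ) / ((d : ℝ) + 1))))

/-- The matrix `a_ij = B_ij R_i C_j / √(α_i β_j)` with `α_i = ∑_j B_ij R_i C_j` and
`β_j = ∑_i B_ij R_i C_j`. -/
def matA (B : Matrix I I ℝ) (R C : I → ℝ) : Matrix I I ℝ :=
  Matrix.of fun i j => B i j * R i * C j /
    Real.sqrt ((∑ j', B i j' * R i * C j') * (∑ i', B i' j * R i' * C j))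

/-- The block matrix with zero diagonal blocks and off-diagonal blocks `A` and `Aᵀ`. -/
def matL (B : Matrix I I ℝ) (R C : I → ℝ) : Matrix (I ⊕ I) (I ⊕ I) ℝ :=
  Matrix.fromBlocks 0 (matA B R C) (matA B R C).transpose 0

theorem matL_isHermitian (B : Matrix I I ℝ) (R C : I → ℝ) : (matL B R C).IsHermitian := by
  rw [Matrix.IsHermitian, matL, Matrix.fromBlocks_conjTranspose]
  simp [Matrix.conjTranspose_eq_transpose_of_trivial]

theorem one_lt_card_sum {I : Type*} [Fintype I] [Nonempty I] : 1 < Fintype.card (I ⊕ I) := by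
  have : 0 < Fintype.card I := Fintype.card_pos
  rw [Fintype.card_sum]
  omega

/-- The second largest eigenvalue of `matL`, counted with multiplicity (`eigenvalues₀` lists the
eigenvalues in decreasing order, starting at index `0`). -/
def secondEigenvalue [Nonempty I] (B : Matrix I I ℝ) (R C : I → ℝ) : ℝ :=
  (matL_isHermitian B R C).eigenvalues₀ ⟨1, one_lt_card_sum⟩

end Growth

/-- `t = (q^k - q)^{1/Δ}` with `Δ = d + 1`. -/
def tParam (q k d : ℕ) : ℝ :=
  ((q : ℝ) ^ k - q) ^ (1 / ((d : ℝ) + 1))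

/-- The interaction matrix on the spins `0, 1, …, q`: `t²` at `(0, 0)`, `t` elsewhere in row and
column `0`, and, on the spins `1, …, q`, zeros on the diagonal and ones off it. -/
def interaction (q k d : ℕ) : Matrix (Fin (q + 1)) (Fin (q + 1)) ℝ :=
  Matrix.of fun i j =>
    if i = 0 then (if j = 0 then tParam q k d ^ 2 else tParam q k d)
    else if j = 0 then tParam q k d else if i = j then 0 else 1

/-- The multiplicities of the distinct values among `R_1, …, R_q`. -/
def multiplicities {q : ℕ} (R : Fin (q + 1) → ℝ) : Multiset ℕ :=
  (Finset.univ.image fun i : Fin q => R i.succ).val.map fun x =>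
    (Finset.univ.filter fun i : Fin q => R i.succ = x).card

/-- The distinct values among `R_1, …, R_q` have multiplicities `q₁, q₂, q₃`, in any order, where
zeros stand for missing values. -/
def HasType {q : ℕ} (R : Fin (q + 1) → ℝ) (q₁ q₂ q₃ : ℕ) : Prop :=
  multiplicities R = ({q₁, q₂, q₃} : Multiset ℕ).filter fun m => 0 < m

/-- The bilinear form `Rᵀ B C` for vectors whose entries on the spins `1, …, q` take three values
with (real) multiplicities `m 0, m 1, m 2`. -/
def bilinS (t : ℝ) (m : Fin 3 → ℝ) (R₀ C₀ : ℝ) (r c : Fin 3 → ℝ) : ℝ :=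
  R₀ * C₀ * t ^ 2 + (∑ i, m i * r i) * C₀ * t + (∑ i, m i * c i) * R₀ * t +
    (∑ i, m i * r i) * (∑ i, m i * c i) - ∑ i, m i * r i * c i

/-- `Φ` for vectors whose entries on the spins `1, …, q` take three values with real
multiplicities. -/
def PhiS (d : ℕ) (t : ℝ) (m : Fin 3 → ℝ) (R₀ C₀ : ℝ) (r c : Fin 3 → ℝ) : ℝ :=
  ((d : ℝ) + 1) * Real.log (bilinS t m R₀ C₀ r c) -
    d * Real.log (R₀ ^ (((d : ℝ) + 1) / d) + ∑ i, m i * r i ^ (((d : ℝ) + 1) / d)) -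
    d * Real.log (C₀ ^ (((d : ℝ) + 1) / d) + ∑ i, m i * c i ^ (((d : ℝ) + 1) / d))

/-- The pair `(R, C)` attains the maximum of `PhiS` over all real triples of multiplicities with sum
`q` and all nonnegative vectors with a positive bilinear form. -/
def IsMaximal (q k d : ℕ) (R C : Fin (q + 1) → ℝ) : Prop :=
  ∀ (m : Fin 3 → ℝ) (R₀ C₀ : ℝ) (r c : Fin 3 → ℝ), (∀ i, 0 ≤ m i) → ∑ i, m i = q →
    0 ≤ R₀ → 0 ≤ C₀ → (∀ i, 0 ≤ r i) → (∀ i, 0 ≤ c i) →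
    0 < bilinS (tParam q k d) m R₀ C₀ r c →
    PhiS d (tParam q k d) m R₀ C₀ r c ≤ Phi d (interaction q k d) R C

/-- `R_i / R_j = C_j / C_i` for all spins `i, j ∈ {1, …, q}`. -/
def IsBalanced {q : ℕ} (R C : Fin (q + 1) → ℝ) : Prop :=
  ∀ i j : Fin q, R i.succ / R j.succ = C j.succ / C i.succ

/-- A positive fixpoint of type `(q/2, q/2, 0)`. -/
def IsHalfFixpoint (q k d : ℕ) (R C : Fin (q + 1) → ℝ) : Prop :=
  IsFixpoint d (interaction q k d) R C ∧ HasType R (q / 2) (q / 2) 0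

end SpinPhase

end

open SpinPhase

/-! Growth rate. Averaged over perfect matchings, the weight of a pair of assignments depends only
on its spin counts, so E[Z] is a power of one matching weight divided by multinomial coefficients
(`expectedPartition_eq`). For all weights R = exp ρ, C = exp γ, keeping only some terms of (Rᵀ B
C)^n bounds the matching weight from above; counting the assignments of one joint edge type bounds
it from below. Hence Ψ₁ is at most `dualRate` for every ρ, γ (`Psi1_le_dualRate`), with equality if
(α, β) are the marginals of the Gibbs edge distribution proportional to R_i B_ij C_j
(`Psi1_eq_dualRate`). The phase of a fixpoint is such a pair of marginals, and there Ψ₁ = Φ(R, C)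
(`IsFixpoint.Psi1_phaseOf`).

Dominance. With ρ = d/(d+1) log α and γ = d/(d+1) log β the entropies cancel from the dual bound, so
Ψ₁ is nowhere larger than the maximum of Φ over nonnegative vectors
(`Psi1_le_of_forall_unitSphere`). A maximizer of Φ solves the fixpoint equations, and its entries on
the spins 1, …, q are roots of one equation with at most three nonnegative solutions
(`not_four_roots`). It is therefore a competitor in the definition of a maximal fixpoint.

Balance. The multiplicities in Φ^S are real, so at a maximal fixpoint the derivative that moves mass
between the two classes vanishes. In the ratios y, z of `HalfProfile.exists_ratios` this says f(y) =
f(z) for the strictly increasing f(z) = 1/(1-z) - d/(1-z^d); hence y = z, which is balance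
(`isBalanced_of_isMaximal`).

Existence and uniqueness. Balanced profiles form a family with one parameter z in (0,1). The one
remaining equation, the normalization of the sum, has a strictly decreasing left side that passes
through 1 (`exists_ratio`, `BalancedProfile.ratio_unique`).

Hessian and spectrum. If ρ, γ move suitably with the phase, `dualRate` touches Ψ₁ from above, and
its second derivative is negative as soon as centred functions of the two end spins have correlation
form below 1/d (`exists_touching_function`). The same bound controls the second eigenvalue. Since
the marginals can be inverted smoothly, Ψ₁ is C² and inherits the sign. At a balanced fixpoint the
form is bounded by 1/D with D = (1-z^d)/(z^((d-1)/2)(1-z)) (`covariance_le`, `exists_spectral_gap`).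

The bound D > d, the monotonicity of f and that of `profileFactor` are all the inequality d
z^((d-1)/2)(1-z) < 1-z^d (`sq_mul_pow_mul_sq_lt`), which is AM-GM on a geometric sum. -/

namespace SpinPhase

/-! ### Counting assignments and the exact first moment -/

section Counting

variable {I : Type*} [Fintype I] [DecidableEq I]

set_option linter.unusedSectionVars false

/-- The spin assignments on `n` vertices with given spin counts. -/
def configs (n : ℕ) (a : I → ℕ) : Finset (Fin n → I) :=
  Finset.univ.filter fun σ => spinCount σ = a

theorem mem_configs {n : ℕ} {a : I → ℕ} {σ : Fin n → I} : σ ∈ configs n a ↔ spinCount σ = a := by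
  simp [configs]

theorem spinCount_comp_perm {n : ℕ} (σ : Fin n → I) (π : Equiv.Perm (Fin n)) :
    spinCount (σ ∘ π) = spinCount σ := by
  ext i
  refine Finset.card_bij (fun v _ => π v) ?_ ?_ ?_
  · intro v hv; simpa using hv
  · intro v _ w _ h; exact π.injective h
  · intro w hw; exact ⟨π.symm w, by simpa using hw, by simp⟩

theorem sum_spinCount {n : ℕ} (σ : Fin n → I) : ∑ i, spinCount σ i = n := by
  have := Finset.card_eq_sum_card_fiberwise (s := (Finset.univ : Finset (Fin n)))
    (t := (Finset.univ : Finset I)) (f := σ) (by simp)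
  simpa [spinCount] using this.symm

theorem prod_eq_prod_pow_spinCount {M : Type*} [CommMonoid M] {n : ℕ} (σ : Fin n → I) (f : I → M) :
    ∏ v, f (σ v) = ∏ i, f i ^ spinCount σ i := by
  rw [← Finset.prod_fiberwise' Finset.univ σ f]
  simp [spinCount]

theorem exists_perm_of_spinCount_eq {n : ℕ} {σ τ : Fin n → I} (h : spinCount σ = spinCount τ) :
    ∃ π : Equiv.Perm (Fin n), τ = σ ∘ π := by
  have e : ∀ i, Nonempty ({v // τ v = i} ≃ {v // σ v = i}) := fun i => by
    rw [← Fintype.card_eq, Fintype.card_subtype, Fintype.card_subtype]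
    exact (congrFun h i).symm
  exact ⟨Equiv.ofFiberEquiv fun i => (e i).some, funext fun v =>
    (Equiv.ofFiberEquiv_map (fun i => (e i).some) v).symm⟩

/-- Orbit counting: permutations of the vertices act transitively on the assignments with given
counts, and each fibre of π ↦ σ ∘ π is a translate of the stabilizer of σ, which permutes vertices
within each spin class. -/
theorem card_configs_mul {n : ℕ} (σ : Fin n → I) :
    (configs n (spinCount σ)).card * ∏ i, (spinCount σ i).factorial = n.factorial := by
  have h1 := Finset.card_eq_sum_card_fiberwise (s := (Finset.univ : Finset (Equiv.Perm (Fin n))))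
    (t := configs n (spinCount σ)) (f := fun π : Equiv.Perm (Fin n) => σ ∘ π)
    (fun π _ => by simp [mem_configs, spinCount_comp_perm])
  have h2 : ∀ τ ∈ configs n (spinCount σ),
      (Finset.univ.filter fun π : Equiv.Perm (Fin n) => σ ∘ π = τ).card =
        ∏ i, (spinCount σ i).factorial := by
    intro τ hτ
    obtain ⟨ρ, rfl⟩ := exists_perm_of_spinCount_eq (mem_configs.1 hτ).symm
    have h3 := DomMulAct.stabilizer_card σ
    simp only [Fintype.card_subtype] at h3
    simp only [spinCount]
    rw [← h3]
    refine Finset.card_bij (fun π _ => π * ρ⁻¹) ?_ ?_ ?_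
    · intro π hπ
      simp only [Finset.mem_filter, Finset.mem_univ, true_and] at hπ ⊢
      ext v
      simpa using congrFun hπ (ρ⁻¹ v)
    · intro π _ π' _ h; exact mul_right_cancel h
    · intro π hπ
      simp only [Finset.mem_filter, Finset.mem_univ, true_and] at hπ
      refine ⟨π * ρ, ?_, by simp⟩
      simp only [Finset.mem_filter, Finset.mem_univ, true_and]
      ext v
      simpa using congrFun hπ (ρ v)
  rw [Finset.sum_congr rfl h2, Finset.sum_const, smul_eq_mul] at h1
  rw [← h1]
  simp [Fintype.card_perm]

theorem exists_spinCount_eq {n : ℕ} {a : I → ℕ} (h : ∑ i, a i = n) :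
    ∃ σ : Fin n → I, spinCount σ = a := by
  have hc : Fintype.card (Fin n) = Fintype.card (Σ i, Fin (a i)) := by simp [h]
  let e := Fintype.equivOfCardEq hc
  refine ⟨fun v => (e v).1, funext fun i => ?_⟩
  rw [spinCount, ← Fintype.card_subtype]
  rw [Fintype.card_congr (e.subtypeEquiv (p := fun v => (e v).1 = i) (q := fun s => s.1 = i)
    fun v => Iff.rfl)]
  rw [Fintype.card_congr (Equiv.sigmaSubtype i)]
  simp

/-- The total weight, over spin assignments with counts `a` and `b`, of a perfect matching. -/
def matchingWeight (n : ℕ) (B : Matrix I I ℝ) (a b : I → ℕ) : ℝ :=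
  ∑ σ ∈ configs n a, ∑ τ ∈ configs n b, ∏ v, B (σ v) (τ v)

theorem matchingWeight_nonneg {B : Matrix I I ℝ} (hB : ∀ i j, 0 ≤ B i j) (n : ℕ) (a b : I → ℕ) :
    0 ≤ matchingWeight n B a b :=
  Finset.sum_nonneg fun _ _ => Finset.sum_nonneg fun _ _ => Finset.prod_nonneg fun _ _ => hB _ _

theorem sum_perm_weight_eq {n : ℕ} (B : Matrix I I ℝ) {σ σ' τ τ' : Fin n → I}
    (hσ : spinCount σ = spinCount σ') (hτ : spinCount τ = spinCount τ') :
    ∑ π : Equiv.Perm (Fin n), ∏ v, B (σ v) (τ (π v)) =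
      ∑ π : Equiv.Perm (Fin n), ∏ v, B (σ' v) (τ' (π v)) := by
  obtain ⟨ρ, rfl⟩ := exists_perm_of_spinCount_eq hσ
  obtain ⟨ρ', rfl⟩ := exists_perm_of_spinCount_eq hτ
  refine Fintype.sum_equiv ((Equiv.mulLeft ρ'⁻¹).trans (Equiv.mulRight ρ)) _ _ fun π => ?_
  refine Fintype.prod_equiv ρ⁻¹ _ _ fun v => ?_
  simp

theorem sum_configs_comp_perm {n : ℕ} (b : I → ℕ) (π : Equiv.Perm (Fin n))
    (f : (Fin n → I) → ℝ) : ∑ τ ∈ configs n b, f (τ ∘ π) = ∑ τ ∈ configs n b, f τ := by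
  refine Finset.sum_bij (fun τ _ => τ ∘ π) ?_ ?_ ?_ ?_
  · intro τ hτ; rw [mem_configs] at *; rw [spinCount_comp_perm, hτ]
  · intro τ _ τ' _ h
    ext v
    simpa using congrFun h (π.symm v)
  · intro τ hτ
    refine ⟨τ ∘ π.symm, ?_, by ext; simp⟩
    rw [mem_configs] at *; rw [spinCount_comp_perm, hτ]
  · intro _ _; rfl

/-- The sum W(σ, τ) of the weights over all matchings depends only on the spin counts, hence is
constant on the pairs counted. Summing W over the pairs gives n! times the matching weight, which
determines the constant; independence of the matchings raises W/n! to the power d + 1. -/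
theorem expectedPartition_eq (d n : ℕ) (B : Matrix I I ℝ) (a b : I → ℕ) :
    expectedPartition (d + 1) n B a b =
      matchingWeight n B a b ^ (d + 1) / (((configs n a).card : ℝ) * (configs n b).card) ^ d := by
  have hf : (n.factorial : ℝ) ≠ 0 := by exact_mod_cast n.factorial_ne_zero
  set W : (Fin n → I) → (Fin n → I) → ℝ := fun σ τ =>
    ∑ π : Equiv.Perm (Fin n), ∏ v, B (σ v) (τ (π v)) with hW
  have h1 : ∑ G : Fin (d + 1) → Equiv.Perm (Fin n), partitionFunction B G a b =
      ∑ σ ∈ configs n a, ∑ τ ∈ configs n b, W σ τ ^ (d + 1) := by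
    simp only [partitionFunction]
    rw [Finset.sum_comm]
    refine Finset.sum_congr rfl fun σ _ => ?_
    rw [Finset.sum_comm]
    refine Finset.sum_congr rfl fun τ _ => ?_
    rw [hW, Fintype.sum_pow]
  have h2 : ∑ σ ∈ configs n a, ∑ τ ∈ configs n b, W σ τ =
      n.factorial * matchingWeight n B a b := by
    have : ∀ π : Equiv.Perm (Fin n), ∑ σ ∈ configs n a, ∑ τ ∈ configs n b,
        ∏ v, B (σ v) (τ (π v)) = matchingWeight n B a b := fun π =>
      Finset.sum_congr rfl fun σ _ =>
        sum_configs_comp_perm b π fun τ => ∏ v, B (σ v) (τ v)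
    calc ∑ σ ∈ configs n a, ∑ τ ∈ configs n b, W σ τ
        = ∑ σ ∈ configs n a, ∑ π : Equiv.Perm (Fin n), ∑ τ ∈ configs n b,
          ∏ v, B (σ v) (τ (π v)) := Finset.sum_congr rfl fun σ _ => Finset.sum_comm
      _ = ∑ π : Equiv.Perm (Fin n), ∑ σ ∈ configs n a, ∑ τ ∈ configs n b,
          ∏ v, B (σ v) (τ (π v)) := Finset.sum_comm
      _ = _ := by rw [Finset.sum_congr rfl fun π _ => this π]; simp [Fintype.card_perm]
  have hcard : (Fintype.card (Fin (d + 1) → Equiv.Perm (Fin n)) : ℝ) =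
      (n.factorial : ℝ) ^ (d + 1) := by simp [Fintype.card_perm]
  rw [expectedPartition, h1, hcard]
  rcases (configs n a).eq_empty_or_nonempty with ha | ⟨σ₀, hσ₀⟩
  · simp [matchingWeight, ha]
  rcases (configs n b).eq_empty_or_nonempty with hb | ⟨τ₀, hτ₀⟩
  · simp [matchingWeight, hb]
  have hc : ∀ σ ∈ configs n a, ∀ τ ∈ configs n b, W σ τ = W σ₀ τ₀ := fun σ hσ τ hτ =>
    sum_perm_weight_eq B ((mem_configs.1 hσ).trans (mem_configs.1 hσ₀).symm)
      ((mem_configs.1 hτ).trans (mem_configs.1 hτ₀).symm)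
  have hna : ((configs n a).card : ℝ) ≠ 0 := by
    exact_mod_cast (Finset.card_pos.2 ⟨σ₀, hσ₀⟩).ne'
  have hnb : ((configs n b).card : ℝ) ≠ 0 := by
    exact_mod_cast (Finset.card_pos.2 ⟨τ₀, hτ₀⟩).ne'
  rw [Finset.sum_congr rfl fun σ hσ => Finset.sum_congr rfl fun τ hτ => hc σ hσ τ hτ] at h2
  rw [Finset.sum_congr rfl fun σ hσ => Finset.sum_congr rfl fun τ hτ => by rw [hc σ hσ τ hτ]]
  simp only [Finset.sum_const, nsmul_eq_mul] at h2 ⊢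
  have h3 : matchingWeight n B a b =
      (configs n a).card * ((configs n b).card * W σ₀ τ₀) / n.factorial := by
    rw [h2]; field_simp
  rw [h3]
  generalize W σ₀ τ₀ = w
  generalize ((configs n a).card : ℝ) = x at *
  generalize ((configs n b).card : ℝ) = y at *
  generalize (n.factorial : ℝ) = f at *
  have h4 : (x * (y * w)) ^ (d + 1) = (x * y) ^ d * (x * (y * w ^ (d + 1))) := by ring
  rw [div_pow, h4, div_right_comm, mul_div_cancel_left₀ _ (pow_ne_zero d (mul_ne_zero hna hnb))]

theorem card_configs_mul_prod_le {R : I → ℝ} (hR : ∀ i, 0 ≤ R i) (n : ℕ) (a : I → ℕ) :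
    (configs n a).card * ∏ i, R i ^ a i ≤ (∑ i, R i) ^ n := by
  rw [Fintype.sum_pow]
  calc ((configs n a).card : ℝ) * ∏ i, R i ^ a i = ∑ σ ∈ configs n a, ∏ v, R (σ v) := by
        rw [Finset.sum_congr rfl fun σ hσ => by
          rw [prod_eq_prod_pow_spinCount, mem_configs.1 hσ]]
        simp
    _ ≤ ∑ σ : Fin n → I, ∏ v, R (σ v) :=
        Finset.sum_le_sum_of_subset_of_nonneg (Finset.subset_univ _) fun σ _ _ =>
          Finset.prod_nonneg fun _ _ => hR _

/-- Expanding the n-th power gives a sum of nonnegative terms over all pairs of assignments; the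
left side keeps the pairs with the prescribed counts. -/
theorem matchingWeight_mul_prod_le {B : Matrix I I ℝ} (hB : ∀ i j, 0 ≤ B i j) {R C : I → ℝ}
    (hR : ∀ i, 0 ≤ R i) (hC : ∀ i, 0 ≤ C i) (n : ℕ) (a b : I → ℕ) :
    matchingWeight n B a b * ((∏ i, R i ^ a i) * ∏ i, C i ^ b i) ≤
      (∑ i, ∑ j, R i * B i j * C j) ^ n := by
  rw [← Fintype.sum_prod_type' (f := fun i j => R i * B i j * C j), Fintype.sum_pow]
  have h0 : ∀ k : I × I, 0 ≤ R k.1 * B k.1 k.2 * C k.2 := fun k =>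
    mul_nonneg (mul_nonneg (hR _) (hB _ _)) (hC _)
  calc matchingWeight n B a b * ((∏ i, R i ^ a i) * ∏ i, C i ^ b i)
      = ∑ στ ∈ configs n a ×ˢ configs n b, ∏ v, R (στ.1 v) * B (στ.1 v) (στ.2 v) * C (στ.2 v) := by
        rw [matchingWeight, Finset.sum_mul, Finset.sum_product]
        refine Finset.sum_congr rfl fun σ hσ => ?_
        rw [Finset.sum_mul]
        refine Finset.sum_congr rfl fun τ hτ => ?_
        rw [Finset.prod_mul_distrib, Finset.prod_mul_distrib, prod_eq_prod_pow_spinCount σ R,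
          prod_eq_prod_pow_spinCount τ C, mem_configs.1 hσ, mem_configs.1 hτ]
        ring
    _ ≤ ∑ στ : (Fin n → I) × (Fin n → I),
          ∏ v, R (στ.1 v) * B (στ.1 v) (στ.2 v) * C (στ.2 v) :=
        Finset.sum_le_sum_of_subset_of_nonneg (Finset.subset_univ _) fun σ _ _ =>
          Finset.prod_nonneg fun v _ => h0 (_, _)
    _ = _ := by
        refine (Fintype.sum_equiv (Equiv.arrowProdEquivProdArrow (Fin n) (fun _ => I) (fun _ => I)) _ _
          fun ω => ?_).symm
        rfl

/-- An assignment of pairs of spins to the edges with joint counts X splits into two assignments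
whose counts are the marginals of X. This splitting is injective, and all other pairs contribute
nonnegatively. -/
theorem card_configs_mul_prod_le_matchingWeight {B : Matrix I I ℝ} (hB : ∀ i j, 0 ≤ B i j) (n : ℕ)
    (X : I × I → ℕ) :
    (configs n X).card * ∏ k, B k.1 k.2 ^ X k ≤
      matchingWeight n B (fun i => ∑ j, X (i, j)) (fun j => ∑ i, X (i, j)) := by
  have hmarg : ∀ ω ∈ configs n X, (fun v => (ω v).1) ∈ configs n (fun i => ∑ j, X (i, j)) ∧
      (fun v => (ω v).2) ∈ configs n (fun j => ∑ i, X (i, j)) := by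
    intro ω hω
    rw [mem_configs] at *
    subst hω
    rw [mem_configs]
    constructor
    · ext i
      simp only [spinCount]
      rw [Finset.card_eq_sum_card_fiberwise (t := Finset.univ) (f := fun v => (ω v).2) (by simp)]
      refine Finset.sum_congr rfl fun j _ => ?_
      congr 1
      ext v
      simp [Prod.ext_iff]
    · ext j
      simp only [spinCount]
      rw [Finset.card_eq_sum_card_fiberwise (t := Finset.univ) (f := fun v => (ω v).1) (by simp)]
      refine Finset.sum_congr rfl fun i _ => ?_
      congr 1
      ext v
      simp [Prod.ext_iff, and_comm]
  calc ((configs n X).card : ℝ) * ∏ k, B k.1 k.2 ^ X k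
      = ∑ ω ∈ configs n X, ∏ v, B (ω v).1 (ω v).2 := by
        rw [Finset.sum_congr rfl fun ω hω => by
          rw [prod_eq_prod_pow_spinCount ω (fun k : I × I => B k.1 k.2), mem_configs.1 hω]]
        simp
    _ = ∑ στ ∈ (configs n X).image (fun ω => ((fun v => (ω v).1), (fun v => (ω v).2))),
          ∏ v, B (στ.1 v) (στ.2 v) := by
        rw [Finset.sum_image]
        intro ω _ ω' _ h
        simp only [Prod.mk.injEq] at h
        ext v
        exacts [congrFun h.1 v, congrFun h.2 v]
    _ ≤ _ := by
        rw [matchingWeight, ← Finset.sum_product']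
        refine Finset.sum_le_sum_of_subset_of_nonneg ?_ fun _ _ _ =>
          Finset.prod_nonneg fun _ _ => hB _ _
        intro στ h
        obtain ⟨ω, hω, rfl⟩ := Finset.mem_image.1 h
        exact Finset.mem_product.2 (hmarg ω hω)

end Counting

end SpinPhase

namespace SpinPhase

/-! ### Entropy estimates and bounds at finite size -/

section Entropy

variable {I : Type*} [Fintype I] [DecidableEq I]

set_option linter.unusedSectionVars false

theorem log_factorial_ge (n : ℕ) : (n : ℝ) * Real.log n - n ≤ Real.log n.factorial := by
  rcases Nat.eq_zero_or_pos n with rfl | hn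
  · simp
  have hn' : (0 : ℝ) < n := by exact_mod_cast hn
  have hf : (0 : ℝ) < n.factorial := by exact_mod_cast n.factorial_pos
  have h := Real.pow_div_factorial_le_exp (n : ℝ) hn'.le n
  have h2 := Real.log_le_log (by positivity) h
  rw [Real.log_exp, Real.log_div (by positivity) (by positivity), Real.log_pow] at h2
  linarith

/-- A crude Stirling bound, by induction for the sharper form with log a in the error. The error is
stated in terms of n so that it is the same for all spins. -/
theorem log_factorial_le {a n : ℕ} (h : a ≤ n) (hn : 1 ≤ n) :
    Real.log a.factorial ≤ 1 + Real.log n + (a * Real.log a - a) := by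
  have hn' : (1 : ℝ) ≤ n := by exact_mod_cast hn
  have hl : 0 ≤ Real.log n := Real.log_nonneg hn'
  rcases Nat.eq_zero_or_pos a with rfl | ha
  · simp; linarith
  suffices H : Real.log a.factorial ≤ 1 + Real.log a + (a * Real.log a - a) by
    have : Real.log a ≤ Real.log n :=
      Real.log_le_log (by exact_mod_cast ha) (by exact_mod_cast h)
    linarith
  clear h hl hn hn'
  induction a, ha using Nat.le_induction with
  | base => simp
  | succ a ha ih =>
    have ha' : (0 : ℝ) < a := by exact_mod_cast ha
    have hf : (0 : ℝ) < a.factorial := by exact_mod_cast a.factorial_pos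
    rw [Nat.factorial_succ]
    push_cast
    rw [Real.log_mul (by positivity) (by positivity)]
    have h1 : 1 / ((a : ℝ) + 1) ≤ Real.log (a + 1) - Real.log a := by
      have := Real.add_one_le_exp (-(Real.log (a + 1) - Real.log a))
      have h2 : Real.exp (-(Real.log (a + 1) - Real.log a)) = a / (a + 1) := by
        rw [neg_sub, Real.exp_sub, Real.exp_log ha', Real.exp_log (by positivity)]
      rw [h2] at this
      have h3 : (a : ℝ) / (a + 1) = 1 - 1 / (a + 1) := by field_simp; ring
      linarith
    rw [div_le_iff₀ (by positivity)] at h1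
    linarith

/-- The entropy of a vector of fractions. -/
noncomputable def entropy (α : I → ℝ) : ℝ := ∑ i, Real.negMulLog (α i)

theorem continuous_entropy : Continuous (entropy : (I → ℝ) → ℝ) := by
  unfold entropy
  fun_prop

theorem mul_entropy_div {n : ℕ} (hn : 1 ≤ n) {a : I → ℕ} (ha : ∑ i, a i = n) :
    n * entropy (fun i => (a i : ℝ) / n) = n * Real.log n - ∑ i, a i * Real.log (a i) := by
  have hn' : (0 : ℝ) < n := by exact_mod_cast hn
  have hs : (n : ℝ) = ∑ i, (a i : ℝ) := by exact_mod_cast ha.symm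
  have : (n : ℝ) * Real.log n = ∑ i, (a i : ℝ) * Real.log n := by
    rw [← Finset.sum_mul, ← hs]
  rw [this, entropy, Finset.mul_sum, ← Finset.sum_sub_distrib]
  refine Finset.sum_congr rfl fun i _ => ?_
  rcases Nat.eq_zero_or_pos (a i) with h | h
  · simp [h]
  have h' : (0 : ℝ) < a i := by exact_mod_cast h
  rw [Real.negMulLog, Real.log_div h'.ne' hn'.ne']
  field_simp
  ring

theorem card_configs_pos {n : ℕ} {a : I → ℕ} (ha : ∑ i, a i = n) : 0 < (configs n a).card := by
  obtain ⟨σ, hσ⟩ := exists_spinCount_eq ha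
  exact Finset.card_pos.2 ⟨σ, mem_configs.2 hσ⟩

theorem log_card_configs_ge {n : ℕ} (hn : 1 ≤ n) {a : I → ℕ} (ha : ∑ i, a i = n) :
    n * entropy (fun i => (a i : ℝ) / n) - Fintype.card I * (1 + Real.log n) ≤
      Real.log (configs n a).card := by
  obtain ⟨σ, rfl⟩ := exists_spinCount_eq ha
  have hc : (0 : ℝ) < (configs n (spinCount σ)).card := by exact_mod_cast card_configs_pos ha
  have h1 := card_configs_mul σ
  have h2 : Real.log (configs n (spinCount σ)).card + ∑ i, Real.log (spinCount σ i).factorial =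
      Real.log n.factorial := by
    rw [← h1]
    push_cast
    rw [Real.log_mul hc.ne' (by
      exact Finset.prod_ne_zero_iff.2 fun i _ => by exact_mod_cast Nat.factorial_ne_zero _),
      Real.log_prod (fun i _ => by exact_mod_cast Nat.factorial_ne_zero _)]
  have h3 : ∑ i, Real.log (spinCount σ i).factorial ≤ ∑ i, (1 + Real.log n +
      (spinCount σ i * Real.log (spinCount σ i) - spinCount σ i)) :=
    Finset.sum_le_sum fun i _ => log_factorial_le
      ((Finset.single_le_sum (fun _ _ => Nat.zero_le _) (Finset.mem_univ i)).trans ha.le) hn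
  have hs : (n : ℝ) = ∑ i, (spinCount σ i : ℝ) := by exact_mod_cast ha.symm
  rw [Finset.sum_add_distrib, Finset.sum_sub_distrib, ← hs] at h3
  simp only [Finset.sum_const, Finset.card_univ, nsmul_eq_mul] at h3
  rw [mul_entropy_div hn ha]
  have h4 := log_factorial_ge n
  linarith

theorem log_card_configs_le {n : ℕ} (hn : 1 ≤ n) {a : I → ℕ} (ha : ∑ i, a i = n) :
    Real.log (configs n a).card ≤ n * entropy (fun i => (a i : ℝ) / n) := by
  have hn' : (0 : ℝ) < n := by exact_mod_cast hn
  have hc : (0 : ℝ) < (configs n a).card := by exact_mod_cast card_configs_pos ha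
  -- Weights equal to the counts themselves make the single multinomial term largest; they give the
  -- entropy bound without any error.
  have h1 := card_configs_mul_prod_le (R := fun i => (a i : ℝ)) (fun i => by positivity) n a
  have hs : ∑ i, (a i : ℝ) = n := by exact_mod_cast ha
  have hp : ∀ i ∈ Finset.univ, ((a i : ℝ) ^ a i) ≠ 0 := fun i _ => by
    rcases Nat.eq_zero_or_pos (a i) with h | h
    · simp [h]
    · have : (0 : ℝ) < a i := by exact_mod_cast h
      positivity
  have hpp : 0 < ∏ i, ((a i : ℝ) ^ a i) :=
    Finset.prod_pos fun i hi => lt_of_le_of_ne (by positivity) (hp i hi).symm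
  rw [hs] at h1
  have h2 := Real.log_le_log (mul_pos hc hpp) h1
  rw [Real.log_mul hc.ne' hpp.ne', Real.log_prod hp, Real.log_pow] at h2
  simp only [Real.log_pow] at h2
  rw [mul_entropy_div hn ha]
  linarith

/-- The logarithm of `Rᵀ B C` for `R = exp ρ` and `C = exp γ`. -/
noncomputable def logZ (B : Matrix I I ℝ) (ρ γ : I → ℝ) : ℝ :=
  Real.log (∑ i, ∑ j, Real.exp (ρ i) * B i j * Real.exp (γ j))

/-- The dual expression for the growth rate: `Ψ₁` is its infimum over `ρ` and `γ`. -/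
noncomputable def dualRate (d : ℕ) (B : Matrix I I ℝ) (α β ρ γ : I → ℝ) : ℝ :=
  -d * (entropy α + entropy β) +
    ((d : ℝ) + 1) * (logZ B ρ γ - ∑ i, α i * ρ i - ∑ i, β i * γ i)

theorem growthRate_of_pos {Δ n : ℕ} {B : Matrix I I ℝ} {a b : I → ℕ}
    (h : 0 < expectedPartition Δ n B a b) :
    growthRate Δ B (n, a, b) = (((n : ℝ)⁻¹ * Real.log (expectedPartition Δ n B a b) : ℝ) : EReal) := by
  rw [growthRate, ENNReal.log_ofReal_of_pos h, EReal.coe_mul]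

theorem growthRate_of_nonpos {Δ n : ℕ} (hn : 1 ≤ n) {B : Matrix I I ℝ} {a b : I → ℕ}
    (h : expectedPartition Δ n B a b ≤ 0) : growthRate Δ B (n, a, b) = ⊥ := by
  rw [growthRate, ENNReal.log_ofReal, if_pos h, EReal.coe_mul_bot_of_pos]
  have : (0 : ℝ) < n := by exact_mod_cast hn
  positivity

/-- The exact formula for the first moment, with the weighted bound on the matching weight in the
numerator and the entropy lower bound for the multinomials in the denominator. Only the latter costs
an error of order (log n)/n. -/
theorem growthRate_le {d n : ℕ} (hn : 1 ≤ n) {B : Matrix I I ℝ} (hB : ∀ i j, 0 ≤ B i j)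
    (a b : I → ℕ) (ρ γ : I → ℝ) :
    growthRate (d + 1) B (n, a, b) ≤
      ((dualRate d B (fun i => (a i : ℝ) / n) (fun i => (b i : ℝ) / n) ρ γ +
        2 * d * Fintype.card I * ((1 + Real.log n) / n) : ℝ) : EReal) := by
  have hn' : (0 : ℝ) < n := by exact_mod_cast hn
  rcases le_or_gt (expectedPartition (d + 1) n B a b) 0 with h | h
  · rw [growthRate_of_nonpos hn h]; exact bot_le
  rw [growthRate_of_pos h, EReal.coe_le_coe_iff]
  have hE := expectedPartition_eq d n B a b
  have hT0 : matchingWeight n B a b ≠ 0 := by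
    rintro h0; rw [h0] at hE; simp at hE; linarith
  have hT : 0 < matchingWeight n B a b := lt_of_le_of_ne (matchingWeight_nonneg hB n a b) hT0.symm
  have ha : (configs n a).Nonempty := by
    by_contra hne
    rw [Finset.not_nonempty_iff_eq_empty] at hne
    exact hT0 (by simp [matchingWeight, hne])
  have hb : (configs n b).Nonempty := by
    by_contra hne
    rw [Finset.not_nonempty_iff_eq_empty] at hne
    exact hT0 (by simp [matchingWeight, hne])
  have hac : (0 : ℝ) < (configs n a).card := by exact_mod_cast ha.card_pos
  have hbc : (0 : ℝ) < (configs n b).card := by exact_mod_cast hb.card_pos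
  obtain ⟨σ, hσ⟩ := ha
  obtain ⟨τ, hτ⟩ := hb
  have hsa : ∑ i, a i = n := by rw [← mem_configs.1 hσ, sum_spinCount]
  have hsb : ∑ i, b i = n := by rw [← mem_configs.1 hτ, sum_spinCount]
  have hlog : Real.log (expectedPartition (d + 1) n B a b) =
      (d + 1) * Real.log (matchingWeight n B a b) -
        d * (Real.log (configs n a).card + Real.log (configs n b).card) := by
    rw [hE, Real.log_div (by positivity) (by positivity), Real.log_pow, Real.log_pow,
      Real.log_mul hac.ne' hbc.ne']
    push_cast; ring
  have h1 := matchingWeight_mul_prod_le hB (R := fun i => Real.exp (ρ i))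
    (C := fun i => Real.exp (γ i)) (fun i => (Real.exp_pos _).le) (fun i => (Real.exp_pos _).le) n a b
  have hpa : ∏ i, Real.exp (ρ i) ^ a i = Real.exp (∑ i, a i * ρ i) := by
    rw [Real.exp_sum]; exact Finset.prod_congr rfl fun i _ => by rw [← Real.exp_nat_mul]
  have hpb : ∏ i, Real.exp (γ i) ^ b i = Real.exp (∑ i, b i * γ i) := by
    rw [Real.exp_sum]; exact Finset.prod_congr rfl fun i _ => by rw [← Real.exp_nat_mul]
  rw [hpa, hpb] at h1
  have h2 := Real.log_le_log (by positivity) h1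
  rw [Real.log_mul hT0 (by positivity), Real.log_mul (by positivity) (by positivity), Real.log_exp,
    Real.log_exp, Real.log_pow] at h2
  have h3 := log_card_configs_ge hn hsa
  have h4 := log_card_configs_ge hn hsb
  rw [hlog, inv_mul_le_iff₀ hn']
  have e1 : (n : ℝ) * ∑ i, (a i : ℝ) / n * ρ i = ∑ i, a i * ρ i := by
    rw [Finset.mul_sum]; exact Finset.sum_congr rfl fun i _ => by field_simp
  have e2 : (n : ℝ) * ∑ i, (b i : ℝ) / n * γ i = ∑ i, b i * γ i := by
    rw [Finset.mul_sum]; exact Finset.sum_congr rfl fun i _ => by field_simp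
  have e3 : (n : ℝ) * ((1 + Real.log n) / n) = 1 + Real.log n := by field_simp
  have e4 : (n : ℝ) * (dualRate d B (fun i => (a i : ℝ) / n) (fun i => (b i : ℝ) / n) ρ γ +
        2 * d * Fintype.card I * ((1 + Real.log n) / n)) =
      -d * (n * entropy (fun i => (a i : ℝ) / n) + n * entropy (fun i => (b i : ℝ) / n)) +
      ((d : ℝ) + 1) * (n * logZ B ρ γ - ∑ i, a i * ρ i - ∑ i, b i * γ i) +
      2 * d * Fintype.card I * (1 + Real.log n) := by
    rw [dualRate]
    linear_combination -((d : ℝ) + 1) * e1 - ((d : ℝ) + 1) * e2 + 2 * d * Fintype.card I * e3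
  rw [e4]
  have h2' : Real.log (matchingWeight n B a b) ≤
      n * logZ B ρ γ - ∑ i, a i * ρ i - ∑ i, b i * γ i := by
    rw [logZ]; linarith
  have h5 := mul_le_mul_of_nonneg_left h2' (by positivity : (0 : ℝ) ≤ d + 1)
  have h6 := mul_le_mul_of_nonneg_left (add_le_add h3 h4) (by positivity : (0 : ℝ) ≤ d)
  linarith

/-- The reverse estimate, from one joint edge type X. The support condition keeps the product of the
entries of B nonzero, so that its logarithm is the expected one. -/
theorem le_growthRate {d n : ℕ} (hn : 1 ≤ n) {B : Matrix I I ℝ} (hB : ∀ i j, 0 ≤ B i j)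
    {X : I × I → ℕ} (hX : ∑ k, X k = n) (hXB : ∀ k, X k ≠ 0 → 0 < B k.1 k.2) :
    ((((d : ℝ) + 1) * (entropy (fun k => (X k : ℝ) / n) + ∑ k, (X k : ℝ) / n * Real.log (B k.1 k.2)
        - Fintype.card (I × I) * ((1 + Real.log n) / n)) -
      d * (entropy (fun i => ((∑ j, X (i, j) : ℕ) : ℝ) / n) +
        entropy (fun j => ((∑ i, X (i, j) : ℕ) : ℝ) / n)) : ℝ) : EReal) ≤
      growthRate (d + 1) B (n, (fun i => ∑ j, X (i, j)), (fun j => ∑ i, X (i, j))) := by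
  have hn' : (0 : ℝ) < n := by exact_mod_cast hn
  set a : I → ℕ := fun i => ∑ j, X (i, j) with ha
  set b : I → ℕ := fun j => ∑ i, X (i, j) with hb
  have hsa : ∑ i, a i = n := by rw [← hX, Fintype.sum_prod_type]
  have hsb : ∑ i, b i = n := by rw [← hX, Fintype.sum_prod_type_right]
  have hac : (0 : ℝ) < (configs n a).card := by exact_mod_cast card_configs_pos hsa
  have hbc : (0 : ℝ) < (configs n b).card := by exact_mod_cast card_configs_pos hsb
  have hXc : (0 : ℝ) < (configs n X).card := by exact_mod_cast card_configs_pos hX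
  have hp : ∀ k ∈ Finset.univ, B k.1 k.2 ^ X k ≠ 0 := fun k _ => by
    by_cases h : X k = 0
    · simp [h]
    · exact pow_ne_zero _ (hXB k h).ne'
  have hpp : 0 < ∏ k, B k.1 k.2 ^ X k := Finset.prod_pos fun k hk =>
    lt_of_le_of_ne (pow_nonneg (hB _ _) _) (hp k hk).symm
  have h1 := card_configs_mul_prod_le_matchingWeight hB n X
  have hT : 0 < matchingWeight n B a b := lt_of_lt_of_le (mul_pos hXc hpp) h1
  have h2 := Real.log_le_log (mul_pos hXc hpp) h1
  rw [Real.log_mul hXc.ne' hpp.ne', Real.log_prod hp] at h2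
  simp only [Real.log_pow] at h2
  have hE := expectedPartition_eq d n B a b
  have hE0 : 0 < expectedPartition (d + 1) n B a b := by rw [hE]; positivity
  have hlog : Real.log (expectedPartition (d + 1) n B a b) =
      (d + 1) * Real.log (matchingWeight n B a b) -
        d * (Real.log (configs n a).card + Real.log (configs n b).card) := by
    rw [hE, Real.log_div (by positivity) (by positivity), Real.log_pow, Real.log_pow,
      Real.log_mul hac.ne' hbc.ne']
    push_cast; ring
  rw [growthRate_of_pos hE0, EReal.coe_le_coe_iff, hlog, le_inv_mul_iff₀ hn']
  have e1 : (n : ℝ) * ∑ k, (X k : ℝ) / n * Real.log (B k.1 k.2) =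
      ∑ k, X k * Real.log (B k.1 k.2) := by
    rw [Finset.mul_sum]; exact Finset.sum_congr rfl fun i _ => by field_simp
  have e3 : (n : ℝ) * ((1 + Real.log n) / n) = 1 + Real.log n := by field_simp
  have h3 := log_card_configs_ge hn hX
  have h4 := log_card_configs_le hn hsa
  have h5 := log_card_configs_le hn hsb
  have h6 := mul_le_mul_of_nonneg_left (add_le_add h4 h5) (by positivity : (0 : ℝ) ≤ d)
  have h7 := mul_le_mul_of_nonneg_left ((add_le_add_left h3 _).trans h2)
    (by positivity : (0 : ℝ) ≤ d + 1)
  have e4 : (n : ℝ) * (((d : ℝ) + 1) * (entropy (fun k => (X k : ℝ) / n) +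
        ∑ k, (X k : ℝ) / n * Real.log (B k.1 k.2)
        - Fintype.card (I × I) * ((1 + Real.log n) / n)) -
      d * (entropy (fun i => (a i : ℝ) / n) + entropy (fun j => (b j : ℝ) / n))) =
      ((d : ℝ) + 1) * (n * entropy (fun k => (X k : ℝ) / n) - Fintype.card (I × I) * (1 + Real.log n)
        + ∑ k, X k * Real.log (B k.1 k.2)) -
      d * (n * entropy (fun i => (a i : ℝ) / n) + n * entropy (fun j => (b j : ℝ) / n)) := by
    linear_combination ((d : ℝ) + 1) * e1 - ((d : ℝ) + 1) * Fintype.card (I × I) * e3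
  rw [e4]
  linarith

end Entropy

end SpinPhase

namespace SpinPhase

/-! ### The growth rate as a dual infimum, attained at Gibbs marginals -/

section Rate

variable {I : Type*} [Fintype I] [DecidableEq I]

set_option linter.unusedSectionVars false

theorem tendsto_one_add_log_div : Tendsto (fun n : ℕ => (1 + Real.log n) / (n : ℝ)) atTop (𝓝 0) := by
  have h1 : Tendsto (fun n : ℕ => (1 : ℝ) / n) atTop (𝓝 0) := tendsto_one_div_atTop_nhds_zero_nat
  have h2 : Tendsto (fun n : ℕ => Real.log n / (n : ℝ)) atTop (𝓝 0) := by
    have := (Real.isLittleO_log_id_atTop.tendsto_div_nhds_zero).comp tendsto_natCast_atTop_atTop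
    exact this
  simpa [add_div] using h1.add h2

theorem continuous_dualRate (d : ℕ) (B : Matrix I I ℝ) (ρ γ : I → ℝ) :
    Continuous fun p : (I → ℝ) × (I → ℝ) => dualRate d B p.1 p.2 ρ γ := by
  have h1 : Continuous fun p : (I → ℝ) × (I → ℝ) => entropy p.1 :=
    continuous_entropy.comp continuous_fst
  have h2 : Continuous fun p : (I → ℝ) × (I → ℝ) => entropy p.2 :=
    continuous_entropy.comp continuous_snd
  unfold dualRate
  fun_prop

theorem Psi1_le_dualRate (d : ℕ) {B : Matrix I I ℝ} (hB : ∀ i j, 0 ≤ B i j) (α β ρ γ : I → ℝ) :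
    Psi1 (d + 1) B α β ≤ (dualRate d B α β ρ γ : EReal) := by
  have hn : Tendsto (fun p : ℕ × (I → ℕ) × (I → ℕ) => p.1) (phaseFilter α β) atTop :=
    tendsto_comap.mono_left inf_le_left
  have ha : Tendsto (fun p : ℕ × (I → ℕ) × (I → ℕ) => fun i => (p.2.1 i : ℝ) / (p.1 : ℝ))
      (phaseFilter α β) (𝓝 α) := tendsto_comap.mono_left (inf_le_right.trans inf_le_left)
  have hb : Tendsto (fun p : ℕ × (I → ℕ) × (I → ℕ) => fun i => (p.2.2 i : ℝ) / (p.1 : ℝ))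
      (phaseFilter α β) (𝓝 β) := tendsto_comap.mono_left (inf_le_right.trans inf_le_right)
  have h1 := ((continuous_dualRate d B ρ γ).tendsto (α, β)).comp (ha.prodMk_nhds hb)
  have h2 := (tendsto_one_add_log_div.comp hn).const_mul (2 * (d : ℝ) * Fintype.card I)
  have h3 := h1.add h2
  rw [mul_zero, add_zero] at h3
  refine EReal.le_of_forall_lt_iff_le.1 fun z hz => ?_
  rw [EReal.coe_lt_coe_iff] at hz
  refine limsup_le_of_le (h := ?_)
  filter_upwards [h3.eventually_lt_const hz, hn.eventually_ge_atTop 1] with p hp hp1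
  obtain ⟨n, a, b⟩ := p
  refine (growthRate_le hp1 hB a b ρ γ).trans ?_
  exact EReal.coe_le_coe_iff.2 (le_of_lt hp)

/-- The edge distribution `B_ij R_i C_j / Rᵀ B C` for `R = exp ρ` and `C = exp γ`. -/
noncomputable def gibbs (B : Matrix I I ℝ) (ρ γ : I → ℝ) (i j : I) : ℝ :=
  Real.exp (ρ i) * B i j * Real.exp (γ j) / ∑ i, ∑ j, Real.exp (ρ i) * B i j * Real.exp (γ j)

theorem gibbs_nonneg {B : Matrix I I ℝ} (hB : ∀ i j, 0 ≤ B i j) (ρ γ : I → ℝ) (i j : I) :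
    0 ≤ gibbs B ρ γ i j := by
  have : ∀ i j, 0 ≤ Real.exp (ρ i) * B i j * Real.exp (γ j) := fun i j => by
    have := hB i j; positivity
  exact div_nonneg (this i j) (Finset.sum_nonneg fun i _ => Finset.sum_nonneg fun j _ => this i j)

theorem partition_pos {B : Matrix I I ℝ} (hB : ∀ i j, 0 ≤ B i j) {i₀ j₀ : I} (h₀ : 0 < B i₀ j₀)
    (ρ γ : I → ℝ) : 0 < ∑ i, ∑ j, Real.exp (ρ i) * B i j * Real.exp (γ j) := by
  have h : ∀ i j, 0 ≤ Real.exp (ρ i) * B i j * Real.exp (γ j) := fun i j => by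
    have := hB i j; positivity
  refine Finset.sum_pos' (fun i _ => Finset.sum_nonneg fun j _ => h i j) ⟨i₀, Finset.mem_univ _, ?_⟩
  exact Finset.sum_pos' (fun j _ => h i₀ j) ⟨j₀, Finset.mem_univ _, by positivity⟩

theorem sum_gibbs {B : Matrix I I ℝ} (hB : ∀ i j, 0 ≤ B i j) {i₀ j₀ : I} (h₀ : 0 < B i₀ j₀)
    (ρ γ : I → ℝ) : ∑ i, ∑ j, gibbs B ρ γ i j = 1 := by
  simp only [gibbs, ← Finset.sum_div]
  exact div_self (partition_pos hB h₀ ρ γ).ne'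

/-- Rounding a probability vector to integer counts with the exact sum n: round down and give the
remainder, which is o(n), to k₀. In the application k₀ is a pair of spins with a positive entry of
B, so the support condition survives. -/
theorem tendsto_floor_fill {K : Type*} [Fintype K] [DecidableEq K] {x : K → ℝ} (hx : ∀ k, 0 ≤ x k)
    (hs : ∑ k, x k = 1) (k₀ : K) :
    ∃ X : ℕ → K → ℕ, (∀ n, ∑ k, X n k = n) ∧ (∀ n k, X n k ≠ 0 → k = k₀ ∨ 0 < x k) ∧
      Tendsto (fun n k => (X n k : ℝ) / n) atTop (𝓝 x) := by
  have hle : ∀ n : ℕ, ∑ k, ⌊x k * n⌋₊ ≤ n := fun n => by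
    have : ∑ k, (⌊x k * n⌋₊ : ℝ) ≤ ∑ k, x k * n := Finset.sum_le_sum fun k _ =>
      Nat.floor_le (by have := hx k; positivity)
    rw [← Finset.sum_mul, hs, one_mul] at this
    exact_mod_cast this
  refine ⟨fun n k => ⌊x k * n⌋₊ + if k = k₀ then n - ∑ k, ⌊x k * n⌋₊ else 0, ?_, ?_, ?_⟩
  · intro n
    rw [Finset.sum_add_distrib, Finset.sum_ite_eq' Finset.univ k₀]
    simp only [Finset.mem_univ, if_true]
    have := hle n
    omega
  · intro n k h
    by_cases hk : k = k₀
    · exact Or.inl hk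
    · right
      simp only [hk, if_false, add_zero] at h
      have h2 := Nat.floor_pos.1 (Nat.pos_of_ne_zero h)
      by_contra h0
      have : x k = 0 := le_antisymm (not_lt.1 h0) (hx k)
      rw [this, zero_mul] at h2
      linarith
  · have hf : ∀ k, Tendsto (fun n : ℕ => (⌊x k * n⌋₊ : ℝ) / n) atTop (𝓝 (x k)) := fun k =>
      (tendsto_nat_floor_mul_div_atTop (hx k)).comp tendsto_natCast_atTop_atTop
    have hr : Tendsto (fun n : ℕ => ((n - ∑ k, ⌊x k * n⌋₊ : ℕ) : ℝ) / n) atTop (𝓝 0) := by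
      have h1 := (tendsto_finsetSum Finset.univ fun k _ => hf k).const_sub 1
      rw [hs, sub_self] at h1
      refine h1.congr' ?_
      filter_upwards [eventually_ge_atTop 1] with n hn
      have hn' : (n : ℝ) ≠ 0 := by positivity
      rw [Nat.cast_sub (hle n), Nat.cast_sum, sub_div, div_self hn', Finset.sum_div]
    rw [tendsto_pi_nhds]
    intro k
    have h2 := (hf k).add (hr.mul_const (if k = k₀ then (1 : ℝ) else 0))
    rw [zero_mul, add_zero] at h2
    refine h2.congr fun n => ?_
    by_cases hk : k = k₀ <;> simp [hk, add_div]

/-- The Gibbs variational principle: the Gibbs edge distribution attains equality between entropy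
plus energy and the dual expression. Its integer roundings are joint types whose marginals converge
to the required phase. -/
theorem dualRate_le_Psi1 (d : ℕ) {B : Matrix I I ℝ} (hB : ∀ i j, 0 ≤ B i j) {i₀ j₀ : I}
    (h₀ : 0 < B i₀ j₀) (ρ γ : I → ℝ) :
    (dualRate d B (fun i => ∑ j, gibbs B ρ γ i j) (fun j => ∑ i, gibbs B ρ γ i j) ρ γ : EReal) ≤
      Psi1 (d + 1) B (fun i => ∑ j, gibbs B ρ γ i j) (fun j => ∑ i, gibbs B ρ γ i j) := by
  set x : I × I → ℝ := fun k => gibbs B ρ γ k.1 k.2 with hx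
  have hx0 : ∀ k, 0 ≤ x k := fun k => gibbs_nonneg hB ρ γ _ _
  have hx1 : ∑ k, x k = 1 := by rw [Fintype.sum_prod_type]; exact sum_gibbs hB h₀ ρ γ
  have hZ := partition_pos hB h₀ ρ γ
  obtain ⟨X, hXn, hXs, hXt⟩ := tendsto_floor_fill hx0 hx1 (i₀, j₀)
  have hXB : ∀ n k, X n k ≠ 0 → 0 < B k.1 k.2 := by
    intro n k h
    rcases hXs n k h with rfl | h
    · exact h₀
    · refine lt_of_le_of_ne (hB _ _) fun h0 => ?_
      simp [hx, gibbs, ← h0] at h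
  set a : ℕ → I → ℕ := fun n i => ∑ j, X n (i, j) with ha
  set b : ℕ → I → ℕ := fun n j => ∑ i, X n (i, j) with hb
  have hat : Tendsto (fun n i => (a n i : ℝ) / n) atTop (𝓝 fun i => ∑ j, gibbs B ρ γ i j) := by
    rw [tendsto_pi_nhds] at hXt ⊢
    intro i
    refine (tendsto_finsetSum Finset.univ fun j _ => hXt (i, j)).congr fun n => ?_
    simp [ha, Finset.sum_div]
  have hbt : Tendsto (fun n i => (b n i : ℝ) / n) atTop (𝓝 fun j => ∑ i, gibbs B ρ γ i j) := by
    rw [tendsto_pi_nhds] at hXt ⊢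
    intro j
    refine (tendsto_finsetSum Finset.univ fun i _ => hXt (i, j)).congr fun n => ?_
    simp [hb, Finset.sum_div]
  have hfil : Tendsto (fun n => (n, a n, b n)) atTop
      (phaseFilter (fun i => ∑ j, gibbs B ρ γ i j) (fun j => ∑ i, gibbs B ρ γ i j)) := by
    refine tendsto_inf.2 ⟨tendsto_comap_iff.2 tendsto_id, tendsto_inf.2 ⟨?_, ?_⟩⟩
    · exact tendsto_comap_iff.2 hat
    · exact tendsto_comap_iff.2 hbt
  have hval : dualRate d B (fun i => ∑ j, gibbs B ρ γ i j) (fun j => ∑ i, gibbs B ρ γ i j) ρ γ =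
      ((d : ℝ) + 1) * (entropy x + ∑ k, x k * Real.log (B k.1 k.2)
        - Fintype.card (I × I) * 0) -
      d * (entropy (fun i => ∑ j, gibbs B ρ γ i j) + entropy (fun j => ∑ i, gibbs B ρ γ i j)) := by
    have e1 : ∑ i, (∑ j, gibbs B ρ γ i j) * ρ i = ∑ k, x k * ρ k.1 := by
      rw [Fintype.sum_prod_type]
      exact Finset.sum_congr rfl fun i _ => by rw [Finset.sum_mul]
    have e2 : ∑ j, (∑ i, gibbs B ρ γ i j) * γ j = ∑ k, x k * γ k.2 := by
      rw [Fintype.sum_prod_type_right]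
      exact Finset.sum_congr rfl fun i _ => by rw [Finset.sum_mul]
    -- On the support log x = ρ + log B + γ - log Z; averaging this against x gives the identity,
    -- and entries with B = 0 contribute nothing on either side.
    have e3 : entropy x + ∑ k, x k * Real.log (B k.1 k.2) =
        logZ B ρ γ - ∑ k, x k * ρ k.1 - ∑ k, x k * γ k.2 := by
      have : logZ B ρ γ = ∑ k, x k * logZ B ρ γ := by rw [← Finset.sum_mul, hx1, one_mul]
      rw [this, entropy, ← Finset.sum_add_distrib, ← Finset.sum_sub_distrib,
        ← Finset.sum_sub_distrib]
      refine Finset.sum_congr rfl fun k _ => ?_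
      rcases (hB k.1 k.2).eq_or_lt with h | h
      · simp [hx, gibbs, ← h]
      · have : Real.log (x k) = ρ k.1 + Real.log (B k.1 k.2) + γ k.2 - logZ B ρ γ := by
          simp only [hx, gibbs]
          rw [Real.log_div (by positivity) hZ.ne', Real.log_mul (by positivity) (by positivity),
            Real.log_mul (by positivity) (by positivity), Real.log_exp, Real.log_exp, logZ]
        rw [Real.negMulLog, this]
        ring
    rw [dualRate, e1, e2, e3]; ring
  have hlim : Tendsto (fun n : ℕ => ((((d : ℝ) + 1) * (entropy (fun k => (X n k : ℝ) / n) +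
        ∑ k, (X n k : ℝ) / n * Real.log (B k.1 k.2)
        - Fintype.card (I × I) * ((1 + Real.log n) / n)) -
      d * (entropy (fun i => (a n i : ℝ) / n) + entropy (fun j => (b n j : ℝ) / n)) : ℝ) : EReal))
      atTop (𝓝 (dualRate d B (fun i => ∑ j, gibbs B ρ γ i j) (fun j => ∑ i, gibbs B ρ γ i j) ρ γ :
        EReal)) := by
    rw [hval]
    refine (continuous_coe_real_ereal.tendsto _).comp ?_
    have t1 := (continuous_entropy.tendsto _).comp hXt
    have t2 : Tendsto (fun n : ℕ => ∑ k, (X n k : ℝ) / n * Real.log (B k.1 k.2)) atTop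
        (𝓝 (∑ k, x k * Real.log (B k.1 k.2))) :=
      tendsto_finsetSum _ fun k _ => ((tendsto_pi_nhds.1 hXt) k).mul_const _
    have t3 := (continuous_entropy.tendsto _).comp hat
    have t4 := (continuous_entropy.tendsto _).comp hbt
    exact (((t1.add t2).sub (tendsto_one_add_log_div.const_mul _)).const_mul _).sub
      ((t3.add t4).const_mul _)
  rw [← hlim.limsup_eq]
  calc _ ≤ limsup (fun n => growthRate (d + 1) B (n, a n, b n)) atTop := by
        refine limsup_le_limsup ?_
        filter_upwards [eventually_ge_atTop 1] with n hn
        exact le_growthRate hn hB (hXn n) (hXB n)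
    _ = limsup (growthRate (d + 1) B) (map (fun n => (n, a n, b n)) atTop) := rfl
    _ ≤ _ := limsup_le_limsup_of_le hfil

theorem Psi1_eq_dualRate (d : ℕ) {B : Matrix I I ℝ} (hB : ∀ i j, 0 ≤ B i j) {i₀ j₀ : I}
    (h₀ : 0 < B i₀ j₀) {α β ρ γ : I → ℝ} (hα : ∀ i, ∑ j, gibbs B ρ γ i j = α i)
    (hβ : ∀ j, ∑ i, gibbs B ρ γ i j = β j) :
    Psi1 (d + 1) B α β = (dualRate d B α β ρ γ : EReal) := by
  obtain rfl : (fun i => ∑ j, gibbs B ρ γ i j) = α := funext hα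
  obtain rfl : (fun j => ∑ i, gibbs B ρ γ i j) = β := funext hβ
  exact le_antisymm (Psi1_le_dualRate d hB _ _ _ _) (dualRate_le_Psi1 d hB h₀ _ _)

end Rate

end SpinPhase

namespace SpinPhase

/-! ### Second-order tests and exponential sums -/

section Calculus

/-- The difference φ - g has a local maximum at 0. If its second derivative there were positive, 0
would also be a local minimum, so the difference would be locally constant with second derivative 0,
a contradiction. -/
theorem deriv_deriv_le_of_eventually_le {φ g g' : ℝ → ℝ} {g₂ : ℝ}
    (hφ : ∀ᶠ s in 𝓝 0, DifferentiableAt ℝ φ s) (hφ₂ : DifferentiableAt ℝ (deriv φ) 0)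
    (hg : ∀ᶠ s in 𝓝 0, HasDerivAt g (g' s) s) (hg₂ : HasDerivAt g' g₂ 0)
    (hle : ∀ᶠ s in 𝓝 0, φ s ≤ g s) (h0 : φ 0 = g 0) :
    deriv φ 0 = g' 0 ∧ deriv (deriv φ) 0 ≤ g₂ := by
  set ψ : ℝ → ℝ := fun s => φ s - g s with hψ
  have hmax : IsLocalMax ψ 0 := by
    filter_upwards [hle] with s hs
    simp only [hψ, h0, sub_self]
    linarith
  have hd : deriv ψ =ᶠ[𝓝 0] fun s => deriv φ s - g' s := by
    filter_upwards [hφ, hg] with s h1 h2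
    exact (h1.hasDerivAt.sub h2).deriv
  have h1 := hmax.deriv_eq_zero
  rw [hd.self_of_nhds, sub_eq_zero] at h1
  refine ⟨h1, ?_⟩
  have h2 : deriv (deriv ψ) 0 = deriv (deriv φ) 0 - g₂ := by
    rw [hd.deriv_eq]
    exact (hφ₂.hasDerivAt.sub hg₂).deriv
  by_contra hlt
  push Not at hlt
  have hmin : IsLocalMin ψ 0 := isLocalMin_of_deriv_deriv_pos (by rw [h2]; linarith)
    hmax.deriv_eq_zero (hφ.self_of_nhds.continuousAt.sub hg.self_of_nhds.continuousAt)
  have hc : ψ =ᶠ[𝓝 0] fun _ => ψ 0 := by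
    filter_upwards [hmax, hmin] with s h3 h4
    exact le_antisymm h3 h4
  have h5 : deriv (deriv ψ) 0 = 0 := by
    rw [hc.deriv.deriv_eq]; simp
  linarith

variable {E : Type*} [NormedAddCommGroup E] [NormedSpace ℝ E]

theorem hasDerivAt_comp_smul {h : E → ℝ} {w : E} {s : ℝ} (hd : DifferentiableAt ℝ h (s • w)) :
    HasDerivAt (fun s : ℝ => h (s • w)) (fderiv ℝ h (s • w) w) s := by
  have h1 : HasDerivAt (fun s : ℝ => s • w) w s := by
    simpa using (hasDerivAt_id s).smul_const w
  exact hd.hasFDerivAt.comp_hasDerivAt s h1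

theorem tendsto_smul_zero (w : E) : Tendsto (fun s : ℝ => s • w) (𝓝 0) (𝓝 0) := by
  have : Continuous fun s : ℝ => s • w := by fun_prop
  simpa using this.tendsto 0

theorem eventually_differentiableAt_of_contDiffAt {h : E → ℝ} (hc : ContDiffAt ℝ 2 h 0) :
    ∀ᶠ x in 𝓝 0, DifferentiableAt ℝ h x := by
  filter_upwards [hc.eventually (by simp)] with x hx
  exact hx.differentiableAt (by simp)

theorem differentiableAt_fderiv_of_contDiffAt {h : E → ℝ} (hc : ContDiffAt ℝ 2 h 0) :
    DifferentiableAt ℝ (fderiv ℝ h) 0 :=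
  (hc.fderiv_right (m := 1) (by norm_num)).differentiableAt (by simp)

/-- A function that is touched from above, along each line, by a function with a strict
nondegenerate maximum has vanishing gradient and negative definite second derivative. -/
theorem fderiv_eq_zero_and_second_neg {h : E → ℝ} (hc : ContDiffAt ℝ 2 h 0)
    (htouch : ∀ w : E, w ≠ 0 → ∃ (g g' : ℝ → ℝ) (g₂ : ℝ), (∀ᶠ s in 𝓝 0, HasDerivAt g (g' s) s) ∧
      HasDerivAt g' g₂ 0 ∧ (∀ᶠ s : ℝ in 𝓝 0, h (s • w) ≤ g s) ∧ h 0 = g 0 ∧ g' 0 = 0 ∧ g₂ < 0) :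
    fderiv ℝ h 0 = 0 ∧ ∀ w : E, w ≠ 0 → fderiv ℝ (fderiv ℝ h) 0 w w < 0 := by
  have key : ∀ w : E, w ≠ 0 → fderiv ℝ h 0 w = 0 ∧ fderiv ℝ (fderiv ℝ h) 0 w w < 0 := by
    intro w hw
    obtain ⟨g, g', g₂, hg, hg₂, hle, h0, hg0, hneg⟩ := htouch w hw
    have e1 : ∀ᶠ s : ℝ in 𝓝 0, HasDerivAt (fun s : ℝ => h (s • w)) (fderiv ℝ h (s • w) w) s := by
      filter_upwards [(tendsto_smul_zero w).eventually (eventually_differentiableAt_of_contDiffAt hc)]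
        with s hs
      exact hasDerivAt_comp_smul hs
    have e2 : deriv (fun s : ℝ => h (s • w)) =ᶠ[𝓝 0] fun s => fderiv ℝ h (s • w) w := by
      filter_upwards [e1] with s hs
      exact hs.deriv
    have e3 : HasDerivAt (fun s : ℝ => fderiv ℝ h (s • w) w) (fderiv ℝ (fderiv ℝ h) 0 w w) 0 := by
      have h1 : HasDerivAt (fun s : ℝ => s • w) w 0 := by
        simpa using (hasDerivAt_id (0 : ℝ)).smul_const w
      have h2 : HasFDerivAt (fderiv ℝ h) (fderiv ℝ (fderiv ℝ h) 0) ((0 : ℝ) • w) := by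
        rw [zero_smul]
        exact (differentiableAt_fderiv_of_contDiffAt hc).hasFDerivAt
      have h3 := h2.comp_hasDerivAt (0 : ℝ) h1
      have h4 := h3.clm_apply (hasDerivAt_const (0 : ℝ) w)
      simpa using h4
    have e4 := deriv_deriv_le_of_eventually_le (e1.mono fun s hs => hs.differentiableAt)
      (e3.differentiableAt.congr_of_eventuallyEq e2) hg hg₂ hle (by simpa using h0)
    rw [e2.deriv_eq, e3.deriv, e2.self_of_nhds, hg0] at e4
    simp only [zero_smul] at e4
    exact ⟨e4.1, e4.2.trans_lt hneg⟩
  refine ⟨?_, fun w hw => (key w hw).2⟩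
  ext w
  by_cases hw : w = 0
  · simp [hw]
  · simpa using (key w hw).1

/-- Compactness of the unit sphere makes the negative definiteness uniform. Differentiability of the
gradient at 0 then makes the radial derivative nonpositive on a small ball, so h decreases along
every segment from 0. -/
theorem isLocalMax_of_second_neg [FiniteDimensional ℝ E] {h : E → ℝ} (hc : ContDiffAt ℝ 2 h 0)
    (h1 : fderiv ℝ h 0 = 0) (h2 : ∀ w : E, w ≠ 0 → fderiv ℝ (fderiv ℝ h) 0 w w < 0) :
    IsLocalMax h 0 := by
  have : ProperSpace E := FiniteDimensional.proper ℝ E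
  set A := fderiv ℝ (fderiv ℝ h) 0 with hA
  obtain ⟨c, hc0, hcA⟩ : ∃ c > 0, ∀ w : E, A w w ≤ -c * ‖w‖ ^ 2 := by
    rcases subsingleton_or_nontrivial E with hE | hE
    · exact ⟨1, one_pos, fun w => by simp [Subsingleton.elim w 0]⟩
    obtain ⟨w₀, hw₀, hmax⟩ := (isCompact_sphere (0 : E) 1).exists_isMaxOn
      (NormedSpace.sphere_nonempty.2 zero_le_one) (f := fun w => A w w) (by fun_prop)
    have hw₀' : w₀ ≠ 0 := by
      rintro rfl; simp at hw₀
    refine ⟨-A w₀ w₀, by linarith [h2 w₀ hw₀'], fun w => ?_⟩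
    by_cases hw : w = 0
    · simp [hw]
    have hn : 0 < ‖w‖ := norm_pos_iff.2 hw
    have := hmax (show ‖w‖⁻¹ • w ∈ Metric.sphere (0 : E) 1 by
      simp [norm_smul, hn.ne'])
    rw [Set.mem_ofPred_eq] at this
    simp only [map_smul, smul_apply, smul_eq_mul] at this
    have h3 : ‖w‖⁻¹ * (‖w‖⁻¹ * A w w) * ‖w‖ ^ 2 = A w w := by field_simp
    have h4 := mul_le_mul_of_nonneg_right this (sq_nonneg ‖w‖)
    rw [neg_neg]
    linarith [h3]
  have ho := (differentiableAt_fderiv_of_contDiffAt hc).hasFDerivAt.isLittleO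
  have ho' := ho.def (half_pos hc0)
  obtain ⟨ε, hε, hball⟩ := Metric.eventually_nhds_iff_ball.1
    (ho'.and (eventually_differentiableAt_of_contDiffAt hc))
  filter_upwards [Metric.ball_mem_nhds (0 : E) hε] with w hw
  have hmem : ∀ s ∈ Set.Icc (0 : ℝ) 1, s • w ∈ Metric.ball (0 : E) ε := by
    intro s hs
    rw [mem_ball_zero_iff] at hw ⊢
    rw [norm_smul, Real.norm_of_nonneg hs.1]
    nlinarith [hs.2, norm_nonneg w]
  have hder : ∀ s ∈ Set.Icc (0 : ℝ) 1,
      HasDerivAt (fun s : ℝ => h (s • w)) (fderiv ℝ h (s • w) w) s := fun s hs =>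
    hasDerivAt_comp_smul (hball _ (hmem s hs)).2
  have hanti : AntitoneOn (fun s : ℝ => h (s • w)) (Set.Icc 0 1) := by
    refine antitoneOn_of_deriv_nonpos (convex_Icc 0 1)
      (fun s hs => (hder s hs).continuousAt.continuousWithinAt)
      (fun s hs => ((hder s (interior_subset hs)).differentiableAt).differentiableWithinAt) ?_
    intro s hs
    rw [interior_Icc] at hs
    rw [(hder s ⟨hs.1.le, hs.2.le⟩).deriv]
    have h3 := (hball _ (hmem s ⟨hs.1.le, hs.2.le⟩)).1
    simp only [h1, sub_zero] at h3
    have h4 := (fderiv ℝ h (s • w) - A (s • w)).le_opNorm (s • w)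
    have h5 := (Real.le_norm_self _).trans (h4.trans (mul_le_mul_of_nonneg_right h3 (norm_nonneg _)))
    have h6 := hcA (s • w)
    simp only [sub_apply] at h5
    have h7 : fderiv ℝ h (s • w) (s • w) ≤ 0 := by
      nlinarith [sq_nonneg ‖s • w‖]
    rw [map_smul, smul_eq_mul] at h7
    exact nonpos_of_mul_nonpos_right h7 hs.1
  have := hanti (Set.left_mem_Icc.2 zero_le_one) (Set.right_mem_Icc.2 zero_le_one) zero_le_one
  simpa using this

/-- The first two derivatives of the logarithm of an exponential sum. -/
theorem hasDerivAt_sum_mul_exp {K : Type*} [Fintype K] (c l : K → ℝ) (s : ℝ) :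
    HasDerivAt (fun s => ∑ k, c k * Real.exp (s * l k)) (∑ k, c k * l k * Real.exp (s * l k)) s := by
  refine HasDerivAt.fun_sum fun k _ => ?_
  have h1 : HasDerivAt (fun s : ℝ => s * l k) (l k) s := by
    simpa using (hasDerivAt_id s).mul_const (l k)
  exact ((h1.exp).const_mul (c k)).congr_deriv (by ring)

theorem hasDerivAt_logSumExp {K : Type*} [Fintype K] {c : K → ℝ} (l : K → ℝ)
    (hpos : ∀ s : ℝ, 0 < ∑ k, c k * Real.exp (s * l k)) (s : ℝ) :
    HasDerivAt (fun s => Real.log (∑ k, c k * Real.exp (s * l k)))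
      ((∑ k, c k * l k * Real.exp (s * l k)) / ∑ k, c k * Real.exp (s * l k)) s :=
  (hasDerivAt_sum_mul_exp c l s).log (hpos s).ne'

/-- The second derivative of a logarithm of an exponential sum is the variance of l under the
weights c. -/
theorem hasDerivAt_logSumExp_deriv {K : Type*} [Fintype K] {c : K → ℝ} (l : K → ℝ)
    (hpos : ∀ s : ℝ, 0 < ∑ k, c k * Real.exp (s * l k)) :
    HasDerivAt (fun s => (∑ k, c k * l k * Real.exp (s * l k)) / ∑ k, c k * Real.exp (s * l k))
      ((∑ k, c k * l k ^ 2) / (∑ k, c k) - ((∑ k, c k * l k) / ∑ k, c k) ^ 2) 0 := by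
  have h1 := hasDerivAt_sum_mul_exp (fun k => c k * l k) l 0
  have h2 := hasDerivAt_sum_mul_exp c l 0
  have h3 := h1.div h2 (hpos 0).ne'
  have h0 := (hpos 0).ne'
  simp only [zero_mul, Real.exp_zero, mul_one] at h3 h0
  refine h3.congr_deriv ?_
  have e : ∑ k, c k * l k * l k = ∑ k, c k * l k ^ 2 :=
    Finset.sum_congr rfl fun k _ => by ring
  rw [e]
  field_simp

theorem variance_pos {K : Type*} [Fintype K] {c l : K → ℝ} (hc : ∀ k, 0 ≤ c k) (hs : 0 < ∑ k, c k)
    (h : ¬ ∃ m, ∀ k, 0 < c k → l k = m) :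
    0 < (∑ k, c k * l k ^ 2) / (∑ k, c k) - ((∑ k, c k * l k) / ∑ k, c k) ^ 2 := by
  set Z := ∑ k, c k with hZ
  set m := (∑ k, c k * l k) / Z with hm
  have h1 : (∑ k, c k * l k ^ 2) / Z - m ^ 2 = (∑ k, c k * (l k - m) ^ 2) / Z := by
    have e : ∑ k, c k * (l k - m) ^ 2 = ∑ k, c k * l k ^ 2 - 2 * m * ∑ k, c k * l k + m ^ 2 * Z := by
      rw [hZ, Finset.mul_sum, Finset.mul_sum, ← Finset.sum_sub_distrib, ← Finset.sum_add_distrib]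
      exact Finset.sum_congr rfl fun k _ => by ring
    have e2 : ∑ k, c k * l k = m * Z := by rw [hm]; field_simp
    rw [e, e2]
    field_simp
    ring
  rw [h1]
  push Not at h
  obtain ⟨k, hk, hk'⟩ := h m
  refine div_pos (Finset.sum_pos' (fun k _ => mul_nonneg (hc k) (sq_nonneg _))
    ⟨k, Finset.mem_univ _, mul_pos hk (by positivity [sub_ne_zero.2 hk'])⟩) hs

end Calculus

end SpinPhase

namespace SpinPhase

/-! ### Smooth local inversion of the map to marginals -/

section Smooth

variable {I : Type*} [Fintype I] [DecidableEq I]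

set_option linter.unusedSectionVars false

/-- The two marginals of the edge distribution. -/
noncomputable def marginals (B : Matrix I I ℝ) (p : (I → ℝ) × (I → ℝ)) : (I → ℝ) × (I → ℝ) :=
  (fun i => ∑ j, gibbs B p.1 p.2 i j, fun j => ∑ i, gibbs B p.1 p.2 i j)

theorem contDiff_gibbs {B : Matrix I I ℝ} (hB : ∀ i j, 0 ≤ B i j) {i₀ j₀ : I} (h₀ : 0 < B i₀ j₀)
    (i j : I) : ContDiff ℝ 2 fun p : (I → ℝ) × (I → ℝ) => gibbs B p.1 p.2 i j := by
  unfold gibbs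
  refine ContDiff.div (by fun_prop) (by fun_prop) fun p => (partition_pos hB h₀ _ _).ne'

theorem contDiff_marginals {B : Matrix I I ℝ} (hB : ∀ i j, 0 ≤ B i j) {i₀ j₀ : I}
    (h₀ : 0 < B i₀ j₀) : ContDiff ℝ 2 (marginals B) := by
  unfold marginals
  refine ContDiff.prodMk (contDiff_pi.2 fun i => ?_) (contDiff_pi.2 fun j => ?_)
  · exact ContDiff.sum fun j _ => contDiff_gibbs hB h₀ i j
  · exact ContDiff.sum fun i _ => contDiff_gibbs hB h₀ i j

theorem exp_mul_exp_add (B : Matrix I I ℝ) (ρ γ ξ η : I → ℝ) (s : ℝ) (i j : I) :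
    Real.exp ((ρ + s • ξ) i) * B i j * Real.exp ((γ + s • η) j) =
      Real.exp (ρ i) * B i j * Real.exp (γ j) * Real.exp (s * (ξ i + η j)) := by
  simp only [Pi.add_apply, Pi.smul_apply, smul_eq_mul, Real.exp_add, mul_add]
  ring

/-- Along a line, `∑ ξ_i α_i + ∑ η_j β_j` for the marginals `α`, `β` has positive derivative. -/
theorem exists_hasDerivAt_pairing_marginals {B : Matrix I I ℝ} (hB : ∀ i j, 0 ≤ B i j) {i₀ : I}
    (hr : ∀ j, 0 < B i₀ j) (hc : ∀ i, 0 < B i i₀) (ρ γ : I → ℝ) {w : tangent I} (hw : w ≠ 0) :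
    ∃ v > 0, HasDerivAt (fun s : ℝ => ∑ i, w.1.1 i * (marginals B ((ρ, γ) + s • w.1)).1 i +
      ∑ j, w.1.2 j * (marginals B ((ρ, γ) + s • w.1)).2 j) v 0 := by
  set ξ := w.1.1 with hξ
  set η := w.1.2 with hη
  set c : I × I → ℝ := fun k => Real.exp (ρ k.1) * B k.1 k.2 * Real.exp (γ k.2) with hcdef
  set l : I × I → ℝ := fun k => ξ k.1 + η k.2 with hl
  have hc0 : ∀ k, 0 ≤ c k := fun k => by have := hB k.1 k.2; simp only [hcdef]; positivity
  have hZ : ∀ s : ℝ, ∑ i, ∑ j, Real.exp ((ρ + s • ξ) i) * B i j * Real.exp ((γ + s • η) j) =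
      ∑ k, c k * Real.exp (s * l k) := fun s => by
    rw [Fintype.sum_prod_type]
    exact Finset.sum_congr rfl fun i _ => Finset.sum_congr rfl fun j _ => exp_mul_exp_add ..
  have hpos : ∀ s : ℝ, 0 < ∑ k, c k * Real.exp (s * l k) := fun s => by
    rw [← hZ]; exact partition_pos hB (hr i₀) _ _
  have hZ0 : 0 < ∑ k, c k := by simpa using hpos 0
  refine ⟨_, variance_pos (l := l) hc0 hZ0 ?_, (hasDerivAt_logSumExp_deriv l hpos).congr_of_eventuallyEq ?_⟩
  -- The derivative is the variance of ξ_i + η_j over edges. Zero variance makes this sum constant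
  -- on the support of B; row i₀ and column i₀ are positive, so ξ and η are each constant, and
  -- tangency makes them 0.
  · rintro ⟨m, hm⟩
    have h1 : ∀ j, ξ i₀ + η j = m := fun j => hm (i₀, j) (by
      have := hr j; simp only [hcdef]; positivity)
    have h2 : ∀ i, ξ i + η i₀ = m := fun i => hm (i, i₀) (by
      have := hc i; simp only [hcdef]; positivity)
    have h3 : ∀ i, ξ i = ξ i₀ := fun i => by linarith [h2 i, h2 i₀]
    have h4 : ∀ j, η j = η i₀ := fun j => by linarith [h1 j, h1 i₀]
    have hs1 : ∑ i, ξ i = 0 := w.2.1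
    have hs2 : ∑ i, η i = 0 := w.2.2
    have hcard : (Fintype.card I : ℝ) ≠ 0 := by
      have : Nonempty I := ⟨i₀⟩
      exact_mod_cast Fintype.card_ne_zero
    rw [Finset.sum_congr rfl fun i _ => h3 i] at hs1
    rw [Finset.sum_congr rfl fun i _ => h4 i] at hs2
    simp only [Finset.sum_const, Finset.card_univ, nsmul_eq_mul, mul_eq_zero, hcard, false_or]
      at hs1 hs2
    refine hw (Subtype.ext (Prod.ext (funext fun i => ?_) (funext fun i => ?_)))
    · rw [← hξ, h3, hs1]; rfl
    · rw [← hη, h4, hs2]; rfl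
  · refine Eventually.of_forall fun s => ?_
    have hg : ∀ i j, gibbs B (ρ + s • ξ) (γ + s • η) i j =
        c (i, j) * Real.exp (s * l (i, j)) / ∑ k, c k * Real.exp (s * l k) := fun i j => by
      rw [gibbs, hZ, exp_mul_exp_add]
    have hm1 : (marginals B ((ρ, γ) + s • w.1)).1 = fun i => ∑ j, gibbs B (ρ + s • ξ) (γ + s • η) i j :=
      rfl
    have hm2 : (marginals B ((ρ, γ) + s • w.1)).2 = fun j => ∑ i, gibbs B (ρ + s • ξ) (γ + s • η) i j :=
      rfl
    simp only [hm1, hm2, hg]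
    generalize ∑ k, c k * Real.exp (s * l k) = Z
    rw [Finset.sum_div, Fintype.sum_prod_type]
    simp only [Finset.mul_sum]
    rw [Finset.sum_comm (f := fun (j i : I) => η j *
      (c (i, j) * Real.exp (s * l (i, j)) / Z)),
      ← Finset.sum_add_distrib]
    refine Finset.sum_congr rfl fun i _ => ?_
    rw [← Finset.sum_add_distrib]
    refine Finset.sum_congr rfl fun j _ => ?_
    simp only [hl]
    ring

/-- The marginals of the edge distribution can be prescribed near a given point, smoothly. -/
theorem exists_marginals_inverse {B : Matrix I I ℝ} (hB : ∀ i j, 0 ≤ B i j) {i₀ : I}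
    (hr : ∀ j, 0 < B i₀ j) (hc : ∀ i, 0 < B i i₀) (ρ γ : I → ℝ) :
    ∃ F : tangent I → tangent I, ContDiffAt ℝ 2 F 0 ∧ F 0 = 0 ∧
      ∀ᶠ w in 𝓝 (0 : tangent I), marginals B ((ρ, γ) + (F w).1) = marginals B (ρ, γ) + w.1 := by
  -- P is a linear projection to the tangent space. Differences of marginals already lie there, so P
  -- only changes the type and makes the map an endomorphism, to which the inverse function theorem
  -- applies.
  obtain ⟨P, hP⟩ := LinearMap.exists_leftInverse_of_injective (tangent I).subtype
    (Submodule.ker_subtype _)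
  have hP' : ∀ w : tangent I, P w.1 = w := fun w => LinearMap.congr_fun hP w
  set Pc : ((I → ℝ) × (I → ℝ)) →L[ℝ] tangent I := LinearMap.toContinuousLinearMap P with hPc
  set G : tangent I → tangent I := fun w =>
    Pc (marginals B ((ρ, γ) + w.1) - marginals B (ρ, γ)) with hG
  have hsum : ∀ p, ∑ i, (marginals B p).1 i = 1 ∧ ∑ i, (marginals B p).2 i = 1 := fun p => by
    refine ⟨sum_gibbs hB (hr i₀) p.1 p.2, ?_⟩
    simp only [marginals]
    rw [Finset.sum_comm]
    exact sum_gibbs hB (hr i₀) p.1 p.2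
  have hGval : ∀ w, (G w).1 = marginals B ((ρ, γ) + w.1) - marginals B (ρ, γ) := fun w => by
    have hmem : marginals B ((ρ, γ) + w.1) - marginals B (ρ, γ) ∈ tangent I := by
      constructor
      · simp [Finset.sum_sub_distrib, hsum]
      · simp [Finset.sum_sub_distrib, hsum]
    exact congrArg Subtype.val (hP' ⟨_, hmem⟩)
  have hGc : ContDiff ℝ 2 G := by
    refine Pc.contDiff.comp (ContDiff.sub ?_ contDiff_const)
    exact (contDiff_marginals hB (hr i₀)).comp
      (contDiff_const.add (tangent I).subtypeL.contDiff)
  have hG0 : G 0 = 0 := by simp [hG]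
  have hGd : HasFDerivAt G (fderiv ℝ G 0) 0 :=
    (hGc.differentiable (by simp) 0).hasFDerivAt
  -- If the derivative killed w, pairing the marginals with w would have derivative 0 along w,
  -- whereas it is a positive variance.
  have hinj : Function.Injective (fderiv ℝ G 0 : tangent I →ₗ[ℝ] tangent I) := by
    refine (injective_iff_map_eq_zero _).2 fun w h0 => ?_
    by_contra hw
    obtain ⟨v, hv, hder⟩ := exists_hasDerivAt_pairing_marginals hB hr hc ρ γ hw
    have h1 : HasDerivAt (fun s : ℝ => s • w) w 0 := by
      simpa using (hasDerivAt_id (0 : ℝ)).smul_const w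
    have h2 : HasDerivAt (fun s : ℝ => G (s • w)) (fderiv ℝ G 0 w) 0 := by
      have h3 : HasFDerivAt G (fderiv ℝ G 0) ((0 : ℝ) • w) := by rwa [zero_smul]
      exact h3.comp_hasDerivAt (0 : ℝ) h1
    have h0' : fderiv ℝ G 0 w = 0 := h0
    rw [h0'] at h2
    have h4 : HasDerivAt (fun s : ℝ => ((G (s • w)).1 : (I → ℝ) × (I → ℝ))) 0 0 := by
      exact (((tangent I).subtypeL.hasFDerivAt (x := G ((0 : ℝ) • w))).comp_hasDerivAt
        (0 : ℝ) h2).congr_deriv (map_zero _)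
    have h5 : ∀ i, HasDerivAt (fun s : ℝ => (G (s • w)).1.1 i) 0 0 := fun i =>
      (hasDerivAt_pi.1 (hasFDerivAt_fst.comp_hasDerivAt (0 : ℝ) h4)) i
    have h6 : ∀ i, HasDerivAt (fun s : ℝ => (G (s • w)).1.2 i) 0 0 := fun i =>
      (hasDerivAt_pi.1 (hasFDerivAt_snd.comp_hasDerivAt (0 : ℝ) h4)) i
    have h7 : HasDerivAt (fun s : ℝ => ∑ i, w.1.1 i * (G (s • w)).1.1 i +
        ∑ j, w.1.2 j * (G (s • w)).1.2 j) 0 0 := by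
      exact ((HasDerivAt.fun_sum fun i (_ : i ∈ Finset.univ) => (h5 i).const_mul (w.1.1 i)).add
        (HasDerivAt.fun_sum fun i (_ : i ∈ Finset.univ) => (h6 i).const_mul (w.1.2 i))).congr_deriv
        (by simp)
    have h8 : (fun s : ℝ => ∑ i, w.1.1 i * (marginals B ((ρ, γ) + s • w.1)).1 i +
        ∑ j, w.1.2 j * (marginals B ((ρ, γ) + s • w.1)).2 j) = fun s : ℝ =>
        (∑ i, w.1.1 i * (G (s • w)).1.1 i + ∑ j, w.1.2 j * (G (s • w)).1.2 j) +
        (∑ i, w.1.1 i * (marginals B (ρ, γ)).1 i + ∑ j, w.1.2 j * (marginals B (ρ, γ)).2 j) := by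
      funext s
      simp only [hGval, Prod.fst_sub, Prod.snd_sub, Pi.sub_apply, mul_sub, Finset.sum_sub_distrib,
        Submodule.coe_smul]
      ring
    rw [h8] at hder
    exact hv.ne' (hder.unique (h7.add_const _))
  set e : tangent I ≃L[ℝ] tangent I :=
    (LinearEquiv.ofInjectiveEndo (fderiv ℝ G 0 : tangent I →ₗ[ℝ] tangent I)
      hinj).toContinuousLinearEquiv with he
  have hGe : HasFDerivAt G (e : tangent I →L[ℝ] tangent I) 0 := by
    convert! hGd using 1
  have hGat : ContDiffAt ℝ 2 G 0 := hGc.contDiffAt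
  refine ⟨hGat.localInverse hGe (by simp), ?_, ?_, ?_⟩
  · have := hGat.to_localInverse hGe (by simp)
    rwa [hG0] at this
  · have := hGat.localInverse_apply_image hGe (by simp)
    rwa [hG0] at this
  · have := (hGat.hasStrictFDerivAt' hGe (by simp)).eventually_right_inverse
    rw [hG0] at this
    filter_upwards [this] with w hw
    have h1 := hGval (hGat.localInverse hGe (by simp) w)
    have h2 : G (hGat.localInverse hGe (by simp) w) = w := hw
    rw [h2] at h1
    rw [h1]
    abel

end Smooth

end SpinPhase

namespace SpinPhase

/-! ### Nondegenerate maxima of the growth rate from a spectral bound -/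

section Hessian

variable {I : Type*} [Fintype I] [DecidableEq I]

set_option linter.unusedSectionVars false

/-- The part of `dualRate` that depends on one side only. -/
noncomputable def sideRate (d : ℕ) (α ρ : I → ℝ) : ℝ :=
  -d * entropy α - ((d : ℝ) + 1) * ∑ i, α i * ρ i

theorem dualRate_eq_sideRate (d : ℕ) (B : Matrix I I ℝ) (α β ρ γ : I → ℝ) :
    dualRate d B α β ρ γ = sideRate d α ρ + sideRate d β γ + ((d : ℝ) + 1) * logZ B ρ γ := by
  simp only [dualRate, sideRate]
  ring

theorem hasDerivAt_add_mul (a u s : ℝ) : HasDerivAt (fun s : ℝ => a + s * u) u s := by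
  simpa using ((hasDerivAt_id s).mul_const u).const_add a

theorem hasDerivAt_sideRate_line (d : ℕ) {α ρ u ξ : I → ℝ} {s : ℝ} (h : ∀ i, α i + s * u i ≠ 0) :
    HasDerivAt (fun s : ℝ => sideRate d (α + s • u) (ρ + s • ξ))
      (∑ i, (d * ((Real.log (α i + s * u i) + 1) * u i) -
        ((d : ℝ) + 1) * (u i * (ρ i + s * ξ i) + (α i + s * u i) * ξ i))) s := by
  have e : (fun s : ℝ => sideRate d (α + s • u) (ρ + s • ξ)) = fun s : ℝ =>
      ∑ i, (-d * Real.negMulLog (α i + s * u i) -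
        ((d : ℝ) + 1) * ((α i + s * u i) * (ρ i + s * ξ i))) := by
    funext s
    simp [sideRate, entropy, Finset.sum_sub_distrib, Finset.mul_sum]
  rw [e]
  refine HasDerivAt.fun_sum fun i _ => ?_
  have h1 := hasDerivAt_add_mul (α i) (u i) s
  have h2 := hasDerivAt_add_mul (ρ i) (ξ i) s
  have h3 := (Real.hasDerivAt_negMulLog (h i)).comp s h1
  exact ((h3.const_mul (-(d : ℝ))).sub ((h1.mul h2).const_mul ((d : ℝ) + 1))).congr_deriv (by ring)

theorem hasDerivAt_sideRate_line_deriv (d : ℕ) {α ρ u ξ : I → ℝ} (h : ∀ i, α i ≠ 0) :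
    HasDerivAt (fun s : ℝ => ∑ i, (d * ((Real.log (α i + s * u i) + 1) * u i) -
        ((d : ℝ) + 1) * (u i * (ρ i + s * ξ i) + (α i + s * u i) * ξ i)))
      (∑ i, (d * u i ^ 2 / α i - 2 * ((d : ℝ) + 1) * (u i * ξ i))) 0 := by
  refine HasDerivAt.fun_sum fun i _ => ?_
  have h1 := hasDerivAt_add_mul (α i) (u i) 0
  have h2 := hasDerivAt_add_mul (ρ i) (ξ i) 0
  have h3 := h1.log (by simpa using h i)
  refine ((((h3.add_const 1).mul_const (u i)).const_mul (d : ℝ)).sub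
    (((h2.const_mul (u i)).add (h1.mul_const (ξ i))).const_mul ((d : ℝ) + 1))).congr_deriv ?_
  have := h i
  simp only [zero_mul, add_zero]
  field_simp
  ring

theorem contDiffAt_dualRate {d : ℕ} {B : Matrix I I ℝ} (hB : ∀ i j, 0 ≤ B i j) {i₀ j₀ : I}
    (h₀ : 0 < B i₀ j₀) {E : Type*} [NormedAddCommGroup E] [NormedSpace ℝ E] {a b r c : E → I → ℝ}
    {x : E} (ha : ContDiffAt ℝ 2 a x) (hb : ContDiffAt ℝ 2 b x) (hr : ContDiffAt ℝ 2 r x)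
    (hc : ContDiffAt ℝ 2 c x) (ha0 : ∀ i, a x i ≠ 0) (hb0 : ∀ i, b x i ≠ 0) :
    ContDiffAt ℝ 2 (fun y => dualRate d B (a y) (b y) (r y) (c y)) x := by
  have ha' := contDiffAt_pi.1 ha
  have hb' := contDiffAt_pi.1 hb
  have hr' := contDiffAt_pi.1 hr
  have hc' := contDiffAt_pi.1 hc
  have hent : ∀ {f : E → I → ℝ}, (∀ i, ContDiffAt ℝ 2 (fun y => f y i) x) → (∀ i, f x i ≠ 0) →
      ContDiffAt ℝ 2 (fun y => entropy (f y)) x := by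
    intro f hf hf0
    unfold entropy Real.negMulLog
    exact ContDiffAt.sum fun i _ => ((hf i).neg).mul ((hf i).log (hf0 i))
  have hZ : ContDiffAt ℝ 2 (fun y => logZ B (r y) (c y)) x := by
    unfold logZ
    refine ContDiffAt.log ?_ (partition_pos hB h₀ _ _).ne'
    exact ContDiffAt.sum fun i _ => ContDiffAt.sum fun j _ =>
      ((hr' i).exp.mul contDiffAt_const).mul (hc' j).exp
  unfold dualRate
  refine (contDiffAt_const.mul ((hent ha' ha0).add (hent hb' hb0))).add
    (contDiffAt_const.mul ((hZ.sub ?_).sub ?_))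
  · exact ContDiffAt.sum fun i _ => (ha' i).mul (hr' i)
  · exact ContDiffAt.sum fun i _ => (hb' i).mul (hc' i)

theorem logZ_line (B : Matrix I I ℝ) (ρ γ ξ η : I → ℝ) (s : ℝ) :
    logZ B (ρ + s • ξ) (γ + s • η) = Real.log (∑ k : I × I,
      Real.exp (ρ k.1) * B k.1 k.2 * Real.exp (γ k.2) * Real.exp (s * (ξ k.1 + η k.2))) := by
  rw [logZ, Fintype.sum_prod_type]
  exact congrArg _ (Finset.sum_congr rfl fun i _ => Finset.sum_congr rfl fun j _ =>
    exp_mul_exp_add ..)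

/-- Along a line of phases, `dualRate` with ρ and γ moving linearly bounds Ψ₁ from above, with
equality at s = 0. Write Q for the sum of the two weighted squared norms of ξ, η and T for twice
their covariance. The variance of ξ_i + η_j is Q + T, the two entropy parts contribute -(d+1)²Q/d,
and the second derivative is (d+1)(T - Q/d), negative by the spectral bound. -/
theorem exists_touching_function {d : ℕ} (hd : 1 ≤ d) {B : Matrix I I ℝ} (hB : ∀ i j, 0 ≤ B i j)
    {i₀ j₀ : I} (h₀ : 0 < B i₀ j₀) {α β ρ γ : I → ℝ} (hα : ∀ i, ∑ j, gibbs B ρ γ i j = α i)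
    (hβ : ∀ j, ∑ i, gibbs B ρ γ i j = β j) (hα0 : ∀ i, 0 < α i) (hβ0 : ∀ i, 0 < β i) {c₁ c₂ : ℝ}
    (h₁ : ∀ i, ((d : ℝ) + 1) * ρ i = d * Real.log (α i) + c₁)
    (h₂ : ∀ i, ((d : ℝ) + 1) * γ i = d * Real.log (β i) + c₂)
    (hspec : ∀ ξ η : I → ℝ, ∑ i, α i * ξ i = 0 → ∑ i, β i * η i = 0 → (ξ, η) ≠ 0 →
      2 * ∑ i, ∑ j, gibbs B ρ γ i j * (ξ i * η j) <
        1 / d * (∑ i, α i * ξ i ^ 2 + ∑ i, β i * η i ^ 2))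
    {u v : I → ℝ} (hu : ∑ i, u i = 0) (hv : ∑ i, v i = 0) (huv : (u, v) ≠ 0) :
    ∃ (g g' : ℝ → ℝ) (g₂ : ℝ), (∀ᶠ s in 𝓝 0, HasDerivAt g (g' s) s) ∧ HasDerivAt g' g₂ 0 ∧
      (∀ s : ℝ, Psi1 (d + 1) B (α + s • u) (β + s • v) ≤ (g s : EReal)) ∧
      Psi1 (d + 1) B α β = (g 0 : EReal) ∧ g' 0 = 0 ∧ g₂ < 0 := by
  have hd0 : (0 : ℝ) < d := by exact_mod_cast hd
  -- This velocity is the derivative of ρ = d/(d+1) log α + const in the direction u, so the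
  -- fixpoint relation between ρ and α is kept to first order.
  set ξ : I → ℝ := fun i => d / (d + 1) * (u i / α i) with hξ
  set η : I → ℝ := fun i => d / (d + 1) * (v i / β i) with hη
  have hu' : ∀ i, u i = (d + 1) / d * (α i * ξ i) := fun i => by
    have := (hα0 i).ne'; simp only [hξ]; field_simp
  have hv' : ∀ i, v i = (d + 1) / d * (β i * η i) := fun i => by
    have := (hβ0 i).ne'; simp only [hη]; field_simp
  have hαξ : ∑ i, α i * ξ i = 0 := by
    have h := hu
    rw [Finset.sum_congr rfl fun i _ => hu' i, ← Finset.mul_sum] at h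
    exact (mul_eq_zero.1 h).resolve_left (by positivity)
  have hβη : ∑ i, β i * η i = 0 := by
    have h := hv
    rw [Finset.sum_congr rfl fun i _ => hv' i, ← Finset.mul_sum] at h
    exact (mul_eq_zero.1 h).resolve_left (by positivity)
  have hne : (ξ, η) ≠ 0 := by
    intro h
    refine huv (Prod.ext (funext fun i => ?_) (funext fun i => ?_))
    · simp [hu' i, show ξ = 0 from congrArg Prod.fst h]
    · simp [hv' i, show η = 0 from congrArg Prod.snd h]
  have hS := hspec ξ η hαξ hβη hne
  set c : I × I → ℝ := fun k => Real.exp (ρ k.1) * B k.1 k.2 * Real.exp (γ k.2) with hc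
  set l : I × I → ℝ := fun k => ξ k.1 + η k.2 with hl
  have hpos : ∀ s : ℝ, 0 < ∑ k, c k * Real.exp (s * l k) := fun s => by
    have := partition_pos hB h₀ (ρ + s • ξ) (γ + s • η)
    rw [Fintype.sum_prod_type]
    simpa only [exp_mul_exp_add] using this
  have hcg : ∀ k, c k / ∑ k, c k = gibbs B ρ γ k.1 k.2 := fun k => by
    rw [gibbs, Fintype.sum_prod_type]
  -- Both functions are centred under the marginals, so the variance below is simply the second
  -- moment.
  have hm : (∑ k, c k * l k) / ∑ k, c k = 0 := by
    rw [Finset.sum_div, Finset.sum_congr rfl fun k _ => by rw [mul_div_right_comm, hcg k]]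
    simp only [hl, mul_add, Finset.sum_add_distrib]
    rw [Fintype.sum_prod_type, Fintype.sum_prod_type_right]
    simp only [← Finset.sum_mul, hα, hβ, hαξ, hβη, add_zero]
  have hV : (∑ k, c k * l k ^ 2) / ∑ k, c k =
      ∑ i, α i * ξ i ^ 2 + ∑ i, β i * η i ^ 2 + 2 * ∑ i, ∑ j, gibbs B ρ γ i j * (ξ i * η j) := by
    rw [Finset.sum_div, Finset.sum_congr rfl fun k _ => by rw [mul_div_right_comm, hcg k]]
    have e : ∀ k : I × I, gibbs B ρ γ k.1 k.2 * l k ^ 2 = gibbs B ρ γ k.1 k.2 * ξ k.1 ^ 2 +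
        gibbs B ρ γ k.1 k.2 * η k.2 ^ 2 + 2 * (gibbs B ρ γ k.1 k.2 * (ξ k.1 * η k.2)) := fun k => by
      simp only [hl]; ring
    rw [Finset.sum_congr rfl fun k _ => e k, Finset.sum_add_distrib, Finset.sum_add_distrib,
      ← Finset.mul_sum, Fintype.sum_prod_type, Fintype.sum_prod_type_right, Fintype.sum_prod_type]
    simp only [← Finset.sum_mul, hα, hβ]
  have hev : ∀ {a w : I → ℝ}, (∀ i, 0 < a i) → ∀ᶠ s : ℝ in 𝓝 0, ∀ i, a i + s * w i ≠ 0 := by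
    intro a w ha
    rw [eventually_all]
    intro i
    have hcont : Continuous fun s : ℝ => a i + s * w i := by fun_prop
    exact hcont.continuousAt.eventually_ne (by simpa using (ha i).ne')
  refine ⟨fun s => dualRate d B (α + s • u) (β + s • v) (ρ + s • ξ) (γ + s • η),
    fun s => (∑ i, (d * ((Real.log (α i + s * u i) + 1) * u i) -
        ((d : ℝ) + 1) * (u i * (ρ i + s * ξ i) + (α i + s * u i) * ξ i))) +
      (∑ i, (d * ((Real.log (β i + s * v i) + 1) * v i) -
        ((d : ℝ) + 1) * (v i * (γ i + s * η i) + (β i + s * v i) * η i))) +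
      ((d : ℝ) + 1) * ((∑ k, c k * l k * Real.exp (s * l k)) / ∑ k, c k * Real.exp (s * l k)),
    _, ?_, ((hasDerivAt_sideRate_line_deriv d fun i => (hα0 i).ne').add
      (hasDerivAt_sideRate_line_deriv d fun i => (hβ0 i).ne')).add
      ((hasDerivAt_logSumExp_deriv l hpos).const_mul _), ?_, ?_, ?_, ?_⟩
  · filter_upwards [hev hα0 (w := u), hev hβ0 (w := v)] with s hs1 hs2
    simp only [dualRate_eq_sideRate, logZ_line]
    exact ((hasDerivAt_sideRate_line d hs1).add (hasDerivAt_sideRate_line d hs2)).add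
      ((hasDerivAt_logSumExp l hpos s).const_mul _)
  · exact fun s => Psi1_le_dualRate d hB _ _ _ _
  · simp only [zero_smul, add_zero]
    exact Psi1_eq_dualRate d hB h₀ hα hβ
  · have key : ∀ {a r w z : I → ℝ} {k : ℝ}, (∀ i, ((d : ℝ) + 1) * r i = d * Real.log (a i) + k) →
        ∑ i, w i = 0 → ∑ i, a i * z i = 0 →
        ∑ i, (d * ((Real.log (a i + 0 * w i) + 1) * w i) -
        ((d : ℝ) + 1) * (w i * (r i + 0 * z i) + (a i + 0 * w i) * z i)) = 0 := by
      intro a r w z k h hw hz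
      have e : ∀ i, d * ((Real.log (a i + 0 * w i) + 1) * w i) -
        ((d : ℝ) + 1) * (w i * (r i + 0 * z i) + (a i + 0 * w i) * z i) =
        (d - k) * w i - ((d : ℝ) + 1) * (a i * z i) := fun i => by
        simp only [zero_mul, add_zero]
        linear_combination -w i * h i
      rw [Finset.sum_congr rfl fun i _ => e i, Finset.sum_sub_distrib, ← Finset.mul_sum,
        ← Finset.mul_sum, hw, hz]
      ring
    have k1 := key h₁ hu hαξ
    have k2 := key h₂ hv hβη
    simp only [zero_mul, add_zero] at k1 k2
    simp only [zero_mul, add_zero, Real.exp_zero, mul_one, k1, k2, hm, mul_zero]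
  · rw [hV, hm]
    have key : ∀ {a w z : I → ℝ}, (∀ i, 0 < a i) → (∀ i, w i = (d + 1) / d * (a i * z i)) →
        ∑ i, (d * w i ^ 2 / a i - 2 * ((d : ℝ) + 1) * (w i * z i)) =
          -(((d : ℝ) + 1) ^ 2 / d) * ∑ i, a i * z i ^ 2 := by
      intro a w z ha hw
      rw [Finset.mul_sum]
      refine Finset.sum_congr rfl fun i _ => ?_
      have := (ha i).ne'
      rw [hw i]
      field_simp
      ring
    rw [key hα0 hu', key hβ0 hv']
    set Q := ∑ i, α i * ξ i ^ 2 + ∑ i, β i * η i ^ 2 with hQ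
    set T := 2 * ∑ i, ∑ j, gibbs B ρ γ i j * (ξ i * η j) with hT
    have e : -(((d : ℝ) + 1) ^ 2 / d) * ∑ i, α i * ξ i ^ 2 +
        -(((d : ℝ) + 1) ^ 2 / d) * ∑ i, β i * η i ^ 2 + ((d : ℝ) + 1) * (Q + T - 0 ^ 2) =
        ((d : ℝ) + 1) * (T - 1 / d * Q) := by
      rw [hQ]; field_simp; ring
    rw [e]
    exact mul_neg_of_pos_of_neg (by positivity) (by linarith)

/-- A phase that satisfies the fixpoint equations and a spectral bound is a nondegenerate local
maximum of the growth rate. -/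
theorem isLocalMaxPhase_and_hessianNegDef {d : ℕ} (hd : 1 ≤ d) {B : Matrix I I ℝ}
    (hB : ∀ i j, 0 ≤ B i j) {i₀ : I} (hr : ∀ j, 0 < B i₀ j) (hc : ∀ i, 0 < B i i₀)
    {α β ρ γ : I → ℝ} (hα : ∀ i, ∑ j, gibbs B ρ γ i j = α i)
    (hβ : ∀ j, ∑ i, gibbs B ρ γ i j = β j) (hα0 : ∀ i, 0 < α i) (hβ0 : ∀ i, 0 < β i) {c₁ c₂ : ℝ}
    (h₁ : ∀ i, ((d : ℝ) + 1) * ρ i = d * Real.log (α i) + c₁)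
    (h₂ : ∀ i, ((d : ℝ) + 1) * γ i = d * Real.log (β i) + c₂)
    (hspec : ∀ ξ η : I → ℝ, ∑ i, α i * ξ i = 0 → ∑ i, β i * η i = 0 → (ξ, η) ≠ 0 →
      2 * ∑ i, ∑ j, gibbs B ρ γ i j * (ξ i * η j) <
        1 / d * (∑ i, α i * ξ i ^ 2 + ∑ i, β i * η i ^ 2)) :
    IsLocalMaxPhase (d + 1) B α β ∧ HessianNegDef (d + 1) B α β := by
  obtain ⟨F, hFc, hF0, hF⟩ := exists_marginals_inverse hB hr hc ρ γ
  have hm : marginals B (ρ, γ) = (α, β) := Prod.ext (funext hα) (funext hβ)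
  -- Near the phase, the smooth local inverse supplies dual variables for which the dual bound is
  -- sharp. This turns Ψ₁ into a composition of C² functions.
  have hPsi : ∀ᶠ w : tangent I in 𝓝 0, Psi1 (d + 1) B (α + w.1.1) (β + w.1.2) =
      (dualRate d B (α + w.1.1) (β + w.1.2) (ρ + (F w).1.1) (γ + (F w).1.2) : EReal) := by
    filter_upwards [hF] with w hw
    rw [hm] at hw
    exact Psi1_eq_dualRate d hB (hr i₀) (fun i => congrFun (congrArg Prod.fst hw) i)
      (fun i => congrFun (congrArg Prod.snd hw) i)
  have hfin : ∀ᶠ w : tangent I in 𝓝 0, Psi1 (d + 1) B (α + w.1.1) (β + w.1.2) ≠ ⊥ ∧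
      Psi1 (d + 1) B (α + w.1.1) (β + w.1.2) ≠ ⊤ := by
    filter_upwards [hPsi] with w hw
    rw [hw]
    exact ⟨EReal.coe_ne_bot _, EReal.coe_ne_top _⟩
  have hcoe : ContDiff ℝ 2 fun w : tangent I => w.1 := (tangent I).subtypeL.contDiff
  have hC : ContDiffAt ℝ 2 (psiNear (d + 1) B α β) 0 := by
    have hFc' : ContDiffAt ℝ 2 (fun w => (F w).1) 0 := hcoe.contDiffAt.comp 0 hFc
    refine ContDiffAt.congr_of_eventuallyEq (f := fun w : tangent I =>
      dualRate d B (α + w.1.1) (β + w.1.2) (ρ + (F w).1.1) (γ + (F w).1.2)) ?_ ?_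
    · refine contDiffAt_dualRate hB (hr i₀) (contDiffAt_const.add hcoe.contDiffAt.fst)
        (contDiffAt_const.add hcoe.contDiffAt.snd) (contDiffAt_const.add hFc'.fst)
        (contDiffAt_const.add hFc'.snd) (fun i => ?_) (fun i => ?_)
      · simpa using (hα0 i).ne'
      · simpa using (hβ0 i).ne'
    · filter_upwards [hPsi] with w hw
      rw [psiNear, hw, EReal.toReal_coe]
  have htouch := fderiv_eq_zero_and_second_neg hC fun w hw => by
    obtain ⟨g, g', g₂, hg, hg₂, hle, h0, hg0, hneg⟩ :=
      exists_touching_function hd hB (hr i₀) hα hβ hα0 hβ0 h₁ h₂ hspec w.2.1 w.2.2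
        (fun h => hw (Subtype.ext h))
    refine ⟨g, g', g₂, hg, hg₂, ?_, ?_, hg0, hneg⟩
    · filter_upwards [(tendsto_smul_zero w).eventually hfin] with s hs
      have := hle s
      rw [psiNear, ← EReal.toReal_coe (g s)]
      exact EReal.toReal_le_toReal this hs.1 (EReal.coe_ne_top _)
    · rw [psiNear]
      simp [h0]
  have hmax := isLocalMax_of_second_neg hC htouch.1 htouch.2
  have hsα : ∑ i, α i = 1 := by
    simp only [← hα]; exact sum_gibbs hB (hr i₀) ρ γ
  have hsβ : ∑ i, β i = 1 := by
    simp only [← hβ]; rw [Finset.sum_comm]; exact sum_gibbs hB (hr i₀) ρ γ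
  refine ⟨⟨⟨fun i => (hα0 i).le, hsα⟩, ⟨fun i => (hβ0 i).le, hsβ⟩, ?_⟩, hfin, hC, fun w hw => ?_⟩
  · rw [IsLocalMaxOn, IsMaxFilter]
    have h1 := hmax.and hfin
    rw [nhds_subtype_eq_comap, eventually_comap] at h1
    have h2 : Tendsto (fun p : (I → ℝ) × (I → ℝ) => p - (α, β)) (𝓝 (α, β))
        (𝓝 ((0 : tangent I) : (I → ℝ) × (I → ℝ))) := by
      have : Continuous fun p : (I → ℝ) × (I → ℝ) => p - (α, β) := by fun_prop
      simpa using this.tendsto (α, β)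
    filter_upwards [nhdsWithin_le_nhds (h2.eventually h1), self_mem_nhdsWithin] with p hp hps
    obtain ⟨⟨_, hp1⟩, ⟨_, hp2⟩⟩ := hps
    have hmem : p - (α, β) ∈ tangent I := by
      constructor
      · simp [Finset.sum_sub_distrib, hp1, hsα]
      · simp [Finset.sum_sub_distrib, hp2, hsβ]
    obtain ⟨h3, h4⟩ := hp ⟨_, hmem⟩ rfl
    have h5 := hfin.self_of_nhds
    simp only [psiNear] at h3
    have e1 : α + (p - (α, β)).1 = p.1 := by simp
    have e2 : β + (p - (α, β)).2 = p.2 := by simp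
    simp only [e1, e2] at h3 h4
    rw [← EReal.coe_toReal h4.2 h4.1]
    have e3 : α + ((0 : tangent I) : (I → ℝ) × (I → ℝ)).1 = α := by simp
    have e4 : β + ((0 : tangent I) : (I → ℝ) × (I → ℝ)).2 = β := by simp
    rw [e3, e4] at h3 h5
    rw [← EReal.coe_toReal h5.2 h5.1]
    exact EReal.coe_le_coe_iff.2 h3
  · rw [iteratedFDeriv_two_apply]
    exact htouch.2 w hw

end Hessian

end SpinPhase

namespace SpinPhase

/-! ### From the spectral bound to the second eigenvalue -/

section Eigenvalue

open Matrix in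
/-- Every hyperplane contains a vector whose Rayleigh quotient is at least the second eigenvalue. -/
theorem exists_rayleigh_ge_second {n : Type*} [Fintype n] [DecidableEq n] {A : Matrix n n ℝ}
    (hA : A.IsHermitian) (h1 : 1 < Fintype.card n) (z : n → ℝ) :
    ∃ w : n → ℝ, w ≠ 0 ∧ w ⬝ᵥ z = 0 ∧ hA.eigenvalues₀ ⟨1, h1⟩ * (w ⬝ᵥ w) ≤ w ⬝ᵥ (A *ᵥ w) := by
  set f : Fin (Fintype.card n) ≃ n := Fintype.equivOfCardEq (Fintype.card_fin _) with hf
  set p := f ⟨0, by omega⟩ with hp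
  set r := f ⟨1, h1⟩ with hr
  have hpr : p ≠ r := fun h => by simpa [hp, hr] using f.injective h
  set e : n → n → ℝ := fun j => ⇑(hA.eigenvectorBasis j) with he
  have hort : ∀ i j, e i ⬝ᵥ e j = if i = j then 1 else 0 := fun i j => by
    have := orthonormal_iff_ite.1 hA.eigenvectorBasis.orthonormal j i
    rw [EuclideanSpace.inner_eq_star_dotProduct] at this
    simp only [he]
    rw [star_trivial] at this
    rw [this]
    simp [eq_comm]
  have hmul : ∀ j, A *ᵥ e j = hA.eigenvalues j • e j := fun j => hA.mulVec_eigenvectorBasis j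
  have hlp : hA.eigenvalues p = hA.eigenvalues₀ ⟨0, by omega⟩ := by
    simp [Matrix.IsHermitian.eigenvalues, hp, hf]
  have hlr : hA.eigenvalues r = hA.eigenvalues₀ ⟨1, h1⟩ := by
    simp [Matrix.IsHermitian.eigenvalues, hr, hf]
  have hle : hA.eigenvalues r ≤ hA.eigenvalues p := by
    rw [hlp, hlr]
    exact hA.eigenvalues₀_antitone (by simp)
  -- The span of the two leading eigenvectors is two-dimensional, so it meets the hyperplane; on it
  -- the Rayleigh quotient is at least the smaller of the two eigenvalues.
  obtain ⟨x, y, hxy, hz⟩ : ∃ x y : ℝ, ¬ (x = 0 ∧ y = 0) ∧ x * (e p ⬝ᵥ z) + y * (e r ⬝ᵥ z) = 0 := by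
    by_cases h : e p ⬝ᵥ z = 0
    · exact ⟨1, 0, by simp, by simp [h]⟩
    · exact ⟨e r ⬝ᵥ z, -(e p ⬝ᵥ z), fun h' => h (neg_eq_zero.1 h'.2), by ring⟩
  have hww : (x • e p + y • e r) ⬝ᵥ (x • e p + y • e r) = x ^ 2 + y ^ 2 := by
    simp only [add_dotProduct, dotProduct_add, smul_dotProduct, dotProduct_smul, hort, hpr, hpr.symm,
      smul_eq_mul, if_true, if_false]
    ring
  have hpos : 0 < x ^ 2 + y ^ 2 := by
    by_contra h
    have hx : x = 0 := by nlinarith [sq_nonneg x, sq_nonneg y]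
    have hy : y = 0 := by nlinarith [sq_nonneg x, sq_nonneg y]
    exact hxy ⟨hx, hy⟩
  refine ⟨x • e p + y • e r, ?_, ?_, ?_⟩
  · intro h
    rw [h] at hww
    simp at hww
    linarith
  · simpa [add_dotProduct, smul_dotProduct] using hz
  · have hwA : (x • e p + y • e r) ⬝ᵥ (A *ᵥ (x • e p + y • e r)) =
        hA.eigenvalues p * x ^ 2 + hA.eigenvalues r * y ^ 2 := by
      simp only [mulVec_add, mulVec_smul, hmul, add_dotProduct, dotProduct_add, smul_dotProduct,
        dotProduct_smul, hort, hpr, hpr.symm, smul_eq_mul, if_true, if_false]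
      ring
    rw [hww, hwA, ← hlr]
    nlinarith [sq_nonneg x, sq_nonneg y]

variable {I : Type*} [Fintype I] [DecidableEq I]

open Matrix in
-- Test on the hyperplane orthogonal to (√a, √b), the eigenvector of eigenvalue 1. In the
-- coordinates w = (√a ξ, √b η) the quadratic form becomes the covariance form, but orthogonality
-- only makes the sum of the two means vanish. The remaining component is along (√a, -√b), of
-- eigenvalue -1, and lowers the form.
theorem secondEigenvalue_lt_of_spectral_bound [Nonempty I] {B : Matrix I I ℝ} {R C : I → ℝ}
    {κ : ℝ} (hκ : 0 < κ) (ha : ∀ i, 0 < ∑ j, B i j * R i * C j)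
    (hb : ∀ j, 0 < ∑ i, B i j * R i * C j)
    (hspec : ∀ ξ η : I → ℝ, ∑ i, (∑ j, B i j * R i * C j) * ξ i = 0 →
      ∑ j, (∑ i, B i j * R i * C j) * η j = 0 → (ξ, η) ≠ 0 →
      2 * ∑ i, ∑ j, B i j * R i * C j * (ξ i * η j) <
        κ * (∑ i, (∑ j, B i j * R i * C j) * ξ i ^ 2 + ∑ j, (∑ i, B i j * R i * C j) * η j ^ 2)) :
    secondEigenvalue B R C < κ := by
  by_contra hcon
  push Not at hcon
  set a : I → ℝ := fun i => ∑ j, B i j * R i * C j with ha'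
  set b : I → ℝ := fun j => ∑ i, B i j * R i * C j with hb'
  set x : I → I → ℝ := fun i j => B i j * R i * C j with hx'
  obtain ⟨w, hw, hwz, hwA⟩ := exists_rayleigh_ge_second (matL_isHermitian B R C) one_lt_card_sum
    (Sum.elim (fun i => √(a i)) fun j => √(b j))
  have hsa : ∀ i, 0 < √(a i) := fun i => Real.sqrt_pos.2 (ha i)
  have hsb : ∀ i, 0 < √(b i) := fun i => Real.sqrt_pos.2 (hb i)
  set ξ : I → ℝ := fun i => w (Sum.inl i) / √(a i) with hξ
  set η : I → ℝ := fun i => w (Sum.inr i) / √(b i) with hη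
  have hwl : ∀ i, w (Sum.inl i) = √(a i) * ξ i := fun i => by
    have := (hsa i).ne'; simp only [hξ]; field_simp
  have hwr : ∀ i, w (Sum.inr i) = √(b i) * η i := fun i => by
    have := (hsb i).ne'; simp only [hη]; field_simp
  have hsqa : ∀ i, √(a i) * √(a i) = a i := fun i => Real.mul_self_sqrt (ha i).le
  have hsqb : ∀ i, √(b i) * √(b i) = b i := fun i => Real.mul_self_sqrt (hb i).le
  have hc : ∑ i, a i * ξ i + ∑ j, b j * η j = 0 := by
    rw [← hwz, dotProduct, Fintype.sum_sum_type]
    congr 1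
    · exact Finset.sum_congr rfl fun i _ => by rw [hwl, Sum.elim_inl]; linear_combination -ξ i * hsqa i
    · exact Finset.sum_congr rfl fun i _ => by rw [hwr, Sum.elim_inr]; linear_combination -η i * hsqb i
  have hn : w ⬝ᵥ w = ∑ i, a i * ξ i ^ 2 + ∑ j, b j * η j ^ 2 := by
    rw [dotProduct, Fintype.sum_sum_type]
    congr 1
    · exact Finset.sum_congr rfl fun i _ => by rw [hwl]; linear_combination ξ i ^ 2 * hsqa i
    · exact Finset.sum_congr rfl fun i _ => by rw [hwr]; linear_combination η i ^ 2 * hsqb i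
  have hA : ∀ i j, √(a i) * matA B R C i j * √(b j) = x i j := fun i j => by
    have h1 := (hsa i).ne'
    have h2 := (hsb j).ne'
    simp only [matA, Matrix.of_apply]
    rw [show (∑ j', B i j' * R i * C j') = a i from rfl,
      show (∑ i', B i' j * R i' * C j) = b j from rfl, show B i j * R i * C j = x i j from rfl,
      Real.sqrt_mul (show 0 ≤ a i from (ha i).le)]
    generalize x i j = y
    field_simp
  have hL : w ⬝ᵥ (matL B R C *ᵥ w) = 2 * ∑ i, ∑ j, x i j * (ξ i * η j) := by
    rw [dotProduct, Fintype.sum_sum_type, two_mul]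
    congr 1
    · refine Finset.sum_congr rfl fun i _ => ?_
      rw [mulVec, dotProduct, Fintype.sum_sum_type]
      simp only [matL, fromBlocks_apply₁₁, fromBlocks_apply₁₂, Matrix.zero_apply, zero_mul,
        Finset.sum_const_zero, zero_add, Finset.mul_sum]
      refine Finset.sum_congr rfl fun j _ => ?_
      rw [← hA, hwl, hwr]; ring
    · rw [Finset.sum_comm]
      refine Finset.sum_congr rfl fun j _ => ?_
      rw [mulVec, dotProduct, Fintype.sum_sum_type]
      simp only [matL, fromBlocks_apply₂₁, fromBlocks_apply₂₂, Matrix.zero_apply, zero_mul,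
        Finset.sum_const_zero, add_zero, Finset.mul_sum, transpose_apply]
      refine Finset.sum_congr rfl fun i _ => ?_
      rw [← hA, hwl, hwr]; ring
  set S := ∑ i, a i with hS
  have hSb : ∑ j, b j = S := Finset.sum_comm
  have hS0 : 0 < S := Finset.sum_pos (fun i _ => ha i) Finset.univ_nonempty
  -- The means of ξ and η are s and -s. Subtracting them removes s²S from each norm term and leaves
  -- -s²S in the covariance.
  set s := (∑ i, a i * ξ i) / S with hs
  have hsS : ∑ i, a i * ξ i = s * S := by rw [hs]; field_simp
  have hsS' : ∑ j, b j * η j = -(s * S) := by linarith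
  have h1 : ∑ i, a i * (ξ i - s) = 0 := by
    simp only [mul_sub, Finset.sum_sub_distrib, ← Finset.sum_mul, hsS, ← hS]; ring
  have h2 : ∑ j, b j * (η j + s) = 0 := by
    simp only [mul_add, Finset.sum_add_distrib, ← Finset.sum_mul, hsS', hSb]; ring
  have h3 : ∑ i, a i * ξ i ^ 2 = ∑ i, a i * (ξ i - s) ^ 2 + s ^ 2 * S := by
    have e : ∀ i, a i * ξ i ^ 2 = a i * (ξ i - s) ^ 2 + 2 * s * (a i * (ξ i - s)) + s ^ 2 * a i :=
      fun i => by ring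
    rw [Finset.sum_congr rfl fun i _ => e i, Finset.sum_add_distrib, Finset.sum_add_distrib,
      ← Finset.mul_sum, ← Finset.mul_sum, h1]
    ring
  have h4 : ∑ j, b j * η j ^ 2 = ∑ j, b j * (η j + s) ^ 2 + s ^ 2 * S := by
    have e : ∀ i, b i * η i ^ 2 = b i * (η i + s) ^ 2 - 2 * s * (b i * (η i + s)) + s ^ 2 * b i :=
      fun i => by ring
    rw [Finset.sum_congr rfl fun i _ => e i, Finset.sum_add_distrib, Finset.sum_sub_distrib,
      ← Finset.mul_sum, ← Finset.mul_sum, h2, hSb]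
    ring
  have h5 : ∑ i, ∑ j, x i j * (ξ i * η j) =
      ∑ i, ∑ j, x i j * ((ξ i - s) * (η j + s)) - s ^ 2 * S := by
    have e : ∀ i j, x i j * (ξ i * η j) = x i j * ((ξ i - s) * (η j + s)) -
        s * (x i j * (ξ i - s)) + s * (x i j * (η j + s)) - s ^ 2 * x i j := fun i j => by ring
    have e1 : ∑ i, ∑ j, x i j * (ξ i - s) = 0 := by
      simpa only [← Finset.sum_mul] using h1
    have e2 : ∑ i, ∑ j, x i j * (η j + s) = 0 := by
      rw [Finset.sum_comm]
      simpa only [← Finset.sum_mul] using h2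
    simp only [e, Finset.sum_add_distrib, Finset.sum_sub_distrib, ← Finset.mul_sum, e1, e2]
    rw [hS]
    ring
  have h6 : κ * (w ⬝ᵥ w) ≤ w ⬝ᵥ (matL B R C *ᵥ w) := by
    refine le_trans (mul_le_mul_of_nonneg_right hcon ?_) hwA
    rw [hn]
    exact add_nonneg (Finset.sum_nonneg fun i _ => mul_nonneg (ha i).le (sq_nonneg _))
      (Finset.sum_nonneg fun i _ => mul_nonneg (hb i).le (sq_nonneg _))
  rw [hn, hL, h3, h4, h5] at h6
  have hsq : 0 ≤ s ^ 2 * S := by positivity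
  have hκs : 0 ≤ κ * (s ^ 2 * S) := by positivity
  by_cases h0 : ((fun i => ξ i - s, fun j => η j + s) : (I → ℝ) × (I → ℝ)) = 0
  · have e1 : ∀ i, ξ i - s = 0 := fun i => congrFun (congrArg Prod.fst h0) i
    have e2 : ∀ i, η i + s = 0 := fun i => congrFun (congrArg Prod.snd h0) i
    simp only [e1, e2] at h6
    simp at h6
    have hs0 : s = 0 := by
      have : s ^ 2 * S = 0 := by nlinarith
      rcases mul_eq_zero.1 this with h | h
      · exact pow_eq_zero_iff (two_ne_zero) |>.1 h
      · exact absurd h hS0.ne'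
    apply hw
    funext i
    rcases i with i | i
    · rw [hwl, show ξ i = 0 by linarith [e1 i]]; simp
    · rw [hwr, show η i = 0 by linarith [e2 i]]; simp
  · have := hspec _ _ h1 h2 h0
    nlinarith

end Eigenvalue

end SpinPhase

namespace SpinPhase

/-! ### The covariance bound for two mirrored classes -/

section SpectralBound

/-- The condition l b = (g D)² makes the form in (ξ_i, η_i) a multiple of one square (l ξ_i + g D
η_i)², so Cauchy–Schwarz over the class bounds it by the class sums. -/
theorem sum_degenerate_form_ge {J : Type*} {s : Finset J} {h : ℝ} (hs : (s.card : ℝ) = h) (hh : 0 < h)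
    {l b g D : ℝ} (hl : 0 < l) (hD : 0 < D) (hlb : l * b = (g * D) ^ 2) (ξ η : J → ℝ) :
    1 / h * (1 / D * (l * (∑ i ∈ s, ξ i) ^ 2 + b * (∑ i ∈ s, η i) ^ 2) +
      2 * g * ((∑ i ∈ s, ξ i) * ∑ i ∈ s, η i)) ≤
    1 / D * (∑ i ∈ s, l * ξ i ^ 2 + ∑ i ∈ s, b * η i ^ 2) + 2 * g * ∑ i ∈ s, ξ i * η i := by
  have hform : ∀ u v : ℝ, 1 / D * (l * u ^ 2 + b * v ^ 2) + 2 * g * (u * v) =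
      1 / (D * l) * (l * u + g * D * v) ^ 2 := fun u v => by
    have hb : b = (g * D) ^ 2 / l := by rw [← hlb]; field_simp
    rw [hb]
    field_simp
    ring
  have h1 := sq_sum_le_card_mul_sum_sq (s := s) (f := fun i => l * ξ i + g * D * η i)
  rw [hs, Finset.sum_add_distrib, ← Finset.mul_sum, ← Finset.mul_sum] at h1
  have h2 : 1 / D * (∑ i ∈ s, l * ξ i ^ 2 + ∑ i ∈ s, b * η i ^ 2) + 2 * g * ∑ i ∈ s, ξ i * η i =
      1 / (D * l) * ∑ i ∈ s, (l * ξ i + g * D * η i) ^ 2 := by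
    rw [Finset.mul_sum, ← Finset.sum_add_distrib, Finset.mul_sum, Finset.mul_sum,
      ← Finset.sum_add_distrib]
    exact Finset.sum_congr rfl fun i _ => hform _ _
  rw [h2, hform]
  have h3 : 0 < 1 / (D * l) := by positivity
  calc 1 / h * (1 / (D * l) * (l * ∑ i ∈ s, ξ i + g * D * ∑ i ∈ s, η i) ^ 2)
      = 1 / (D * l) * (1 / h * (l * ∑ i ∈ s, ξ i + g * D * ∑ i ∈ s, η i) ^ 2) := by ring
    _ ≤ _ := by
        refine mul_le_mul_of_nonneg_left ?_ h3.le
        rw [one_div, inv_mul_le_iff₀ hh]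
        exact h1

/-- With A = p a + r b and E = p² a + r² b one has g D (a + b) = (p + r) A - E. Cauchy–Schwarz
against w A² + h E² costs the factor h (p + r)² + w, which is at most D. -/
theorem two_class_form_le {p r w h D g : ℝ} (hw : 0 < w) (hh : 0 < h) (hD : 0 < D)
    (hg : p * r = g * D) (hle : h * (p + r) ^ 2 + w ≤ D) (a b : ℝ) :
    g ^ 2 * (a + b) ^ 2 - 2 * (g / h) * (a * b) ≤
      1 / D * ((p ^ 2 * a ^ 2 + r ^ 2 * b ^ 2) / h + (p ^ 2 * a + r ^ 2 * b) ^ 2 / w) := by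
  set A := p * a + r * b with hA
  set E := p ^ 2 * a + r ^ 2 * b with hE
  have h1 : g * D * (a + b) = (p + r) * A - E := by rw [← hg, hA, hE]; ring
  have h2 : h * w * ((p + r) * A - E) ^ 2 ≤ D * (w * A ^ 2 + h * E ^ 2) := by
    have h3 : 0 ≤ w * A ^ 2 + h * E ^ 2 := by positivity
    nlinarith [mul_le_mul_of_nonneg_right hle h3, sq_nonneg (h * (p + r) * E + w * A)]
  have h4 : A ^ 2 = p ^ 2 * a ^ 2 + r ^ 2 * b ^ 2 + 2 * (g * D) * (a * b) := by rw [← hg, hA]; ring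
  rw [← h1] at h2
  have h5 : 1 / D * ((p ^ 2 * a ^ 2 + r ^ 2 * b ^ 2) / h + E ^ 2 / w) -
      (g ^ 2 * (a + b) ^ 2 - 2 * (g / h) * (a * b)) =
      (D * (w * A ^ 2 + h * E ^ 2) - h * w * (g * D * (a + b)) ^ 2) / (D ^ 2 * h * w) := by
    rw [h4]; field_simp; ring
  have h6 : 0 ≤ (D * (w * A ^ 2 + h * E ^ 2) - h * w * (g * D * (a + b)) ^ 2) / (D ^ 2 * h * w) :=
    div_nonneg (by linarith) (by positivity)
  linarith

/-- For the opposite sign only the cross term 2 (g/h) a b can be positive, and (p a - r b)² ≥ 0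
absorbs it; no upper bound on h (p + r)² + w is needed. -/
theorem two_class_form_ge {p r w h D g : ℝ} (hw : 0 < w) (hh : 0 < h) (hD : 0 < D)
    (hg : p * r = g * D) (a b : ℝ) :
    -(g ^ 2 * (a + b) ^ 2 - 2 * (g / h) * (a * b)) ≤
      1 / D * ((p ^ 2 * a ^ 2 + r ^ 2 * b ^ 2) / h + (p ^ 2 * a + r ^ 2 * b) ^ 2 / w) := by
  have h1 : 2 * (g / h) * (a * b) ≤ 1 / D * ((p ^ 2 * a ^ 2 + r ^ 2 * b ^ 2) / h) := by
    have h2 : 1 / D * ((p ^ 2 * a ^ 2 + r ^ 2 * b ^ 2) / h) - 2 * (g / h) * (a * b) =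
        (p * a - r * b) ^ 2 / (D * h) := by
      have : (p * a - r * b) ^ 2 = p ^ 2 * a ^ 2 + r ^ 2 * b ^ 2 - 2 * (g * D) * (a * b) := by
        rw [← hg]; ring
      rw [this]; field_simp
    have h3 : 0 ≤ (p * a - r * b) ^ 2 / (D * h) := by positivity
    linarith
  have h4 : 0 ≤ 1 / D * ((p ^ 2 * a + r ^ 2 * b) ^ 2 / w) := by positivity
  have h5 : 0 ≤ g ^ 2 * (a + b) ^ 2 := by positivity
  rw [mul_add]
  linarith

/-- The bound on the covariance of two centred functions of the spins, where the spins of the two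
classes `s` and `sᶜ` have weights `x`, `y` on one side and `y`, `x` on the other. -/
theorem covariance_le {J : Type*} [Fintype J] [DecidableEq J] {s : Finset J} {h x y w D : ℝ}
    (hs : (s.card : ℝ) = h) (hs' : (sᶜ.card : ℝ) = h) (hh : 0 < h) (hx : 0 < x) (hx1 : x < 1)
    (hy : 0 < y) (hy1 : y < 1) (hw : 0 < w) (hw' : w = 1 - h * (x + y)) (hD1 : 1 ≤ D)
    (hD : D ^ 2 * (x * y) = (1 - x) * (1 - y)) {r c : J → ℝ} (hrs : ∀ i ∈ s, r i = x)
    (hcs : ∀ i ∈ s, c i = y) (hrs' : ∀ i ∈ sᶜ, r i = y) (hcs' : ∀ i ∈ sᶜ, c i = x) {ξ₀ η₀ : ℝ}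
    {ξ η : J → ℝ} (hξ : w * ξ₀ + ∑ i, r i * (1 - c i) * ξ i = 0)
    (hη : w * η₀ + ∑ i, c i * (1 - r i) * η i = 0) :
    2 * ((w * ξ₀ + ∑ i, r i * ξ i) * (w * η₀ + ∑ i, c i * η i) - ∑ i, r i * c i * (ξ i * η i)) ≤
      1 / D * ((w * ξ₀ ^ 2 + ∑ i, r i * (1 - c i) * ξ i ^ 2) +
        (w * η₀ ^ 2 + ∑ i, c i * (1 - r i) * η i ^ 2)) := by
  have hD0 : 0 < D := by linarith
  set g := x * y with hg
  set p := √(x * (1 - y)) with hp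
  set e := √(y * (1 - x)) with he
  have hp2 : p ^ 2 = x * (1 - y) := Real.sq_sqrt (mul_nonneg hx.le (by linarith))
  have he2 : e ^ 2 = y * (1 - x) := Real.sq_sqrt (mul_nonneg hy.le (by linarith))
  have hg0 : 0 < g := mul_pos hx hy
  -- The relation between D and x, y says exactly that the form at a single spin is degenerate.
  have hpe : p * e = g * D := by
    have h1 : (p * e) ^ 2 = (g * D) ^ 2 := by
      rw [mul_pow, hp2, he2, mul_pow, hg]
      linear_combination -(x * y) * hD
    exact (pow_left_inj₀ (mul_nonneg (Real.sqrt_nonneg _) (Real.sqrt_nonneg _)) (by positivity)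
      two_ne_zero).1 h1
  -- The left side equals 1 + 2hg(D - 1), and 2hg ≤ h(x + y) < 1.
  have hle : h * (p + e) ^ 2 + w ≤ D := by
    have h1 : (p + e) ^ 2 = x + y - 2 * g + 2 * (g * D) := by
      rw [← hpe, add_sq, hp2, he2, hg]; ring
    have h2 : 0 ≤ 1 - 2 * h * g := by
      have h3 : 2 * g ≤ x + y := by rw [hg]; nlinarith
      nlinarith
    rw [h1, hw']
    nlinarith
  have hsplit : ∀ f : J → ℝ, ∑ i, f i = ∑ i ∈ s, f i + ∑ i ∈ sᶜ, f i := fun f =>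
    (Finset.sum_add_sum_compl s f).symm
  set X₁ := ∑ i ∈ s, ξ i with hX₁
  set X₂ := ∑ i ∈ sᶜ, ξ i with hX₂
  set Y₁ := ∑ i ∈ s, η i with hY₁
  set Y₂ := ∑ i ∈ sᶜ, η i with hY₂
  have e1 : ∑ i, r i * (1 - c i) * ξ i = p ^ 2 * X₁ + e ^ 2 * X₂ := by
    rw [hsplit, hX₁, hX₂, Finset.mul_sum, Finset.mul_sum]
    congr 1
    · exact Finset.sum_congr rfl fun i hi => by rw [hrs i hi, hcs i hi, hp2]
    · exact Finset.sum_congr rfl fun i hi => by rw [hrs' i hi, hcs' i hi, he2]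
  have e2 : ∑ i, c i * (1 - r i) * η i = e ^ 2 * Y₁ + p ^ 2 * Y₂ := by
    rw [hsplit, hY₁, hY₂, Finset.mul_sum, Finset.mul_sum]
    congr 1
    · exact Finset.sum_congr rfl fun i hi => by rw [hrs i hi, hcs i hi, he2]
    · exact Finset.sum_congr rfl fun i hi => by rw [hrs' i hi, hcs' i hi, hp2]
  -- Subtracting the centring condition leaves the sum of r_i c_i ξ_i, and the product r_i c_i
  -- equals g in both classes.
  have e3 : w * ξ₀ + ∑ i, r i * ξ i = g * (X₁ + X₂) := by
    have : ∑ i, r i * ξ i = x * X₁ + y * X₂ := by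
      rw [hsplit, hX₁, hX₂, Finset.mul_sum, Finset.mul_sum]
      congr 1
      · exact Finset.sum_congr rfl fun i hi => by rw [hrs i hi]
      · exact Finset.sum_congr rfl fun i hi => by rw [hrs' i hi]
    rw [e1, hp2, he2] at hξ
    rw [this, hg]
    linear_combination hξ
  have e4 : w * η₀ + ∑ i, c i * η i = g * (Y₁ + Y₂) := by
    have : ∑ i, c i * η i = y * Y₁ + x * Y₂ := by
      rw [hsplit, hY₁, hY₂, Finset.mul_sum, Finset.mul_sum]
      congr 1
      · exact Finset.sum_congr rfl fun i hi => by rw [hcs i hi]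
      · exact Finset.sum_congr rfl fun i hi => by rw [hcs' i hi]
    rw [e2, hp2, he2] at hη
    rw [this, hg]
    linear_combination hη
  have e5 : ∑ i, r i * c i * (ξ i * η i) = g * (∑ i ∈ s, ξ i * η i + ∑ i ∈ sᶜ, ξ i * η i) := by
    rw [hsplit, mul_add, Finset.mul_sum, Finset.mul_sum]
    congr 1
    · exact Finset.sum_congr rfl fun i hi => by rw [hrs i hi, hcs i hi]
    · exact Finset.sum_congr rfl fun i hi => by rw [hrs' i hi, hcs' i hi, hg]; ring
  have e6 : ∑ i, r i * (1 - c i) * ξ i ^ 2 =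
      ∑ i ∈ s, p ^ 2 * ξ i ^ 2 + ∑ i ∈ sᶜ, e ^ 2 * ξ i ^ 2 := by
    rw [hsplit]
    congr 1
    · exact Finset.sum_congr rfl fun i hi => by rw [hrs i hi, hcs i hi, hp2]
    · exact Finset.sum_congr rfl fun i hi => by rw [hrs' i hi, hcs' i hi, he2]
  have e7 : ∑ i, c i * (1 - r i) * η i ^ 2 =
      ∑ i ∈ s, e ^ 2 * η i ^ 2 + ∑ i ∈ sᶜ, p ^ 2 * η i ^ 2 := by
    rw [hsplit]
    congr 1
    · exact Finset.sum_congr rfl fun i hi => by rw [hrs i hi, hcs i hi, he2]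
    · exact Finset.sum_congr rfl fun i hi => by rw [hrs' i hi, hcs' i hi, hp2]
  have e8 : w * ξ₀ ^ 2 = (p ^ 2 * X₁ + e ^ 2 * X₂) ^ 2 / w := by
    rw [e1] at hξ
    rw [eq_div_iff hw.ne']
    linear_combination (w * ξ₀ - (p ^ 2 * X₁ + e ^ 2 * X₂)) * hξ
  have e9 : w * η₀ ^ 2 = (e ^ 2 * Y₁ + p ^ 2 * Y₂) ^ 2 / w := by
    rw [e2] at hη
    rw [eq_div_iff hw.ne']
    linear_combination (w * η₀ - (e ^ 2 * Y₁ + p ^ 2 * Y₂)) * hη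
  have hp0 : 0 < p ^ 2 := by rw [hp2]; exact mul_pos hx (by linarith)
  have he0 : 0 < e ^ 2 := by rw [he2]; exact mul_pos hy (by linarith)
  have f1 := sum_degenerate_form_ge hs hh hp0 hD0 (g := g) (b := e ^ 2)
    (by rw [← hpe]; ring) ξ η
  have f2 := sum_degenerate_form_ge hs' hh he0 hD0 (g := g) (b := p ^ 2)
    (by rw [← hpe]; ring) ξ η
  -- The exchange of the two sides together with the two classes is a symmetry. The symmetric
  -- combinations X₁ + Y₂, X₂ + Y₁ need the upper bound and the antisymmetric ones the lower bound;
  -- the sum of the two is the required form by polarization.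
  have f3 := two_class_form_le hw hh hD0 hpe hle (X₁ + Y₂) (X₂ + Y₁)
  have f4 := two_class_form_ge hw hh hD0 hpe (X₁ - Y₂) (X₂ - Y₁)
  rw [e3, e4, e5, e6, e7, e8, e9]
  rw [← hX₁, ← hY₁] at f1
  rw [← hX₂, ← hY₂] at f2
  have f5 : 2 * (g ^ 2 * ((X₁ + X₂) * (Y₁ + Y₂)) - g / h * (X₁ * Y₁ + X₂ * Y₂)) ≤
      1 / D * ((p ^ 2 * X₁ ^ 2 + e ^ 2 * X₂ ^ 2) / h + (p ^ 2 * X₁ + e ^ 2 * X₂) ^ 2 / w +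
        ((e ^ 2 * Y₁ ^ 2 + p ^ 2 * Y₂ ^ 2) / h + (e ^ 2 * Y₁ + p ^ 2 * Y₂) ^ 2 / w)) := by
    have f6 := add_le_add f3 f4
    have l1 : (g ^ 2 * (X₁ + Y₂ + (X₂ + Y₁)) ^ 2 - 2 * (g / h) * ((X₁ + Y₂) * (X₂ + Y₁))) +
        -(g ^ 2 * (X₁ - Y₂ + (X₂ - Y₁)) ^ 2 - 2 * (g / h) * ((X₁ - Y₂) * (X₂ - Y₁))) =
        2 * (2 * (g ^ 2 * ((X₁ + X₂) * (Y₁ + Y₂)) - g / h * (X₁ * Y₁ + X₂ * Y₂))) := by ring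
    rw [l1] at f6
    have l2 : 1 / D * ((p ^ 2 * (X₁ + Y₂) ^ 2 + e ^ 2 * (X₂ + Y₁) ^ 2) / h +
          (p ^ 2 * (X₁ + Y₂) + e ^ 2 * (X₂ + Y₁)) ^ 2 / w) +
        1 / D * ((p ^ 2 * (X₁ - Y₂) ^ 2 + e ^ 2 * (X₂ - Y₁) ^ 2) / h +
          (p ^ 2 * (X₁ - Y₂) + e ^ 2 * (X₂ - Y₁)) ^ 2 / w) =
        2 * (1 / D * ((p ^ 2 * X₁ ^ 2 + e ^ 2 * X₂ ^ 2) / h + (p ^ 2 * X₁ + e ^ 2 * X₂) ^ 2 / w +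
        ((e ^ 2 * Y₁ ^ 2 + p ^ 2 * Y₂ ^ 2) / h + (e ^ 2 * Y₁ + p ^ 2 * Y₂) ^ 2 / w))) := by
      ring
    rw [l2] at f6
    linarith
  have l3 : 1 / D * ((p ^ 2 * X₁ ^ 2 + e ^ 2 * X₂ ^ 2) / h + (p ^ 2 * X₁ + e ^ 2 * X₂) ^ 2 / w +
        ((e ^ 2 * Y₁ ^ 2 + p ^ 2 * Y₂ ^ 2) / h + (e ^ 2 * Y₁ + p ^ 2 * Y₂) ^ 2 / w)) +
      2 * (g / h * (X₁ * Y₁ + X₂ * Y₂)) =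
      1 / h * (1 / D * (p ^ 2 * X₁ ^ 2 + e ^ 2 * Y₁ ^ 2) + 2 * g * (X₁ * Y₁)) +
      1 / h * (1 / D * (e ^ 2 * X₂ ^ 2 + p ^ 2 * Y₂ ^ 2) + 2 * g * (X₂ * Y₂)) +
      1 / D * ((p ^ 2 * X₁ + e ^ 2 * X₂) ^ 2 / w + (e ^ 2 * Y₁ + p ^ 2 * Y₂) ^ 2 / w) := by ring
  have l4 : 1 / D * ((p ^ 2 * X₁ + e ^ 2 * X₂) ^ 2 / w +
        (∑ i ∈ s, p ^ 2 * ξ i ^ 2 + ∑ i ∈ sᶜ, e ^ 2 * ξ i ^ 2) +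
        ((e ^ 2 * Y₁ + p ^ 2 * Y₂) ^ 2 / w +
          (∑ i ∈ s, e ^ 2 * η i ^ 2 + ∑ i ∈ sᶜ, p ^ 2 * η i ^ 2))) =
      1 / D * ((p ^ 2 * X₁ + e ^ 2 * X₂) ^ 2 / w + (e ^ 2 * Y₁ + p ^ 2 * Y₂) ^ 2 / w) +
      1 / D * (∑ i ∈ s, p ^ 2 * ξ i ^ 2 + ∑ i ∈ s, e ^ 2 * η i ^ 2) +
      1 / D * (∑ i ∈ sᶜ, e ^ 2 * ξ i ^ 2 + ∑ i ∈ sᶜ, p ^ 2 * η i ^ 2) := by ring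
  rw [l4]
  linarith

end SpectralBound

end SpinPhase

namespace SpinPhase

/-! ### The interaction matrix and the normal form of a fixpoint -/

section Interaction

theorem tParam_base_pos {q k : ℕ} (hq : 2 ≤ q) (hk : 2 ≤ k) : (0 : ℝ) < (q : ℝ) ^ k - q := by
  have h : q < q ^ k := by
    calc q = q ^ 1 := (pow_one q).symm
      _ < q ^ k := Nat.pow_lt_pow_right (by omega) (by omega)
  have : (q : ℝ) < (q : ℝ) ^ k := by exact_mod_cast h
  linarith

theorem tParam_pos {q k : ℕ} (hq : 2 ≤ q) (hk : 2 ≤ k) (d : ℕ) : 0 < tParam q k d :=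
  Real.rpow_pos_of_pos (tParam_base_pos hq hk) _

theorem tParam_pow {q k : ℕ} (hq : 2 ≤ q) (hk : 2 ≤ k) (d : ℕ) :
    tParam q k d ^ (d + 1) = (q : ℝ) ^ k - q := by
  rw [tParam, ← Real.rpow_natCast, ← Real.rpow_mul (tParam_base_pos hq hk).le]
  push_cast
  rw [one_div_mul_cancel (by positivity), Real.rpow_one]

theorem interaction_nonneg {q k : ℕ} (hq : 2 ≤ q) (hk : 2 ≤ k) (d : ℕ) (i j : Fin (q + 1)) :
    0 ≤ interaction q k d i j := by
  have := (tParam_pos hq hk d).le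
  simp only [interaction, Matrix.of_apply]
  split_ifs <;> positivity

theorem interaction_symm (q k d : ℕ) (i j : Fin (q + 1)) :
    interaction q k d i j = interaction q k d j i := by
  by_cases hi : i = 0 <;> by_cases hj : j = 0 <;> simp [interaction, hi, hj, eq_comm]

theorem interaction_zero_pos {q k : ℕ} (hq : 2 ≤ q) (hk : 2 ≤ k) (d : ℕ) (j : Fin (q + 1)) :
    0 < interaction q k d 0 j := by
  have := tParam_pos hq hk d
  simp only [interaction, Matrix.of_apply]
  split_ifs <;> positivity

theorem sum_interaction_zero (q k d : ℕ) (f : Fin (q + 1) → ℝ) :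
    ∑ j, interaction q k d 0 j * f j =
      tParam q k d * (tParam q k d * f 0 + ∑ j : Fin q, f j.succ) := by
  rw [Fin.sum_univ_succ]
  simp [interaction, Finset.mul_sum, mul_add]
  ring

theorem sum_interaction_succ (q k d : ℕ) (f : Fin (q + 1) → ℝ) (i : Fin q) :
    ∑ j, interaction q k d i.succ j * f j =
      tParam q k d * f 0 + ∑ j : Fin q, f j.succ - f i.succ := by
  rw [Fin.sum_univ_succ]
  have h : ∀ j : Fin q, interaction q k d i.succ j.succ * f j.succ =
      f j.succ - if i = j then f j.succ else 0 := fun j => by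
    by_cases hij : i = j
    · simp [interaction, hij]
    · simp [interaction, hij]
  rw [Finset.sum_congr rfl fun j _ => h j, Finset.sum_sub_distrib]
  simp [interaction]
  ring

theorem sum_sum_interaction (q k d : ℕ) (f g : Fin (q + 1) → ℝ) :
    ∑ i, ∑ j, interaction q k d i j * f i * g j =
      (tParam q k d * f 0 + ∑ i : Fin q, f i.succ) * (tParam q k d * g 0 + ∑ i : Fin q, g i.succ) -
        ∑ i : Fin q, f i.succ * g i.succ := by
  have h : ∀ i, ∑ j, interaction q k d i j * f i * g j = f i * ∑ j, interaction q k d i j * g j :=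
    fun i => by
      rw [Finset.mul_sum]; exact Finset.sum_congr rfl fun j _ => by ring
  rw [Finset.sum_congr rfl fun i _ => h i, Fin.sum_univ_succ, sum_interaction_zero]
  simp only [sum_interaction_succ, mul_sub, Finset.sum_sub_distrib, ← Finset.sum_mul]
  ring

theorem exists_class_of_hasType {q n : ℕ} {R : Fin (q + 1) → ℝ} (h : HasType R n n 0) (hn : 0 < n) :
    ∃ a b : ℝ, b < a ∧ ∃ s : Finset (Fin q), s.card = n ∧ sᶜ.card = n ∧
      (∀ i ∈ s, R i.succ = a) ∧ ∀ i ∉ s, R i.succ = b := by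
  have hf : ({n, n, 0} : Multiset ℕ).filter (fun m => 0 < m) = {n, n} := by
    simp only [Multiset.insert_eq_cons]
    rw [Multiset.filter_cons_of_pos _ hn, Multiset.filter_cons_of_pos _ hn]
    simp [Multiset.filter_singleton]
  rw [HasType, hf, multiplicities] at h
  set T := Finset.univ.image fun i : Fin q => R i.succ with hT
  have hcard : T.card = 2 := by
    have := congrArg Multiset.card h
    simpa using this
  obtain ⟨a, b, hab, hTab⟩ := Finset.card_eq_two.1 hcard
  wlog hlt : b < a generalizing a b
  · exact this b a hab.symm (by rw [hTab, Finset.pair_comm]) (lt_of_le_of_ne (not_lt.1 hlt) hab)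
  have hall : ∀ x ∈ T, (Finset.univ.filter fun i : Fin q => R i.succ = x).card = n := by
    intro x hx
    have : (Finset.univ.filter fun i : Fin q => R i.succ = x).card ∈ ({n, n} : Multiset ℕ) := by
      rw [← h]; exact Multiset.mem_map_of_mem _ hx
    simpa using this
  have hmem : ∀ i : Fin q, R i.succ = a ∨ R i.succ = b := fun i => by
    have : R i.succ ∈ T := Finset.mem_image_of_mem _ (Finset.mem_univ i)
    rw [hTab] at this
    simpa using this
  refine ⟨a, b, hlt, Finset.univ.filter fun i : Fin q => R i.succ = a, hall a (by simp [hTab]), ?_,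
    by simp, fun i hi => (hmem i).resolve_left (by simpa using hi)⟩
  rw [← hall b (by simp [hTab])]
  congr 1
  ext i
  simp only [Finset.mem_compl, Finset.mem_filter, Finset.mem_univ, true_and]
  constructor
  · exact fun hi => (hmem i).resolve_left hi
  · intro hi hi'
    exact hlt.ne (hi.symm.trans hi')

theorem hasType_of_class {q n : ℕ} {R : Fin (q + 1) → ℝ} {a b : ℝ} (hab : a ≠ b)
    {s : Finset (Fin q)} (hs : s.card = n) (hs' : sᶜ.card = n) (hn : 0 < n)
    (ha : ∀ i ∈ s, R i.succ = a) (hb : ∀ i ∉ s, R i.succ = b) : HasType R n n 0 := by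
  have hf : ({n, n, 0} : Multiset ℕ).filter (fun m => 0 < m) = {n, n} := by
    simp only [Multiset.insert_eq_cons]
    rw [Multiset.filter_cons_of_pos _ hn, Multiset.filter_cons_of_pos _ hn]
    simp [Multiset.filter_singleton]
  have hfa : (Finset.univ.filter fun i : Fin q => R i.succ = a) = s := by
    ext i
    simp only [Finset.mem_filter, Finset.mem_univ, true_and]
    exact ⟨fun h => by_contra fun hi => hab (h.symm.trans (hb i hi)), ha i⟩
  have hfb : (Finset.univ.filter fun i : Fin q => R i.succ = b) = sᶜ := by
    ext i
    simp only [Finset.mem_filter, Finset.mem_univ, true_and, Finset.mem_compl]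
    exact ⟨fun h hi => hab ((ha i hi).symm.trans h), hb i⟩
  have him : (Finset.univ.image fun i : Fin q => R i.succ) = {a, b} := by
    ext x
    simp only [Finset.mem_image, Finset.mem_univ, true_and, Finset.mem_insert, Finset.mem_singleton]
    constructor
    · rintro ⟨i, rfl⟩
      by_cases hi : i ∈ s
      · exact Or.inl (ha i hi)
      · exact Or.inr (hb i hi)
    · rintro (rfl | rfl)
      · obtain ⟨i, hi⟩ := Finset.card_pos.1 (hs.symm ▸ hn)
        exact ⟨i, ha i hi⟩
      · obtain ⟨i, hi⟩ := Finset.card_pos.1 (hs'.symm ▸ hn)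
        exact ⟨i, hb i (Finset.mem_compl.1 hi)⟩
  rw [HasType, hf, multiplicities, him, Finset.insert_val_of_notMem (by simpa using hab)]
  simp only [Finset.singleton_val, Multiset.map_cons, Multiset.map_singleton, hfa, hfb, hs, hs']
  rfl

/-- The normal form of a fixpoint of type `(q/2, q/2, 0)`: both vectors are divided by the sums
`X = t R₀ + ∑ R_i` and `Y = t C₀ + ∑ C_i`, and take the values `r₁ > r₂` and `c₁ < c₂` on a set `s`
of spins and its complement. -/
structure HalfProfile (q k d : ℕ) (R C : Fin (q + 1) → ℝ) (s : Finset (Fin q))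
    (X Y A A' r₁ r₂ c₁ c₂ : ℝ) : Prop where
  card_mem : s.card = q / 2
  card_compl : sᶜ.card = q / 2
  X_pos : 0 < X
  Y_pos : 0 < Y
  A_pos : 0 < A
  A'_pos : 0 < A'
  R_zero : tParam q k d * R 0 = X * (A * ((q : ℝ) ^ k - q))
  C_zero : tParam q k d * C 0 = Y * (A' * ((q : ℝ) ^ k - q))
  R_mem : ∀ i ∈ s, R i.succ = X * r₁
  R_compl : ∀ i ∉ s, R i.succ = X * r₂
  C_mem : ∀ i ∈ s, C i.succ = Y * c₁
  C_compl : ∀ i ∉ s, C i.succ = Y * c₂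
  r₁_eq : r₁ = A * (1 - c₁) ^ d
  r₂_eq : r₂ = A * (1 - c₂) ^ d
  c₁_eq : c₁ = A' * (1 - r₁) ^ d
  c₂_eq : c₂ = A' * (1 - r₂) ^ d
  r₂_pos : 0 < r₂
  r₂_lt : r₂ < r₁
  r₁_lt : r₁ < 1
  c₁_pos : 0 < c₁
  c₁_lt : c₁ < c₂
  c₂_lt : c₂ < 1
  sum_r : A * ((q : ℝ) ^ k - q) + (q : ℝ) / 2 * (r₁ + r₂) = 1
  sum_c : A' * ((q : ℝ) ^ k - q) + (q : ℝ) / 2 * (c₁ + c₂) = 1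

theorem half_cast {q : ℕ} (hq : Even q) : ((q / 2 : ℕ) : ℝ) = (q : ℝ) / 2 := by
  rw [Nat.cast_div hq.two_dvd (by norm_num)]; norm_num

theorem sum_two_class {q : ℕ} (hq : Even q) {s : Finset (Fin q)} (hs : s.card = q / 2)
    (hs' : sᶜ.card = q / 2) {f : Fin q → ℝ} {a b : ℝ} (ha : ∀ i ∈ s, f i = a)
    (hb : ∀ i ∉ s, f i = b) : ∑ i, f i = (q : ℝ) / 2 * (a + b) := by
  rw [← Finset.sum_add_sum_compl s f, Finset.sum_congr rfl ha,
    Finset.sum_congr rfl fun i hi => hb i (Finset.mem_compl.1 hi), Finset.sum_const,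
    Finset.sum_const, hs, hs', nsmul_eq_mul, nsmul_eq_mul, half_cast hq]
  ring

/-- The recursion only sees the sums X and Y: R_0 = a (tY)^d and R_i = a (Y - C_i)^d, and likewise
for C. Hence C_i is a function of R_i, so C is constant on the same two classes, and t^(d+1) = q^k -
q turns t R_0 into a multiple of A. -/
theorem exists_halfProfile {q k d : ℕ} (hq : 4 ≤ q) (hq_even : Even q) (hk : 2 ≤ k) (hd : 1 ≤ d)
    {R C : Fin (q + 1) → ℝ} (h : IsHalfFixpoint q k d R C) :
    ∃ (s : Finset (Fin q)) (X Y A A' r₁ r₂ c₁ c₂ : ℝ),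
      HalfProfile q k d R C s X Y A A' r₁ r₂ c₁ c₂ := by
  obtain ⟨⟨hR, hC, ⟨a, ha⟩, ⟨a', ha'⟩⟩, htype⟩ := h
  have hn : 0 < q / 2 := by omega
  obtain ⟨R₁, R₂, hlt, s, hs, hs', hRs, hRs'⟩ := exists_class_of_hasType htype hn
  set t := tParam q k d with ht
  have ht0 : 0 < t := tParam_pos (by omega) hk d
  have htp : t ^ (d + 1) = (q : ℝ) ^ k - q := tParam_pow (by omega) hk d
  set X := t * R 0 + ∑ j : Fin q, R j.succ with hX
  set Y := t * C 0 + ∑ j : Fin q, C j.succ with hY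
  have hX0 : 0 < X := add_pos_of_pos_of_nonneg (mul_pos ht0 (hR 0))
    (Finset.sum_nonneg fun j _ => (hR _).le)
  have hY0 : 0 < Y := add_pos_of_pos_of_nonneg (mul_pos ht0 (hC 0))
    (Finset.sum_nonneg fun j _ => (hC _).le)
  have hRlt : ∀ i : Fin q, R i.succ < X := fun i => by
    have := Finset.single_le_sum (fun j _ => (hR (Fin.succ j)).le) (Finset.mem_univ i)
    have h2 := mul_pos ht0 (hR 0)
    rw [hX]; linarith
  have hClt : ∀ i : Fin q, C i.succ < Y := fun i => by
    have := Finset.single_le_sum (fun j _ => (hC (Fin.succ j)).le) (Finset.mem_univ i)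
    have h2 := mul_pos ht0 (hC 0)
    rw [hY]; linarith
  have hR0 : R 0 = a * (t * Y) ^ d := by rw [ha 0, sum_interaction_zero]
  have hRi : ∀ i : Fin q, R i.succ = a * (Y - C i.succ) ^ d := fun i => by
    rw [ha i.succ, sum_interaction_succ]
  have hC0 : C 0 = a' * (t * X) ^ d := by
    rw [ha' 0]
    simp only [interaction_symm q k d _ 0]
    rw [sum_interaction_zero]
  have hCi : ∀ i : Fin q, C i.succ = a' * (X - R i.succ) ^ d := fun i => by
    rw [ha' i.succ]
    simp only [interaction_symm q k d _ i.succ]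
    rw [sum_interaction_succ]
  have hapos : 0 < a := by
    have := hR 0; rw [hR0] at this; exact pos_of_mul_pos_left this (by positivity)
  have ha'pos : 0 < a' := by
    have := hC 0; rw [hC0] at this; exact pos_of_mul_pos_left this (by positivity)
  obtain ⟨i₁, hi₁⟩ := Finset.card_pos.1 (hs.symm ▸ hn)
  obtain ⟨i₂, hi₂⟩ := Finset.card_pos.1 (hs'.symm ▸ hn)
  rw [Finset.mem_compl] at hi₂
  set C₁ := a' * (X - R₁) ^ d with hC₁
  set C₂ := a' * (X - R₂) ^ d with hC₂
  have hCs : ∀ i ∈ s, C i.succ = C₁ := fun i hi => by rw [hCi, hRs i hi]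
  have hCs' : ∀ i ∉ s, C i.succ = C₂ := fun i hi => by rw [hCi, hRs' i hi]
  have hR₁X : R₁ < X := hRs i₁ hi₁ ▸ hRlt i₁
  have hR₂0 : 0 < R₂ := hRs' i₂ hi₂ ▸ hR _
  have hC₁0 : 0 < C₁ := hCs i₁ hi₁ ▸ hC _
  have hC₂Y : C₂ < Y := hCs' i₂ hi₂ ▸ hClt i₂
  -- The recursion is decreasing in R_i, so the class with the larger value of R has the smaller
  -- value of C.
  have hClt' : C₁ < C₂ := mul_lt_mul_of_pos_left
    (pow_lt_pow_left₀ (by linarith) (by linarith) (by omega)) ha'pos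
  have hsumR : X = t * R 0 + (q : ℝ) / 2 * (R₁ + R₂) := by
    rw [hX, sum_two_class hq_even hs hs' (f := fun j : Fin q => R j.succ) hRs hRs']
  have hsumC : Y = t * C 0 + (q : ℝ) / 2 * (C₁ + C₂) := by
    rw [hY, sum_two_class hq_even hs hs' (f := fun j : Fin q => C j.succ) hCs hCs']
  have key : ∀ {b U V z : ℝ}, 0 < U → 0 < V → b * (V - z) ^ d / U =
      b * V ^ d / U * (1 - z / V) ^ d := by
    intro b U V z hU hV
    have : V - z = V * (1 - z / V) := by field_simp
    rw [this, mul_pow]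
    ring
  have hRz : t * R 0 = X * (a * Y ^ d / X * ((q : ℝ) ^ k - q)) := by
    rw [hR0, ← htp, mul_pow, pow_succ']; field_simp
  have hCz : t * C 0 = Y * (a' * X ^ d / Y * ((q : ℝ) ^ k - q)) := by
    rw [hC0, ← htp, mul_pow, pow_succ']; field_simp
  refine ⟨s, X, Y, a * Y ^ d / X, a' * X ^ d / Y, R₁ / X, R₂ / X, C₁ / Y, C₂ / Y, hs, hs', hX0, hY0,
    by positivity, by positivity, hRz, hCz, ?_, ?_, ?_, ?_, ?_, ?_, ?_, ?_, by positivity,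
    div_lt_div_of_pos_right hlt hX0, (div_lt_one hX0).2 hR₁X, by positivity,
    div_lt_div_of_pos_right hClt' hY0, (div_lt_one hY0).2 hC₂Y, ?_, ?_⟩
  · intro i hi; rw [hRs i hi]; field_simp
  · intro i hi; rw [hRs' i hi]; field_simp
  · intro i hi; rw [hCs i hi]; field_simp
  · intro i hi; rw [hCs' i hi]; field_simp
  · rw [← key hX0 hY0, ← hCs i₁ hi₁, ← hRi, hRs i₁ hi₁]
  · rw [← key hX0 hY0, ← hCs' i₂ hi₂, ← hRi, hRs' i₂ hi₂]
  · rw [← key hY0 hX0]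
  · rw [← key hY0 hX0]
  · have : X * (a * Y ^ d / X * ((q : ℝ) ^ k - q) + (q : ℝ) / 2 * (R₁ / X + R₂ / X)) = X * 1 := by
      rw [mul_add, ← hRz, mul_one]
      conv_rhs => rw [hsumR]
      field_simp
    exact mul_left_cancel₀ hX0.ne' this
  · have : Y * (a' * X ^ d / Y * ((q : ℝ) ^ k - q) + (q : ℝ) / 2 * (C₁ / Y + C₂ / Y)) = Y * 1 := by
      rw [mul_add, ← hCz, mul_one]
      conv_rhs => rw [hsumC]
      field_simp
    exact mul_left_cancel₀ hY0.ne' this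

end Interaction

end SpinPhase

namespace SpinPhase

/-! ### One inequality and the monotone functions of the ratio -/

section Profile

/-- Reverse the geometric sum and apply AM-GM to each pair of exponents 2i and 2(d-1-i), whose
geometric mean is z^(d-1); the pair with i = 0 is strict. -/
theorem card_mul_pow_lt_geom {d : ℕ} (hd : 2 ≤ d) {z : ℝ} (h0 : 0 < z) (h1 : z < 1) :
    d * z ^ (d - 1) < ∑ i ∈ Finset.range d, (z ^ 2) ^ i := by
  have hr := Finset.sum_range_reflect (fun i => (z ^ 2) ^ i) d
  have h2 : 2 * (d * z ^ (d - 1)) < ∑ i ∈ Finset.range d, ((z ^ 2) ^ i + (z ^ 2) ^ (d - 1 - i)) := by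
    have e : 2 * (d * z ^ (d - 1)) = ∑ i ∈ Finset.range d, 2 * z ^ (d - 1) := by
      simp; ring
    rw [e]
    have hterm : ∀ i ∈ Finset.range d, (z ^ 2) ^ i + (z ^ 2) ^ (d - 1 - i) - 2 * z ^ (d - 1) =
        (z ^ i - z ^ (d - 1 - i)) ^ 2 := by
      intro i hi
      rw [Finset.mem_range] at hi
      have : z ^ (d - 1) = z ^ i * z ^ (d - 1 - i) := by rw [← pow_add]; congr 1; omega
      rw [this]; ring
    refine Finset.sum_lt_sum (fun i hi => ?_) ⟨0, Finset.mem_range.2 (by omega), ?_⟩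
    · have := hterm i hi
      nlinarith [sq_nonneg (z ^ i - z ^ (d - 1 - i))]
    · have h3 := hterm 0 (Finset.mem_range.2 (by omega))
      have h4 : z ^ (d - 1) < 1 := pow_lt_one₀ h0.le h1 (by omega)
      have h5 : 0 < (z ^ 0 - z ^ (d - 1 - 0)) ^ 2 := by
        rw [pow_zero, Nat.sub_zero]
        have : 0 < 1 - z ^ (d - 1) := by linarith
        positivity
      linarith
  rw [Finset.sum_add_distrib, hr] at h2
  linarith

theorem card_mul_pow_mul_lt {d : ℕ} (hd : 2 ≤ d) {z : ℝ} (h0 : 0 < z) (h1 : z < 1) :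
    d * z ^ (d - 1) * (1 - z ^ 2) < 1 - (z ^ 2) ^ d := by
  have h2 : 0 < 1 - z ^ 2 := by nlinarith
  rw [← geom_sum_mul_neg (z ^ 2) d]
  exact mul_lt_mul_of_pos_right (card_mul_pow_lt_geom hd h0 h1) h2

/-- The previous inequality at √z, squared. Its uses are the uniqueness of the ratio at a stationary
profile, the monotonicity of `profileFactor`, and the spectral gap. -/
theorem sq_mul_pow_mul_sq_lt {d : ℕ} (hd : 2 ≤ d) {z : ℝ} (h0 : 0 < z) (h1 : z < 1) :
    (d : ℝ) ^ 2 * z ^ (d - 1) * (1 - z) ^ 2 < (1 - z ^ d) ^ 2 := by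
  have hs : 0 < √z := Real.sqrt_pos.2 h0
  have hs1 : √z < 1 := by rw [Real.sqrt_lt' one_pos]; simpa using h1
  have h := card_mul_pow_mul_lt hd hs hs1
  rw [Real.sq_sqrt h0.le] at h
  have h2 : (d : ℝ) ^ 2 * z ^ (d - 1) * (1 - z) ^ 2 = (d * √z ^ (d - 1) * (1 - z)) ^ 2 := by
    rw [mul_pow, mul_pow, ← pow_mul, mul_comm (d - 1) 2, pow_mul, Real.sq_sqrt h0.le]
  rw [h2]
  have h3 : 0 ≤ 1 - z := by linarith
  exact pow_lt_pow_left₀ h (by positivity) two_ne_zero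

theorem one_sub_pow_pos {z : ℝ} (h0 : 0 < z) (h1 : z < 1) {n : ℕ} (hn : n ≠ 0) : 0 < 1 - z ^ n := by
  have := pow_lt_one₀ h0.le h1 hn
  linarith

theorem strictMonoOn_inv_sub {d : ℕ} (hd : 2 ≤ d) :
    StrictMonoOn (fun z : ℝ => 1 / (1 - z) - d / (1 - z ^ d)) (Set.Ioo 0 1) := by
  have hder : ∀ z ∈ Set.Ioo (0 : ℝ) 1, HasDerivAt (fun z : ℝ => 1 / (1 - z) - d / (1 - z ^ d))
      (1 / (1 - z) ^ 2 - d * (d * z ^ (d - 1)) / (1 - z ^ d) ^ 2) z := by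
    rintro z ⟨h0, h1⟩
    have hz : 1 - z ≠ 0 := by linarith
    have hzd := (one_sub_pow_pos h0 h1 (n := d) (by omega)).ne'
    have a1 : HasDerivAt (fun z : ℝ => 1 - z) (-1) z := by
      simpa using (hasDerivAt_id z).const_sub 1
    have a2 : HasDerivAt (fun z : ℝ => 1 - z ^ d) (-(d * z ^ (d - 1))) z := by
      simpa using (hasDerivAt_pow d z).const_sub 1
    refine (((hasDerivAt_const z (1 : ℝ)).div a1 hz).sub
      ((hasDerivAt_const z (d : ℝ)).div a2 hzd)).congr_deriv ?_
    ring
  refine strictMonoOn_of_deriv_pos (convex_Ioo 0 1)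
    (fun z hz => (hder z hz).continuousAt.continuousWithinAt) fun z hz => ?_
  rw [interior_Ioo] at hz
  rw [(hder z hz).deriv]
  have hz1 : 0 < 1 - z := by linarith [hz.2]
  have hzd := one_sub_pow_pos hz.1 hz.2 (n := d) (by omega)
  have hK := sq_mul_pow_mul_sq_lt hd hz.1 hz.2
  rw [sub_pos, div_lt_div_iff₀ (by positivity) (by positivity)]
  linarith

/-- Solving for the values in terms of y and z turns the stationarity condition `hbal` into the
equality of 1/(1-z) - d/(1-z^d) at y and at z, a strictly monotone function. -/
theorem profile_ratio_eq {d : ℕ} (hd : 2 ≤ d) {r₁ r₂ c₁ c₂ y z : ℝ} (hy : y ∈ Set.Ioo (0 : ℝ) 1)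
    (hz : z ∈ Set.Ioo (0 : ℝ) 1) (hr₁ : r₁ * (1 - z * y ^ d) = 1 - z) (hr₂ : r₂ = y ^ d * r₁)
    (hc₂ : c₂ * (1 - y * z ^ d) = 1 - y) (hc₁ : c₁ = z ^ d * c₂)
    (hbal : r₁ + c₁ + (d - 1) * (r₁ * c₁) = r₂ + c₂ + (d - 1) * (r₂ * c₂)) : y = z := by
  refine (strictMonoOn_inv_sub hd).injOn hy hz ?_
  have hy1 : 0 < 1 - y := by linarith [hy.2]
  have hz1 : 0 < 1 - z := by linarith [hz.2]
  have hyd := one_sub_pow_pos hy.1 hy.2 (n := d) (by omega)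
  have hzd := one_sub_pow_pos hz.1 hz.2 (n := d) (by omega)
  set Y := y ^ d with hY
  set Z := z ^ d with hZ
  have hY0 : 0 < Y := pow_pos hy.1 d
  have hZ0 : 0 < Z := pow_pos hz.1 d
  have e1 : 0 < 1 - z * Y := by nlinarith
  have e2 : 0 < 1 - y * Z := by nlinarith
  have hr : r₁ = (1 - z) / (1 - z * Y) := by rw [eq_div_iff e1.ne', hr₁]
  have hc : c₂ = (1 - y) / (1 - y * Z) := by rw [eq_div_iff e2.ne', hc₂]
  rw [hr₂, hc₁, hr, hc] at hbal
  have e3 : 1 - Z * y ≠ 0 := by rw [mul_comm]; exact e2.ne'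
  field_simp at hbal
  rw [div_sub_div _ _ hy1.ne' hyd.ne', div_sub_div _ _ hz1.ne' hzd.ne',
    div_eq_div_iff (by positivity) (by positivity)]
  linear_combination hbal

/-- The ratios are y = (1-c₂)/(1-c₁) and z = (1-r₁)/(1-r₂). Dividing the profile equations
eliminates A and A', and the definitions of y and z then determine r₁ and c₂. -/
theorem HalfProfile.exists_ratios {q k d : ℕ} {R C : Fin (q + 1) → ℝ} {s : Finset (Fin q)}
    {X Y A A' r₁ r₂ c₁ c₂ : ℝ} (h : HalfProfile q k d R C s X Y A A' r₁ r₂ c₁ c₂) :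
    ∃ y ∈ Set.Ioo (0 : ℝ) 1, ∃ z ∈ Set.Ioo (0 : ℝ) 1, r₁ * (1 - z * y ^ d) = 1 - z ∧
      r₂ = y ^ d * r₁ ∧ c₂ * (1 - y * z ^ d) = 1 - y ∧ c₁ = z ^ d * c₂ := by
  have h1 : 0 < 1 - r₁ := by linarith [h.r₁_lt]
  have h2 : 0 < 1 - r₂ := by linarith [h.r₂_lt]
  have h3 : 0 < 1 - c₂ := by linarith [h.c₂_lt]
  have h4 : 0 < 1 - c₁ := by linarith [h.c₁_lt]
  have hr2 : r₂ = ((1 - c₂) / (1 - c₁)) ^ d * r₁ := by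
    rw [div_pow, h.r₁_eq, div_mul_eq_mul_div, eq_div_iff (by positivity)]
    conv_lhs => rw [h.r₂_eq]
    ring
  have hc1 : c₁ = ((1 - r₁) / (1 - r₂)) ^ d * c₂ := by
    rw [div_pow, h.c₂_eq, div_mul_eq_mul_div, eq_div_iff (by positivity)]
    conv_lhs => rw [h.c₁_eq]
    ring
  refine ⟨(1 - c₂) / (1 - c₁), ⟨by positivity, (div_lt_one h4).2 (by linarith [h.c₁_lt])⟩,
    (1 - r₁) / (1 - r₂), ⟨by positivity, (div_lt_one h2).2 (by linarith [h.r₂_lt])⟩, ?_, hr2, ?_, hc1⟩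
  · have : r₁ * (1 - (1 - r₁) / (1 - r₂) * ((1 - c₂) / (1 - c₁)) ^ d) =
        r₁ - (1 - r₁) / (1 - r₂) * (((1 - c₂) / (1 - c₁)) ^ d * r₁) := by ring
    rw [this, ← hr2]
    field_simp
    ring
  · have : c₂ * (1 - (1 - c₂) / (1 - c₁) * ((1 - r₁) / (1 - r₂)) ^ d) =
        c₂ - (1 - c₂) / (1 - c₁) * (((1 - r₁) / (1 - r₂)) ^ d * c₂) := by ring
    rw [this, ← hc1]
    field_simp
    ring

/-- The larger of the two values of a balanced fixpoint, in terms of the ratio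
`z = (1 - x) / (1 - y)`. The smaller one is `z ^ d` times as large. -/
noncomputable def largeValue (d : ℕ) (z : ℝ) : ℝ := (∑ i ∈ Finset.range (d + 1), z ^ i)⁻¹

theorem geom_pos {z : ℝ} (h0 : 0 ≤ z) (n : ℕ) : 0 < ∑ i ∈ Finset.range (n + 1), z ^ i := by
  rw [Finset.sum_range_succ']
  have : 0 ≤ ∑ i ∈ Finset.range n, z ^ (i + 1) := Finset.sum_nonneg fun i _ => by positivity
  simp only [pow_zero]
  linarith

theorem largeValue_mul (d : ℕ) {z : ℝ} (h0 : 0 < z) : largeValue d z * (1 - z ^ (d + 1)) = 1 - z := by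
  have := geom_pos h0.le d
  rw [← geom_sum_mul_neg z (d + 1), largeValue]
  field_simp

theorem largeValue_eq (d : ℕ) {z : ℝ} (h0 : 0 < z) (h1 : z < 1) :
    largeValue d z = (1 - z) / (1 - z ^ (d + 1)) := by
  rw [eq_div_iff (one_sub_pow_pos h0 h1 (by omega)).ne', largeValue_mul d h0]

theorem one_sub_smallValue_eq (d : ℕ) {z : ℝ} (h0 : 0 < z) (h1 : z < 1) :
    1 - z ^ d * largeValue d z = (1 - z ^ d) / (1 - z ^ (d + 1)) := by
  have := (one_sub_pow_pos h0 h1 (n := d + 1) (by omega)).ne'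
  rw [largeValue_eq d h0 h1]
  field_simp
  ring

theorem one_sub_largeValue_eq (d : ℕ) {z : ℝ} (h0 : 0 < z) (h1 : z < 1) :
    1 - largeValue d z = z * (1 - z ^ d) / (1 - z ^ (d + 1)) := by
  have := (one_sub_pow_pos h0 h1 (n := d + 1) (by omega)).ne'
  rw [largeValue_eq d h0 h1]
  field_simp
  ring

/-- The factor `A` in `x = A (1 - y) ^ d` and `y = A (1 - x) ^ d`. -/
noncomputable def profileFactor (d : ℕ) (z : ℝ) : ℝ :=
  largeValue d z / (1 - z ^ d * largeValue d z) ^ d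

theorem smallValue_eq_factor_mul {d : ℕ} (hd : 1 ≤ d) {z : ℝ} (h0 : 0 < z) (h1 : z < 1) :
    z ^ d * largeValue d z = profileFactor d z * (1 - largeValue d z) ^ d := by
  have e1 := one_sub_pow_pos h0 h1 (n := d + 1) (by omega)
  have e2 := one_sub_pow_pos h0 h1 (n := d) (by omega)
  rw [profileFactor, one_sub_smallValue_eq d h0 h1, one_sub_largeValue_eq d h0 h1, div_pow, div_pow,
    mul_pow]
  field_simp

theorem log_profileFactor {d : ℕ} (hd : 1 ≤ d) {z : ℝ} (h0 : 0 < z) (h1 : z < 1) :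
    Real.log (profileFactor d z) = Real.log (1 - z) + (d - 1) * Real.log (1 - z ^ (d + 1)) -
      d * Real.log (1 - z ^ d) := by
  have e1 := one_sub_pow_pos h0 h1 (n := d + 1) (by omega)
  have e2 := one_sub_pow_pos h0 h1 (n := d) (by omega)
  have e3 : 0 < 1 - z := by linarith
  rw [profileFactor, one_sub_smallValue_eq d h0 h1, largeValue_eq d h0 h1,
    Real.log_div (by positivity) (by positivity), Real.log_pow, Real.log_div (by positivity)
    (by positivity), Real.log_div (by positivity) (by positivity)]
  ring

theorem strictAntiOn_log_profileFactor {d : ℕ} (hd : 2 ≤ d) :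
    StrictAntiOn (fun z : ℝ => Real.log (1 - z) + (d - 1) * Real.log (1 - z ^ (d + 1)) -
      d * Real.log (1 - z ^ d)) (Set.Ioo 0 1) := by
  have hpow : ∀ (n : ℕ) (z : ℝ), HasDerivAt (fun z : ℝ => 1 - z ^ n) (-(n * z ^ (n - 1))) z :=
    fun n z => by simpa using (hasDerivAt_pow n z).const_sub 1
  have hder : ∀ z ∈ Set.Ioo (0 : ℝ) 1, HasDerivAt (fun z : ℝ => Real.log (1 - z) +
      (d - 1) * Real.log (1 - z ^ (d + 1)) - d * Real.log (1 - z ^ d))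
      (-1 / (1 - z) + (d - 1) * (-((d + 1) * z ^ d) / (1 - z ^ (d + 1))) -
        d * (-(d * z ^ (d - 1)) / (1 - z ^ d))) z := by
    rintro z ⟨h0, h1⟩
    have hz : 1 - z ≠ 0 := by linarith
    have e1 := one_sub_pow_pos h0 h1 (n := d + 1) (by omega)
    have e2 := one_sub_pow_pos h0 h1 (n := d) (by omega)
    have a1 : HasDerivAt (fun z : ℝ => 1 - z) (-1) z := by
      simpa using (hasDerivAt_id z).const_sub 1
    have a2 := (hpow (d + 1) z).log e1.ne'
    have a3 := (hpow d z).log e2.ne'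
    refine (((a1.log hz).add (a2.const_mul ((d : ℝ) - 1))).sub
      (a3.const_mul (d : ℝ))).congr_deriv ?_
    push_cast
    rfl
  refine strictAntiOn_of_deriv_neg (convex_Ioo 0 1)
    (fun z hz => (hder z hz).continuousAt.continuousWithinAt) fun z hz => ?_
  rw [interior_Ioo] at hz
  rw [(hder z hz).deriv]
  obtain ⟨h0, h1⟩ := hz
  have hz1 : 0 < 1 - z := by linarith
  have e1 := one_sub_pow_pos h0 h1 (n := d + 1) (by omega)
  have e2 := one_sub_pow_pos h0 h1 (n := d) (by omega)
  have hK := sq_mul_pow_mul_sq_lt hd h0 h1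
  obtain ⟨m, rfl⟩ : ∃ m, d = m + 1 := ⟨d - 1, by omega⟩
  simp only [Nat.add_sub_cancel] at hK ⊢
  -- Over a common denominator the derivative has numerator d² z^(d-1) (1-z)² - (1-z^d)².
  have key : -1 / (1 - z) + (((m + 1 : ℕ) : ℝ) - 1) * (-((((m + 1 : ℕ) : ℝ) + 1) * z ^ (m + 1)) /
      (1 - z ^ (m + 1 + 1))) - ((m + 1 : ℕ) : ℝ) * (-(((m + 1 : ℕ) : ℝ) * z ^ m) / (1 - z ^ (m + 1))) =
      (((m + 1 : ℕ) : ℝ) ^ 2 * z ^ m * (1 - z) ^ 2 - (1 - z ^ (m + 1)) ^ 2) /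
        ((1 - z) * (1 - z ^ (m + 1)) * (1 - z ^ (m + 1 + 1))) := by
    field_simp
    ring
  rw [key]
  exact div_neg_of_neg_of_pos (by linarith) (by positivity)

theorem profileFactor_pos {d : ℕ} (hd : 1 ≤ d) {z : ℝ} (h0 : 0 < z) (h1 : z < 1) :
    0 < profileFactor d z := by
  have e1 := one_sub_pow_pos h0 h1 (n := d + 1) (by omega)
  have e2 := one_sub_pow_pos h0 h1 (n := d) (by omega)
  have e3 : 0 < 1 - z := by linarith
  rw [profileFactor, one_sub_smallValue_eq d h0 h1, largeValue_eq d h0 h1]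
  positivity

theorem strictAntiOn_profileFactor {d : ℕ} (hd : 2 ≤ d) :
    StrictAntiOn (profileFactor d) (Set.Ioo 0 1) := by
  intro a ha b hb hab
  have h := strictAntiOn_log_profileFactor hd ha hb hab
  simp only at h
  rw [← log_profileFactor (by omega) ha.1 ha.2, ← log_profileFactor (by omega) hb.1 hb.2] at h
  exact (Real.log_lt_log_iff (profileFactor_pos (by omega) hb.1 hb.2)
    (profileFactor_pos (by omega) ha.1 ha.2)).1 h

/-- The sum is 1 - (z - z^d)/(1 - z^(d+1)); the sign of its derivative is again the AM-GM
inequality, in the form `card_mul_pow_mul_lt`. -/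
theorem antitoneOn_sum_values {d : ℕ} (hd : 2 ≤ d) :
    AntitoneOn (fun z => largeValue d z + z ^ d * largeValue d z) (Set.Ioo 0 1) := by
  have hEq : Set.EqOn (fun z => largeValue d z + z ^ d * largeValue d z)
      (fun z => 1 - (z - z ^ d) / (1 - z ^ (d + 1))) (Set.Ioo 0 1) := by
    rintro z ⟨h0, h1⟩
    have e1 := (one_sub_pow_pos h0 h1 (n := d + 1) (by omega)).ne'
    simp only
    rw [largeValue_eq d h0 h1]
    field_simp
    ring
  have hpow : ∀ (n : ℕ) (z : ℝ), HasDerivAt (fun z : ℝ => 1 - z ^ n) (-(n * z ^ (n - 1))) z :=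
    fun n z => by simpa using (hasDerivAt_pow n z).const_sub 1
  have hder : ∀ z ∈ Set.Ioo (0 : ℝ) 1, HasDerivAt (fun z : ℝ => 1 - (z - z ^ d) / (1 - z ^ (d + 1)))
      (-(((1 - d * z ^ (d - 1)) * (1 - z ^ (d + 1)) + (z - z ^ d) * ((d + 1) * z ^ d)) /
        (1 - z ^ (d + 1)) ^ 2)) z := by
    rintro z ⟨h0, h1⟩
    have e1 := one_sub_pow_pos h0 h1 (n := d + 1) (by omega)
    have a1 : HasDerivAt (fun z : ℝ => z - z ^ d) (1 - d * z ^ (d - 1)) z :=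
      (hasDerivAt_id z).sub (hasDerivAt_pow d z)
    refine ((a1.div (hpow (d + 1) z) e1.ne').const_sub 1).congr_deriv ?_
    push_cast
    ring
  refine AntitoneOn.congr ?_ hEq.symm
  refine antitoneOn_of_deriv_nonpos (convex_Ioo 0 1)
    (fun z hz => (hder z hz).continuousAt.continuousWithinAt)
    (fun z hz => (hder z (interior_subset hz)).differentiableAt.differentiableWithinAt) fun z hz => ?_
  rw [interior_Ioo] at hz
  rw [(hder z hz).deriv]
  obtain ⟨h0, h1⟩ := hz
  have hK := card_mul_pow_mul_lt hd h0 h1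
  obtain ⟨m, rfl⟩ : ∃ m, d = m + 1 := ⟨d - 1, by omega⟩
  simp only [Nat.add_sub_cancel] at hK ⊢
  have key : (1 - ((m + 1 : ℕ) : ℝ) * z ^ m) * (1 - z ^ (m + 1 + 1)) +
      (z - z ^ (m + 1)) * ((((m + 1 : ℕ) : ℝ) + 1) * z ^ (m + 1)) =
      1 - (z ^ 2) ^ (m + 1) - ((m + 1 : ℕ) : ℝ) * z ^ m * (1 - z ^ 2) := by
    ring
  rw [key, neg_nonpos]
  exact div_nonneg (by linarith) (by positivity)

end Profile

end SpinPhase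

namespace SpinPhase

/-! ### Existence and uniqueness of balanced fixpoints -/

section Balanced

/-- The normal form of a balanced fixpoint of type `(q/2, q/2, 0)`. -/
def BalancedProfile (q k d : ℕ) (R C : Fin (q + 1) → ℝ) (s : Finset (Fin q)) (X Y z : ℝ) : Prop :=
  HalfProfile q k d R C s X Y (profileFactor d z) (profileFactor d z) (largeValue d z)
    (z ^ d * largeValue d z) (z ^ d * largeValue d z) (largeValue d z)

theorem HalfProfile.balancedProfile {q k d : ℕ} {R C : Fin (q + 1) → ℝ} {s : Finset (Fin q)}
    {X Y A A' r₁ r₂ c₁ c₂ : ℝ} (h : HalfProfile q k d R C s X Y A A' r₁ r₂ c₁ c₂) {z : ℝ}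
    (h0 : 0 < z) (hr₁ : r₁ * (1 - z * z ^ d) = 1 - z) (hr₂ : r₂ = z ^ d * r₁)
    (hc₂ : c₂ * (1 - z * z ^ d) = 1 - z) (hc₁ : c₁ = z ^ d * c₂) (h1 : z < 1) :
    BalancedProfile q k d R C s X Y z := by
  have e := (one_sub_pow_pos h0 h1 (n := d + 1) (by omega)).ne'
  have er : r₁ = largeValue d z := by
    rw [largeValue_eq d h0 h1, eq_div_iff e, ← hr₁, pow_succ']
  have ec : c₂ = largeValue d z := by
    rw [largeValue_eq d h0 h1, eq_div_iff e, ← hc₂, pow_succ']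
  subst er ec
  subst hr₂ hc₁
  have hne : (1 - z ^ d * largeValue d z) ^ d ≠ 0 := pow_ne_zero _ (by
    have := h.r₂_lt; have := h.r₁_lt; linarith)
  have eA : A = profileFactor d z := by
    rw [profileFactor, eq_div_iff hne]; exact h.r₁_eq.symm
  have eA' : A' = profileFactor d z := by
    rw [profileFactor, eq_div_iff hne]; exact h.c₂_eq.symm
  subst eA
  rw [eA'] at h
  exact h

theorem BalancedProfile.isBalanced {q k d : ℕ} {R C : Fin (q + 1) → ℝ} {s : Finset (Fin q)}
    {X Y z : ℝ} (h : BalancedProfile q k d R C s X Y z) : IsBalanced R C := by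
  have hX := h.X_pos
  have hY := h.Y_pos
  have h1 := h.r₂_pos
  have h2 : 0 < largeValue d z := h1.trans h.r₂_lt
  intro i j
  by_cases hi : i ∈ s <;> by_cases hj : j ∈ s
  · rw [h.R_mem i hi, h.R_mem j hj, h.C_mem i hi, h.C_mem j hj, div_self (by positivity),
      div_self (by positivity)]
  · rw [h.R_mem i hi, h.R_compl j hj, h.C_mem i hi, h.C_compl j hj, mul_div_mul_left _ _ hX.ne',
      mul_div_mul_left _ _ hY.ne']
  · rw [h.R_compl i hi, h.R_mem j hj, h.C_compl i hi, h.C_mem j hj, mul_div_mul_left _ _ hX.ne',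
      mul_div_mul_left _ _ hY.ne']
  · rw [h.R_compl i hi, h.R_compl j hj, h.C_compl i hi, h.C_compl j hj, div_self (by positivity),
      div_self (by positivity)]

/-- For two classes balance means r₁ c₁ = r₂ c₂, that is y^d = z^d, so the two ratios coincide. -/
theorem exists_balancedProfile {q k d : ℕ} (hq : 4 ≤ q) (hq_even : Even q) (hk : 2 ≤ k) (hd : 1 ≤ d)
    {R C : Fin (q + 1) → ℝ} (h : IsHalfFixpoint q k d R C) (hbal : IsBalanced R C) :
    ∃ (s : Finset (Fin q)) (X Y z : ℝ), z ∈ Set.Ioo (0 : ℝ) 1 ∧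
      BalancedProfile q k d R C s X Y z := by
  obtain ⟨s, X, Y, A, A', r₁, r₂, c₁, c₂, hp⟩ := exists_halfProfile hq hq_even hk hd h
  obtain ⟨y, hy, z, hz, hr₁, hr₂, hc₂, hc₁⟩ := hp.exists_ratios
  obtain ⟨i, hi⟩ := Finset.card_pos.1 (hp.card_mem ▸ (by omega : 0 < q / 2))
  obtain ⟨j, hj⟩ := Finset.card_pos.1 (hp.card_compl ▸ (by omega : 0 < q / 2))
  rw [Finset.mem_compl] at hj
  have hX := hp.X_pos
  have hY := hp.Y_pos
  have hr₂0 := hp.r₂_pos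
  have hr₁0 := hr₂0.trans hp.r₂_lt
  have hc₁0 := hp.c₁_pos
  have hc₂0 := hc₁0.trans hp.c₁_lt
  have hij := hbal i j
  rw [hp.R_mem i hi, hp.R_compl j hj, hp.C_mem i hi, hp.C_compl j hj, mul_div_mul_left _ _ hX.ne',
    mul_div_mul_left _ _ hY.ne', div_eq_div_iff hr₂0.ne' hc₁0.ne', hr₂, hc₁] at hij
  have hyz : y = z := by
    have h1 : y ^ d = z ^ d := by
      have h2 : (y ^ d - z ^ d) * (r₁ * c₂) = 0 := by linear_combination -hij
      have h3 := (mul_eq_zero.1 h2).resolve_right (by positivity)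
      linarith
    exact (pow_left_inj₀ hy.1.le hz.1.le (by omega)).1 h1
  subst hyz
  exact ⟨s, X, Y, y, hy, hp.balancedProfile hy.1 hr₁ hr₂ hc₂ hc₁ hy.2⟩

/-- Every entry of the profile is a function of z, and `sum_r` is the one equation left. Its left
side is strictly decreasing: the first summand strictly, the second weakly. -/
theorem BalancedProfile.ratio_unique {q k d : ℕ} (hq : 4 ≤ q) (hk : 2 ≤ k) (hd : 2 ≤ d)
    {R C R' C' : Fin (q + 1) → ℝ} {s s' : Finset (Fin q)} {X Y X' Y' z z' : ℝ}
    (h : BalancedProfile q k d R C s X Y z) (h' : BalancedProfile q k d R' C' s' X' Y' z')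
    (hz : z ∈ Set.Ioo (0 : ℝ) 1) (hz' : z' ∈ Set.Ioo (0 : ℝ) 1) : z = z' := by
  have hQ := tParam_base_pos (q := q) (by omega) hk
  have hanti : StrictAntiOn (fun z => profileFactor d z * ((q : ℝ) ^ k - q) +
      (q : ℝ) / 2 * (largeValue d z + z ^ d * largeValue d z)) (Set.Ioo 0 1) := by
    intro a ha b hb hab
    have h1 := mul_lt_mul_of_pos_right (strictAntiOn_profileFactor hd ha hb hab) hQ
    have h2 := mul_le_mul_of_nonneg_left (antitoneOn_sum_values hd ha hb hab.le)
      (by positivity : (0 : ℝ) ≤ (q : ℝ) / 2)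
    exact add_lt_add_of_lt_of_le h1 h2
  exact hanti.injOn hz hz' (h.sum_r.trans h'.sum_r.symm)

theorem one_add_inv_pow_lt_three {d : ℕ} (hd : 1 ≤ d) : (((d : ℝ) + 1) / d) ^ d < 3 := by
  have hd0 : (0 : ℝ) < d := by exact_mod_cast hd
  have h1 : ((d : ℝ) + 1) / d ≤ Real.exp (1 / d) := by
    have := Real.add_one_le_exp (1 / (d : ℝ))
    rw [add_div, div_self hd0.ne']; linarith
  calc (((d : ℝ) + 1) / d) ^ d ≤ Real.exp (1 / d) ^ d := pow_le_pow_left₀ (by positivity) h1 d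
    _ = Real.exp 1 := by rw [← Real.exp_nat_mul]; congr 1; field_simp
    _ < 3 := by linarith [Real.exp_one_lt_d9]

/-- Intermediate value theorem on the closed interval; `largeValue` is an inverse geometric sum,
hence continuous at z = 1 as well. At z = 0 the left side is q^k - q/2 > 1. At z = 1 it is below
(3(q^k - q) + q)/(d + 1), which is less than 1 since d ≥ 5q^k; the 3 bounds (1 + 1/d)^d. -/
theorem exists_ratio {q k d : ℕ} (hq : 4 ≤ q) (hk : 2 ≤ k) (hd : 5 * q ^ k ≤ d) :
    ∃ z ∈ Set.Ioo (0 : ℝ) 1, profileFactor d z * ((q : ℝ) ^ k - q) +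
      (q : ℝ) / 2 * (largeValue d z + z ^ d * largeValue d z) = 1 := by
  have hQ := tParam_base_pos (q := q) (by omega) hk
  have hq' : (4 : ℝ) ≤ q := by exact_mod_cast hq
  have hd1 : 1 ≤ d := le_trans (by have := Nat.pow_pos (n := k) (show 0 < q by omega); omega) hd
  have hd' : 5 * (q : ℝ) ^ k ≤ d := by exact_mod_cast hd
  have hd0 : (0 : ℝ) < d := by exact_mod_cast hd1
  have hcont : ContinuousOn (fun z => profileFactor d z * ((q : ℝ) ^ k - q) +
      (q : ℝ) / 2 * (largeValue d z + z ^ d * largeValue d z)) (Set.Icc 0 1) := by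
    have hL : ContinuousOn (largeValue d) (Set.Icc 0 1) := by
      unfold largeValue
      exact ContinuousOn.inv₀ (by fun_prop) fun z hz => (geom_pos hz.1 d).ne'
    have hF : ContinuousOn (profileFactor d) (Set.Icc 0 1) := by
      unfold profileFactor
      refine hL.div ((continuousOn_const.sub ((by fun_prop : Continuous fun z : ℝ =>
        z ^ d).continuousOn.mul hL)).pow d) fun z hz => pow_ne_zero _ ?_
      have h1 := geom_pos hz.1 d
      have h2 : z ^ d < ∑ i ∈ Finset.range (d + 1), z ^ i := by
        rw [Finset.sum_range_succ]
        obtain ⟨m, rfl⟩ : ∃ m, d = m + 1 := ⟨d - 1, by omega⟩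
        have := geom_pos hz.1 m
        linarith
      have h3 : z ^ d * largeValue d z < 1 := by
        rw [largeValue, ← div_eq_mul_inv, div_lt_one h1]; exact h2
      linarith
    have hz : Continuous fun z : ℝ => z ^ d := by fun_prop
    exact (hF.mul continuousOn_const).add
      (continuousOn_const.mul (hL.add (hz.continuousOn.mul hL)))
  have hsub := intermediate_value_Ioo' zero_le_one hcont
  have hL0 : largeValue d 0 = 1 := by
    rw [largeValue, Finset.sum_range_succ']; simp
  have hL1 : largeValue d 1 = 1 / ((d : ℝ) + 1) := by
    simp [largeValue]
  have hF0 : profileFactor d 0 = 1 := by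
    rw [profileFactor, hL0]; simp [show d ≠ 0 by omega]
  have hF1 : profileFactor d 1 < 3 / ((d : ℝ) + 1) := by
    have e : profileFactor d 1 = (((d : ℝ) + 1) / d) ^ d / ((d : ℝ) + 1) := by
      rw [profileFactor, hL1, one_pow, one_mul]
      have : (1 : ℝ) - 1 / (d + 1) = (((d : ℝ) + 1) / d)⁻¹ := by field_simp; ring
      rw [this, inv_pow]
      field_simp
    rw [e]
    exact div_lt_div_of_pos_right (one_add_inv_pow_lt_three hd1) (by positivity)
  refine hsub ⟨?_, ?_⟩
  · simp only [hL1, one_pow, one_mul]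
    have h1 := mul_lt_mul_of_pos_right hF1 hQ
    have h2 : 3 / ((d : ℝ) + 1) * ((q : ℝ) ^ k - q) + (q : ℝ) / 2 * (1 / (d + 1) + 1 / (d + 1)) =
        (3 * ((q : ℝ) ^ k - q) + q) / (d + 1) := by field_simp; ring
    have h3 : (3 * ((q : ℝ) ^ k - q) + q) / ((d : ℝ) + 1) < 1 := by
      rw [div_lt_one (by positivity)]; linarith
    linarith
  · simp only [hL0, hF0, zero_pow (show d ≠ 0 by omega), add_zero, mul_one, one_mul]
    have : (q : ℝ) * q ≤ (q : ℝ) ^ k := by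
      rw [← sq]; exact pow_le_pow_right₀ (by linarith) hk
    nlinarith

theorem exists_isBalanced_isHalfFixpoint {q k d : ℕ} (hq : 4 ≤ q) (hq_even : Even q) (hk : 2 ≤ k)
    (hd : 5 * q ^ k ≤ d) :
    ∃ R C : Fin (q + 1) → ℝ, IsHalfFixpoint q k d R C ∧ IsBalanced R C := by
  obtain ⟨z, ⟨h0, h1⟩, hz⟩ := exists_ratio hq hk hd
  have hd1 : 1 ≤ d := le_trans (by have := Nat.pow_pos (n := k) (show 0 < q by omega); omega) hd
  set L := largeValue d z with hL
  set F := profileFactor d z with hF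
  set t := tParam q k d with ht
  have ht0 : 0 < t := tParam_pos (by omega) hk d
  have htp : t ^ (d + 1) = (q : ℝ) ^ k - q := tParam_pow (by omega) hk d
  have hF0 : 0 < F := profileFactor_pos hd1 h0 h1
  have hL0 : 0 < L := inv_pos.2 (geom_pos h0.le d)
  have hzd : z ^ d < 1 := pow_lt_one₀ h0.le h1 (by omega)
  have hz0 : 0 < z ^ d := pow_pos h0 d
  have hL1 : F * (1 - z ^ d * L) ^ d = L := by
    rw [hF, profileFactor, div_mul_cancel₀]
    rw [one_sub_smallValue_eq d h0 h1]
    have e1 := one_sub_pow_pos h0 h1 (n := d + 1) (by omega)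
    have e2 := one_sub_pow_pos h0 h1 (n := d) (by omega)
    positivity
  have hl1 : F * (1 - L) ^ d = z ^ d * L := (smallValue_eq_factor_mul hd1 h0 h1).symm
  obtain ⟨s, -, hs⟩ := Finset.exists_subset_card_eq (s := (Finset.univ : Finset (Fin q)))
    (n := q / 2) (by simp; omega)
  have hs' : sᶜ.card = q / 2 := by
    obtain ⟨m, hm⟩ := hq_even
    rw [Finset.card_compl, hs, Fintype.card_fin]; omega
  have hn : 0 < q / 2 := by omega
  -- The normal form with X = Y = 1: spin 0 gets F t^d on both sides, and the two values of the
  -- profile are exchanged between the sides.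
  set R : Fin (q + 1) → ℝ := Fin.cons (F * t ^ d) fun i => if i ∈ s then L else z ^ d * L with hR
  set C : Fin (q + 1) → ℝ := Fin.cons (F * t ^ d) fun i => if i ∈ s then z ^ d * L else L with hC
  have hRs : ∀ i ∈ s, R i.succ = L := fun i hi => by simp [hR, hi]
  have hRs' : ∀ i ∉ s, R i.succ = z ^ d * L := fun i hi => by simp [hR, hi]
  have hCs : ∀ i ∈ s, C i.succ = z ^ d * L := fun i hi => by simp [hC, hi]
  have hCs' : ∀ i ∉ s, C i.succ = L := fun i hi => by simp [hC, hi]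
  have hR0 : R 0 = F * t ^ d := rfl
  have hC0 : C 0 = F * t ^ d := rfl
  have hX : t * R 0 + ∑ j : Fin q, R j.succ = 1 := by
    rw [sum_two_class hq_even hs hs' (f := fun j : Fin q => R j.succ) hRs hRs', ← hz, hR0, ← htp]
    ring
  have hY : t * C 0 + ∑ j : Fin q, C j.succ = 1 := by
    rw [sum_two_class hq_even hs hs' (f := fun j : Fin q => C j.succ) hCs hCs', ← hz, hC0, ← htp]
    ring
  refine ⟨R, C, ⟨⟨?_, ?_, ⟨F, ?_⟩, ⟨F, ?_⟩⟩, ?_⟩, ?_⟩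
  · intro i
    refine Fin.cases ?_ (fun i => ?_) i
    · rw [hR0]; positivity
    · by_cases hi : i ∈ s
      · rw [hRs i hi]; exact hL0
      · rw [hRs' i hi]; positivity
  · intro i
    refine Fin.cases ?_ (fun i => ?_) i
    · rw [hC0]; positivity
    · by_cases hi : i ∈ s
      · rw [hCs i hi]; positivity
      · rw [hCs' i hi]; exact hL0
  · intro i
    refine Fin.cases ?_ (fun i => ?_) i
    · rw [sum_interaction_zero, hY, mul_one, hR0]
    · rw [sum_interaction_succ, hY]
      by_cases hi : i ∈ s
      · rw [hRs i hi, hCs i hi, hL1]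
      · rw [hRs' i hi, hCs' i hi, hl1]
  · intro i
    simp only [interaction_symm q k d _ i]
    refine Fin.cases ?_ (fun i => ?_) i
    · rw [sum_interaction_zero, hX, mul_one, hC0]
    · rw [sum_interaction_succ, hX]
      by_cases hi : i ∈ s
      · rw [hRs i hi, hCs i hi, hl1]
      · rw [hRs' i hi, hCs' i hi, hL1]
  · exact hasType_of_class (by nlinarith : L ≠ z ^ d * L) hs hs' hn hRs hRs'
  · intro i j
    have : z ^ d * L ≠ 0 := by positivity
    by_cases hi : i ∈ s <;> by_cases hj : j ∈ s <;>
      simp [hRs, hRs', hCs, hCs', hi, hj, hL0.ne', this]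

theorem phaseOf_smul_comp {q d : ℕ} {R : Fin (q + 1) → ℝ} (hR : ∀ i, 0 < R i) {a : ℝ} (ha : 0 < a)
    (π : Equiv.Perm (Fin (q + 1))) : phaseOf d (a • (R ∘ π)) = phaseOf d R ∘ π := by
  funext i
  simp only [phaseOf, Pi.smul_apply, Function.comp_apply, smul_eq_mul,
    Real.mul_rpow ha.le (hR _).le, ← Finset.mul_sum]
  rw [Equiv.sum_comp π fun j => R j ^ (((d : ℝ) + 1) / d)]
  have : a ^ (((d : ℝ) + 1) / d) ≠ 0 := (Real.rpow_pos_of_pos ha _).ne'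
  rw [mul_div_mul_left _ _ this]

/-- Sets are viewed as assignments of two Boolean spins, for which equal counts already provide a
permutation. -/
theorem exists_perm_mem_iff {q : ℕ} {s s' : Finset (Fin q)} (h : s.card = s'.card) :
    ∃ e : Equiv.Perm (Fin q), ∀ i, i ∈ s ↔ e i ∈ s' := by
  have hc : ∀ u : Finset (Fin q), spinCount (fun i => decide (i ∈ u)) true = u.card ∧
      spinCount (fun i => decide (i ∈ u)) false = uᶜ.card := fun u => by
    constructor
    · simp [spinCount]
    · simp only [spinCount, decide_eq_false_iff_not]
      congr 1
      ext i
      simp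
  obtain ⟨e, he⟩ := exists_perm_of_spinCount_eq (n := q) (σ := fun i => decide (i ∈ s'))
    (τ := fun i => decide (i ∈ s)) (by
      funext b
      cases b
      · rw [(hc s).2, (hc s').2, Finset.card_compl, Finset.card_compl, h]
      · rw [(hc s).1, (hc s').1, h])
  exact ⟨e, fun i => by simpa using congrFun he i⟩

theorem eqUpToScalingPerm_of_balanced {q k d : ℕ} (hq : 4 ≤ q) (hq_even : Even q) (hk : 2 ≤ k)
    (hd : 2 ≤ d) {R C R' C' : Fin (q + 1) → ℝ} (h : IsHalfFixpoint q k d R C) (hb : IsBalanced R C)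
    (h' : IsHalfFixpoint q k d R' C') (hb' : IsBalanced R' C') :
    EqUpToScalingPerm (interaction q k d) R C R' C' ∧ PermutationSymmetric (interaction q k d)
      (phaseOf d R) (phaseOf d C) (phaseOf d R') (phaseOf d C') := by
  obtain ⟨s, X, Y, z, hz, hp⟩ := exists_balancedProfile hq hq_even hk (by omega) h hb
  obtain ⟨s', X', Y', z', hz', hp'⟩ := exists_balancedProfile hq hq_even hk (by omega) h' hb'
  obtain rfl := hp.ratio_unique hq hk hd hp' hz hz'
  obtain ⟨e, he⟩ := exists_perm_mem_iff (hp.card_mem.trans hp'.card_mem.symm)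
  -- This permutation fixes the spin 0 and acts as e on the others; every such permutation preserves
  -- the interaction.
  set π : Equiv.Perm (Fin (q + 1)) := Equiv.Perm.decomposeFin.symm (0, e) with hπ
  have hπ0 : π 0 = 0 := by simp [hπ]
  have hπs : ∀ i : Fin q, π i.succ = (e i).succ := fun i => by simp [hπ]
  have ht0 : 0 < tParam q k d := tParam_pos (by omega) hk d
  have hX := hp.X_pos
  have hY := hp.Y_pos
  have hX' := hp'.X_pos
  have hY' := hp'.Y_pos
  have hsub : (interaction q k d).submatrix π π = interaction q k d := by
    ext i j
    rw [Matrix.submatrix_apply]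
    refine Fin.cases ?_ (fun i => ?_) i <;> refine Fin.cases ?_ (fun j => ?_) j
    · rw [hπ0]
    · rw [hπ0, hπs]; simp [interaction]
    · rw [hπ0, hπs]; simp [interaction]
    · rw [hπs, hπs]; simp [interaction, e.injective.eq_iff]
  have hRe : R = (X / X') • (R' ∘ π) := by
    funext i
    simp only [Pi.smul_apply, Function.comp_apply, smul_eq_mul]
    refine Fin.cases ?_ (fun i => ?_) i
    · rw [hπ0]
      have h1 := hp.R_zero
      have h2 := hp'.R_zero
      refine mul_left_cancel₀ ht0.ne' ?_
      rw [mul_left_comm, h1, h2]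
      field_simp
    · rw [hπs]
      by_cases hi : i ∈ s
      · rw [hp.R_mem i hi, hp'.R_mem _ ((he i).1 hi)]; field_simp
      · rw [hp.R_compl i hi, hp'.R_compl _ (fun h => hi ((he i).2 h))]; field_simp
  have hCe : C = (Y / Y') • (C' ∘ π) := by
    funext i
    simp only [Pi.smul_apply, Function.comp_apply, smul_eq_mul]
    refine Fin.cases ?_ (fun i => ?_) i
    · rw [hπ0]
      have h1 := hp.C_zero
      have h2 := hp'.C_zero
      refine mul_left_cancel₀ ht0.ne' ?_
      rw [mul_left_comm, h1, h2]
      field_simp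
    · rw [hπs]
      by_cases hi : i ∈ s
      · rw [hp.C_mem i hi, hp'.C_mem _ ((he i).1 hi)]; field_simp
      · rw [hp.C_compl i hi, hp'.C_compl _ (fun h => hi ((he i).2 h))]; field_simp
  refine ⟨⟨π, hsub, X / X', Y / Y', by positivity, by positivity, hRe, hCe⟩, π, hsub, Or.inl ⟨?_, ?_⟩⟩
  · conv_lhs => rw [hRe]
    exact phaseOf_smul_comp h'.1.1 (by positivity) π
  · conv_lhs => rw [hCe]
    exact phaseOf_smul_comp h'.1.2.1 (by positivity) π

end Balanced

end SpinPhase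

namespace SpinPhase

/-! ### Fixpoints as Gibbs distributions; the value of the growth rate -/

section Fixpoint

variable {I : Type*} [Fintype I]

theorem IsFixpoint.transpose {d : ℕ} {B : Matrix I I ℝ} {R C : I → ℝ} (h : IsFixpoint d B R C) :
    IsFixpoint d B.transpose C R :=
  ⟨h.2.1, h.1, h.2.2.2, h.2.2.1⟩

theorem IsFixpoint.sum_pos {d : ℕ} (hd : 1 ≤ d) {B : Matrix I I ℝ} (hB : ∀ i j, 0 ≤ B i j)
    {R C : I → ℝ} (h : IsFixpoint d B R C) (i : I) : 0 < ∑ j, B i j * C j := by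
  obtain ⟨hR, hC, ⟨A, hA⟩, -⟩ := h
  refine (Finset.sum_nonneg fun j _ => mul_nonneg (hB i j) (hC j).le).lt_of_ne' fun h0 => ?_
  have := hA i
  rw [h0, zero_pow (by omega), mul_zero] at this
  exact (hR i).ne' this

/-- Since p = 1 + 1/d, one d-th root of the fixpoint equation gives R_i^p. Thus the phase is
proportional to the row sums of R_i B_ij C_j, the marginal of the Gibbs distribution. -/
theorem IsFixpoint.exists_rpow_eq {d : ℕ} (hd : 1 ≤ d) {B : Matrix I I ℝ} (hB : ∀ i j, 0 ≤ B i j)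
    {R C : I → ℝ} (h : IsFixpoint d B R C) :
    ∃ K : ℝ, 0 ≤ K ∧ ∀ i, R i ^ (((d : ℝ) + 1) / d) = K * (R i * ∑ j, B i j * C j) := by
  have hpos := h.sum_pos hd hB
  obtain ⟨hR, hC, ⟨A, hA⟩, -⟩ := h
  have hd0 : (d : ℝ) ≠ 0 := by positivity
  rcases isEmpty_or_nonempty I with hI | ⟨⟨i₀⟩⟩
  · exact ⟨0, le_rfl, fun i => isEmptyElim i⟩
  have hA0 : 0 < A := by
    have := hA i₀ ▸ hR i₀
    exact (pos_iff_pos_of_mul_pos this).2 (pow_pos (hpos i₀) d)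
  refine ⟨A ^ (1 / (d : ℝ)), (Real.rpow_pos_of_pos hA0 _).le, fun i => ?_⟩
  have e : ((d : ℝ) + 1) / d = 1 + 1 / d := by field_simp
  rw [e, Real.rpow_add (hR i), Real.rpow_one]
  nth_rewrite 2 [hA i]
  rw [Real.mul_rpow hA0.le (pow_nonneg (hpos i).le d), one_div,
    Real.pow_rpow_inv_natCast (hpos i).le (by omega)]
  ring

theorem IsFixpoint.phaseOf_eq {d : ℕ} (hd : 1 ≤ d) {B : Matrix I I ℝ} (hB : ∀ i j, 0 ≤ B i j)
    {R C : I → ℝ} (h : IsFixpoint d B R C) (i : I) :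
    phaseOf d R i = (∑ j, B i j * R i * C j) / ∑ i, ∑ j, B i j * R i * C j := by
  obtain ⟨K, -, hK⟩ := h.exists_rpow_eq hd hB
  have e : ∀ i, ∑ j, B i j * R i * C j = R i * ∑ j, B i j * C j := fun i => by
    rw [Finset.mul_sum]; exact Finset.sum_congr rfl fun j _ => by ring
  have hK0 : K ≠ 0 := by
    rintro rfl
    have := hK i
    rw [zero_mul] at this
    exact (Real.rpow_pos_of_pos (h.1 i) _).ne' this
  rw [phaseOf, Finset.sum_congr rfl fun i _ => hK i, hK, ← Finset.mul_sum, mul_div_mul_left _ _ hK0,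
    Finset.sum_congr rfl fun i _ => e i, e]

theorem gibbs_log {B : Matrix I I ℝ} {R C : I → ℝ} (hR : ∀ i, 0 < R i) (hC : ∀ i, 0 < C i) (i j : I) :
    gibbs B (fun i => Real.log (R i)) (fun i => Real.log (C i)) i j =
      B i j * R i * C j / ∑ i, ∑ j, B i j * R i * C j := by
  have e : ∀ i j, Real.exp (Real.log (R i)) * B i j * Real.exp (Real.log (C j)) =
      B i j * R i * C j := fun i j => by
    rw [Real.exp_log (hR i), Real.exp_log (hC j), mul_comm (R i)]
  simp only [gibbs, e]

theorem IsFixpoint.sum_gibbs_row {d : ℕ} (hd : 1 ≤ d) {B : Matrix I I ℝ} (hB : ∀ i j, 0 ≤ B i j)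
    {R C : I → ℝ} (h : IsFixpoint d B R C) (i : I) :
    ∑ j, gibbs B (fun i => Real.log (R i)) (fun i => Real.log (C i)) i j = phaseOf d R i := by
  simp only [gibbs_log h.1 h.2.1]
  rw [← Finset.sum_div, h.phaseOf_eq hd hB]

theorem IsFixpoint.phaseOf_eq' {d : ℕ} (hd : 1 ≤ d) {B : Matrix I I ℝ} (hB : ∀ i j, 0 ≤ B i j)
    {R C : I → ℝ} (h : IsFixpoint d B R C) (j : I) :
    phaseOf d C j = (∑ i, B i j * R i * C j) / ∑ i, ∑ j, B i j * R i * C j := by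
  have h1 := h.transpose.phaseOf_eq hd (fun i j => hB j i) j
  rw [Finset.sum_comm] at h1
  exact h1.trans (congrArg₂ (· / ·) (Finset.sum_congr rfl fun i _ => mul_right_comm _ _ _)
    (Finset.sum_congr rfl fun i _ => Finset.sum_congr rfl fun j _ => mul_right_comm _ _ _))

theorem IsFixpoint.sum_gibbs_col {d : ℕ} (hd : 1 ≤ d) {B : Matrix I I ℝ} (hB : ∀ i j, 0 ≤ B i j)
    {R C : I → ℝ} (h : IsFixpoint d B R C) (j : I) :
    ∑ i, gibbs B (fun i => Real.log (R i)) (fun i => Real.log (C i)) i j = phaseOf d C j := by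
  simp only [gibbs_log h.1 h.2.1]
  rw [← Finset.sum_div, h.phaseOf_eq' hd hB]

theorem sum_rpow_pos [Nonempty I] {R : I → ℝ} (hR : ∀ i, 0 < R i) (p : ℝ) : 0 < ∑ i, R i ^ p :=
  Finset.sum_pos (fun i _ => Real.rpow_pos_of_pos (hR i) p) Finset.univ_nonempty

theorem phaseOf_pos {d : ℕ} {R : I → ℝ} (hR : ∀ i, 0 < R i) (i : I) : 0 < phaseOf d R i :=
  haveI : Nonempty I := ⟨i⟩
  div_pos (Real.rpow_pos_of_pos (hR i) _) (sum_rpow_pos hR _)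

theorem sum_phaseOf [Nonempty I] (d : ℕ) {R : I → ℝ} (hR : ∀ i, 0 < R i) :
    ∑ i, phaseOf d R i = 1 := by
  simp only [phaseOf]
  rw [← Finset.sum_div, div_self (sum_rpow_pos hR _).ne']

theorem phaseOf_mem_stdSimplex [Nonempty I] (d : ℕ) {R : I → ℝ} (hR : ∀ i, 0 < R i) :
    phaseOf d R ∈ stdSimplex ℝ I :=
  ⟨fun i => (phaseOf_pos hR i).le, sum_phaseOf d hR⟩

/-- This affine relation between log R and log α is the first-order condition that
`exists_touching_function` needs. -/
theorem log_phaseOf [Nonempty I] {d : ℕ} (hd : 1 ≤ d) {R : I → ℝ} (hR : ∀ i, 0 < R i) (i : I) :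
    ((d : ℝ) + 1) * Real.log (R i) =
      d * Real.log (phaseOf d R i) + d * Real.log (∑ j, R j ^ (((d : ℝ) + 1) / d)) := by
  have hd0 : (d : ℝ) ≠ 0 := by positivity
  rw [phaseOf, Real.log_div (Real.rpow_pos_of_pos (hR i) _).ne' (sum_rpow_pos hR _).ne',
    Real.log_rpow (hR i)]
  field_simp
  ring

theorem Phi_eq {d : ℕ} {B : Matrix I I ℝ} {R C : I → ℝ} (hS : 0 < ∑ i, ∑ j, R i * B i j * C j)
    (hR : 0 < ∑ i, R i ^ (((d : ℝ) + 1) / d)) (hC : 0 < ∑ i, C i ^ (((d : ℝ) + 1) / d)) :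
    Phi d B R C = ((d : ℝ) + 1) * Real.log (∑ i, ∑ j, R i * B i j * C j) -
      d * Real.log (∑ i, R i ^ (((d : ℝ) + 1) / d)) -
      d * Real.log (∑ i, C i ^ (((d : ℝ) + 1) / d)) := by
  have h1 := Real.rpow_pos_of_pos hR ((d : ℝ) / (d + 1))
  have h2 := Real.rpow_pos_of_pos hC ((d : ℝ) / (d + 1))
  rw [Phi, Real.log_div hS.ne' (by positivity), Real.log_mul h1.ne' h2.ne', Real.log_rpow hR,
    Real.log_rpow hC]
  field_simp
  ring

theorem IsFixpoint.Psi1_phaseOf [DecidableEq I] {d : ℕ} (hd : 1 ≤ d) {B : Matrix I I ℝ}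
    (hB : ∀ i j, 0 ≤ B i j) {i₀ j₀ : I} (h₀ : 0 < B i₀ j₀) {R C : I → ℝ} (h : IsFixpoint d B R C) :
    Psi1 (d + 1) B (phaseOf d R) (phaseOf d C) = (Phi d B R C : ℝ) := by
  have : Nonempty I := ⟨i₀⟩
  rw [Psi1_eq_dualRate d hB h₀ (h.sum_gibbs_row hd hB) (h.sum_gibbs_col hd hB)]
  congr 1
  have hZ : ∑ i, ∑ j, Real.exp (Real.log (R i)) * B i j * Real.exp (Real.log (C j)) =
      ∑ i, ∑ j, R i * B i j * C j :=
    Finset.sum_congr rfl fun i _ => Finset.sum_congr rfl fun j _ => by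
      rw [Real.exp_log (h.1 i), Real.exp_log (h.2.1 j)]
  have hS : 0 < ∑ i, ∑ j, R i * B i j * C j := by
    rw [← hZ]; exact partition_pos hB h₀ _ _
  have key : ∀ {R : I → ℝ}, (∀ i, 0 < R i) → d * entropy (phaseOf d R) =
      d * Real.log (∑ j, R j ^ (((d : ℝ) + 1) / d)) -
        ((d : ℝ) + 1) * ∑ i, phaseOf d R i * Real.log (R i) := fun {R} hR => by
    rw [entropy, Finset.mul_sum, Finset.mul_sum]
    generalize hN : d * Real.log (∑ j, R j ^ (((d : ℝ) + 1) / d)) = N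
    rw [show N = ∑ i, phaseOf d R i * N by rw [← Finset.sum_mul, sum_phaseOf d hR, one_mul],
      ← Finset.sum_sub_distrib]
    refine Finset.sum_congr rfl fun i _ => ?_
    rw [Real.negMulLog]
    linear_combination phaseOf d R i * log_phaseOf hd hR i + phaseOf d R i * hN
  rw [dualRate, logZ, hZ, Phi_eq hS (sum_rpow_pos h.1 _) (sum_rpow_pos h.2.1 _)]
  linear_combination -key h.1 - key h.2.1

end Fixpoint

/-! ### The spectral bound at balanced fixpoints -/

section Spectral

theorem HalfProfile.sum_succ {q k d : ℕ} (hq_even : Even q) {R C : Fin (q + 1) → ℝ}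
    {s : Finset (Fin q)} {X Y A A' r₁ r₂ c₁ c₂ : ℝ}
    (h : HalfProfile q k d R C s X Y A A' r₁ r₂ c₁ c₂) :
    tParam q k d * R 0 + ∑ i : Fin q, R i.succ = X ∧
      tParam q k d * C 0 + ∑ i : Fin q, C i.succ = Y := by
  constructor
  · rw [sum_two_class hq_even h.card_mem h.card_compl (f := fun j : Fin q => R j.succ) h.R_mem
      h.R_compl, h.R_zero]
    linear_combination X * h.sum_r
  · rw [sum_two_class hq_even h.card_mem h.card_compl (f := fun j : Fin q => C j.succ) h.C_mem
      h.C_compl, h.C_zero]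
    linear_combination Y * h.sum_c

/-- With x and y the two values of the profile, (1-x)(1-y)/(xy) equals (1-z^d)²/(z^(d-1)(1-z)²),
which exceeds d² by `sq_mul_pow_mul_sq_lt`. -/
theorem exists_spectral_gap {d : ℕ} (hd : 2 ≤ d) {z : ℝ} (h0 : 0 < z) (h1 : z < 1) :
    ∃ D : ℝ, (d : ℝ) < D ∧ D ^ 2 * (largeValue d z * (z ^ d * largeValue d z)) =
      (1 - largeValue d z) * (1 - z ^ d * largeValue d z) := by
  have e1 := one_sub_pow_pos h0 h1 (n := d + 1) (by omega)
  have e2 := one_sub_pow_pos h0 h1 (n := d) (by omega)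
  have e3 : 0 < 1 - z := by linarith
  have hz := pow_pos h0 (d - 1)
  have hzd : z ^ d = z * z ^ (d - 1) := by rw [← pow_succ']; congr 1; omega
  refine ⟨√((1 - z ^ d) ^ 2 / (z ^ (d - 1) * (1 - z) ^ 2)), ?_, ?_⟩
  · refine Real.lt_sqrt_of_sq_lt ?_
    rw [lt_div_iff₀ (by positivity), ← mul_assoc]
    exact sq_mul_pow_mul_sq_lt hd h0 h1
  · rw [Real.sq_sqrt (by positivity), one_sub_largeValue_eq d h0 h1, one_sub_smallValue_eq d h0 h1,
      largeValue_eq d h0 h1]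
    have : z ^ d * ((1 - z) / (1 - z ^ (d + 1))) =
      z * z ^ (d - 1) * ((1 - z) / (1 - z ^ (d + 1))) := by rw [hzd]
    rw [this]
    field_simp

/-- After division by X Y the edge weights take the mirrored two-class form of `covariance_le`,
where w is the weight of spin 0 on either side. That bound has the constant 1/D, and D > d gives
strictness because the norm is positive. -/
theorem spectral_bound_of_balanced {q k d : ℕ} (hq : 4 ≤ q) (hq_even : Even q) (hk : 2 ≤ k)
    (hd : 2 ≤ d) {R C : Fin (q + 1) → ℝ} (hf : IsHalfFixpoint q k d R C) (hb : IsBalanced R C)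
    (ξ η : Fin (q + 1) → ℝ)
    (hξ : ∑ i, (∑ j, interaction q k d i j * R i * C j) * ξ i = 0)
    (hη : ∑ j, (∑ i, interaction q k d i j * R i * C j) * η j = 0) (hne : (ξ, η) ≠ 0) :
    2 * ∑ i, ∑ j, interaction q k d i j * R i * C j * (ξ i * η j) <
      1 / (d : ℝ) * (∑ i, (∑ j, interaction q k d i j * R i * C j) * ξ i ^ 2 +
        ∑ j, (∑ i, interaction q k d i j * R i * C j) * η j ^ 2) := by
  obtain ⟨s, X, Y, z, hz, h⟩ := exists_balancedProfile hq hq_even hk (by omega) hf hb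
  obtain ⟨D, hdD, hD⟩ := exists_spectral_gap hd hz.1 hz.2
  obtain ⟨hRX, hCY⟩ := HalfProfile.sum_succ hq_even h
  have hX := h.X_pos
  have hY := h.Y_pos
  have hd0 : (0 : ℝ) < d := by positivity
  have hB := interaction_nonneg (q := q) (k := k) (by omega) hk d
  have hBp := interaction_zero_pos (q := q) (k := k) (by omega) hk d
  have hrow : ∀ i, 0 < ∑ j, interaction q k d i j * R i * C j := fun i => by
    refine Finset.sum_pos' (fun j _ => mul_nonneg (mul_nonneg (hB i j) (hf.1.1 i).le)
      (hf.1.2.1 j).le) ⟨0, Finset.mem_univ _, ?_⟩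
    rw [interaction_symm]
    exact mul_pos (mul_pos (hBp i) (hf.1.1 i)) (hf.1.2.1 0)
  have hcol : ∀ j, 0 < ∑ i, interaction q k d i j * R i * C j := fun j => by
    refine Finset.sum_pos' (fun i _ => mul_nonneg (mul_nonneg (hB i j) (hf.1.1 i).le)
      (hf.1.2.1 j).le) ⟨0, Finset.mem_univ _, ?_⟩
    exact mul_pos (mul_pos (hBp j) (hf.1.1 0)) (hf.1.2.1 j)
  set N := ∑ i, (∑ j, interaction q k d i j * R i * C j) * ξ i ^ 2 +
        ∑ j, (∑ i, interaction q k d i j * R i * C j) * η j ^ 2 with hN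
  have hNpos : 0 < N := by
    have h1 : ∀ i ∈ Finset.univ, 0 ≤ (∑ j, interaction q k d i j * R i * C j) * ξ i ^ 2 :=
      fun i _ => mul_nonneg (hrow i).le (sq_nonneg _)
    have h2 : ∀ j ∈ Finset.univ, 0 ≤ (∑ i, interaction q k d i j * R i * C j) * η j ^ 2 :=
      fun i _ => mul_nonneg (hcol i).le (sq_nonneg _)
    refine (add_nonneg (Finset.sum_nonneg h1) (Finset.sum_nonneg h2)).lt_of_ne' fun h0 => hne ?_
    rw [add_eq_zero_iff_of_nonneg (Finset.sum_nonneg h1) (Finset.sum_nonneg h2),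
      Finset.sum_eq_zero_iff_of_nonneg h1, Finset.sum_eq_zero_iff_of_nonneg h2] at h0
    refine Prod.ext (funext fun i => ?_) (funext fun i => ?_)
    · have := h0.1 i (Finset.mem_univ _)
      simpa [(hrow i).ne'] using this
    · have := h0.2 i (Finset.mem_univ _)
      simpa [(hcol i).ne'] using this
  set w := profileFactor d z * ((q : ℝ) ^ k - q) with hw
  have hw0 : 0 < w := mul_pos h.A_pos (tParam_base_pos (by omega) hk)
  set r : Fin q → ℝ := fun i => R i.succ / X with hr
  set c : Fin q → ℝ := fun i => C i.succ / Y with hc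
  have hRr : ∀ i : Fin q, R i.succ = X * r i := fun i => by rw [hr]; field_simp
  have hCc : ∀ i : Fin q, C i.succ = Y * c i := fun i => by rw [hc]; field_simp
  have hpull : ∀ i, ∑ j, interaction q k d i j * R i * C j =
      R i * ∑ j, interaction q k d i j * C j := fun i => by
    rw [Finset.mul_sum]; exact Finset.sum_congr rfl fun j _ => by ring
  have hpull' : ∀ j, ∑ i, interaction q k d i j * R i * C j =
      C j * ∑ i, interaction q k d j i * R i := fun j => by
    rw [Finset.mul_sum]
    exact Finset.sum_congr rfl fun i _ => by rw [interaction_symm q k d i j]; ring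
  have ha : ∀ u : Fin (q + 1) → ℝ, ∑ i, (∑ j, interaction q k d i j * R i * C j) * u i =
      X * Y * (w * u 0 + ∑ i : Fin q, r i * (1 - c i) * u i.succ) := fun u => by
    rw [Fin.sum_univ_succ]
    simp only [hpull, sum_interaction_zero, sum_interaction_succ, hCY]
    rw [mul_add, Finset.mul_sum]
    congr 1
    · linear_combination Y * u 0 * h.R_zero
    · exact Finset.sum_congr rfl fun i _ => by rw [hRr, hCc]; ring
  have hb' : ∀ u : Fin (q + 1) → ℝ, ∑ j, (∑ i, interaction q k d i j * R i * C j) * u j =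
      X * Y * (w * u 0 + ∑ i : Fin q, c i * (1 - r i) * u i.succ) := fun u => by
    rw [Fin.sum_univ_succ]
    simp only [hpull', sum_interaction_zero, sum_interaction_succ, hRX]
    rw [mul_add, Finset.mul_sum]
    congr 1
    · linear_combination X * u 0 * h.C_zero
    · exact Finset.sum_congr rfl fun i _ => by rw [hRr, hCc]; ring
  have hcov : ∑ i, ∑ j, interaction q k d i j * R i * C j * (ξ i * η j) =
      X * Y * ((w * ξ 0 + ∑ i : Fin q, r i * ξ i.succ) * (w * η 0 + ∑ i : Fin q, c i * η i.succ) -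
        ∑ i : Fin q, r i * c i * (ξ i.succ * η i.succ)) := by
    have e := sum_sum_interaction q k d (fun i => R i * ξ i) (fun i => C i * η i)
    have e1 : ∑ i, ∑ j, interaction q k d i j * R i * C j * (ξ i * η j) =
        ∑ i, ∑ j, interaction q k d i j * (R i * ξ i) * (C j * η j) :=
      Finset.sum_congr rfl fun i _ => Finset.sum_congr rfl fun j _ => by ring
    have e2 : ∑ i : Fin q, R i.succ * ξ i.succ = X * ∑ i : Fin q, r i * ξ i.succ := by
      rw [Finset.mul_sum]; exact Finset.sum_congr rfl fun i _ => by rw [hRr]; ring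
    have e3 : ∑ i : Fin q, C i.succ * η i.succ = Y * ∑ i : Fin q, c i * η i.succ := by
      rw [Finset.mul_sum]; exact Finset.sum_congr rfl fun i _ => by rw [hCc]; ring
    have e4 : ∑ i : Fin q, R i.succ * ξ i.succ * (C i.succ * η i.succ) =
        X * Y * ∑ i : Fin q, r i * c i * (ξ i.succ * η i.succ) := by
      rw [Finset.mul_sum]; exact Finset.sum_congr rfl fun i _ => by rw [hRr, hCc]; ring
    rw [e1, e, e2, e3, e4, ← mul_assoc (tParam q k d), ← mul_assoc (tParam q k d), h.R_zero,
      h.C_zero]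
    ring
  have hXY : 0 < X * Y := mul_pos hX hY
  rw [ha ξ] at hξ
  rw [hb' η] at hη
  have hc₁ := h.c₁_lt
  have key := covariance_le (J := Fin q) (s := s) (h := (q : ℝ) / 2)
    (x := largeValue d z) (y := z ^ d * largeValue d z) (w := w) (D := D)
    (by rw [h.card_mem, half_cast hq_even]) (by rw [h.card_compl, half_cast hq_even])
    (by positivity) (h.r₂_pos.trans h.r₂_lt) h.r₁_lt h.r₂_pos (h.r₂_lt.trans h.r₁_lt) hw0
    (by linarith [h.sum_r]) (by
      have : (2 : ℝ) ≤ d := by exact_mod_cast hd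
      linarith) hD
    (r := r) (c := c) (fun i hi => by rw [hr]; simp only [h.R_mem i hi]; field_simp)
    (fun i hi => by rw [hc]; simp only [h.C_mem i hi]; field_simp)
    (fun i hi => by rw [hr]; simp only [h.R_compl i (Finset.mem_compl.1 hi)]; field_simp)
    (fun i hi => by rw [hc]; simp only [h.C_compl i (Finset.mem_compl.1 hi)]; field_simp)
    (ξ₀ := ξ 0) (η₀ := η 0) (ξ := fun i => ξ i.succ) (η := fun i => η i.succ)
    ((mul_eq_zero.1 hξ).resolve_left hXY.ne') ((mul_eq_zero.1 hη).resolve_left hXY.ne')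
  have key2 := mul_le_mul_of_nonneg_left key hXY.le
  have hNe : N = X * Y * ((w * ξ 0 ^ 2 + ∑ i : Fin q, r i * (1 - c i) * ξ i.succ ^ 2) +
      (w * η 0 ^ 2 + ∑ i : Fin q, c i * (1 - r i) * η i.succ ^ 2)) := by
    rw [hN, ha fun i => ξ i ^ 2, hb' fun i => η i ^ 2]
    ring
  have h3 : 1 / D * N < 1 / (d : ℝ) * N :=
    mul_lt_mul_of_pos_right (one_div_lt_one_div_of_lt hd0 hdD) hNpos
  refine lt_of_le_of_lt ?_ h3
  rw [hcov, hNe]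
  calc _ = _ := by ring
    _ ≤ _ := key2
    _ = _ := by ring

theorem balanced_isLocalMaxPhase {q k d : ℕ} (hq : 4 ≤ q) (hq_even : Even q) (hk : 2 ≤ k)
    (hd : 2 ≤ d) {R C : Fin (q + 1) → ℝ} (hf : IsHalfFixpoint q k d R C) (hb : IsBalanced R C) :
    IsLocalMaxPhase (d + 1) (interaction q k d) (phaseOf d R) (phaseOf d C) ∧
      HessianNegDef (d + 1) (interaction q k d) (phaseOf d R) (phaseOf d C) ∧
      secondEigenvalue (interaction q k d) R C < 1 / (d : ℝ) := by
  have hd1 : 1 ≤ d := by omega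
  have hB := interaction_nonneg (q := q) (k := k) (by omega) hk d
  have hBp := interaction_zero_pos (q := q) (k := k) (by omega) hk d
  have hrow := hf.1.sum_pos hd1 hB
  have hcol := hf.1.transpose.sum_pos hd1 (fun i j => hB j i)
  have hspec := spectral_bound_of_balanced hq hq_even hk hd hf hb
  have hd0 : (0 : ℝ) < d := by positivity
  set S := ∑ i, ∑ j, interaction q k d i j * R i * C j with hS
  have hrow' : ∀ i, 0 < ∑ j, interaction q k d i j * R i * C j := fun i => by
    have := mul_pos (hf.1.1 i) (hrow i)
    rw [Finset.mul_sum] at this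
    calc _ < _ := this
      _ = _ := Finset.sum_congr rfl fun j _ => by ring
  have hcol' : ∀ j, 0 < ∑ i, interaction q k d i j * R i * C j := fun j => by
    have := mul_pos (hf.1.2.1 j) (hcol j)
    rw [Finset.mul_sum] at this
    calc _ < _ := this
      _ = _ := Finset.sum_congr rfl fun j _ => mul_comm _ _
  have hS0 : 0 < S := Finset.sum_pos (fun i _ => hrow' i) Finset.univ_nonempty
  have hl := isLocalMaxPhase_and_hessianNegDef (d := d) hd1 hB (i₀ := 0) hBp
    (fun i => by rw [interaction_symm]; exact hBp i) (hf.1.sum_gibbs_row hd1 hB)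
    (hf.1.sum_gibbs_col hd1 hB) (phaseOf_pos hf.1.1) (phaseOf_pos hf.1.2.1)
    (log_phaseOf hd1 hf.1.1) (log_phaseOf hd1 hf.1.2.1) (fun ξ η h1 h2 hne => by
      have e1 : ∀ u : Fin (q + 1) → ℝ, ∑ i, phaseOf d R i * u i =
          (∑ i, (∑ j, interaction q k d i j * R i * C j) * u i) / S := fun u => by
        rw [Finset.sum_div]
        exact Finset.sum_congr rfl fun i _ => by rw [hf.1.phaseOf_eq hd1 hB]; ring
      have e2 : ∀ u : Fin (q + 1) → ℝ, ∑ i, phaseOf d C i * u i =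
          (∑ j, (∑ i, interaction q k d i j * R i * C j) * u j) / S := fun u => by
        rw [Finset.sum_div]
        exact Finset.sum_congr rfl fun i _ => by rw [hf.1.phaseOf_eq' hd1 hB]; ring
      rw [e1, div_eq_zero_iff, or_iff_left hS0.ne'] at h1
      rw [e2, div_eq_zero_iff, or_iff_left hS0.ne'] at h2
      have h3 := hspec ξ η h1 h2 hne
      rw [e1 fun i => ξ i ^ 2, e2 fun i => η i ^ 2]
      have e3 : ∑ i, ∑ j, gibbs (interaction q k d) (fun i => Real.log (R i))
          (fun i => Real.log (C i)) i j * (ξ i * η j) =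
          (∑ i, ∑ j, interaction q k d i j * R i * C j * (ξ i * η j)) / S := by
        simp only [Finset.sum_div]
        exact Finset.sum_congr rfl fun i _ => Finset.sum_congr rfl fun j _ => by
          rw [gibbs_log hf.1.1 hf.1.2.1]; ring
      rw [e3]
      have h4 := div_lt_div_of_pos_right h3 hS0
      calc _ = _ := by ring
        _ < _ := h4
        _ = _ := by ring)
  exact ⟨hl.1, hl.2, secondEigenvalue_lt_of_spectral_bound (by positivity) hrow' hcol' hspec⟩

end Spectral

end SpinPhase

namespace SpinPhase

/-! ### Stationarity in the multiplicities forces balance -/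

section Maximal

theorem hasDerivAt_log_quadratic {a : ℝ} (ha : 0 < a) (b c : ℝ) :
    HasDerivAt (fun δ : ℝ => Real.log (a + b * δ + c * δ ^ 2)) (b / a) 0 := by
  have h : HasDerivAt (fun δ : ℝ => a + b * δ + c * δ ^ 2) b 0 := by
    have h1 := ((hasDerivAt_id (0 : ℝ)).const_mul b).const_add a
    have h2 := ((hasDerivAt_pow 2 (0 : ℝ)).const_mul c)
    have h3 := h1.add h2
    simp only [mul_one, id_eq, Nat.add_one_sub_one, pow_one, mul_zero, add_zero] at h3
    exact h3
  simpa using h.log (by simpa using ha.ne')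

theorem IsFixpoint.sum_rpow_eq {I : Type*} [Fintype I] {d : ℕ} {B : Matrix I I ℝ} {R C : I → ℝ}
    {K : ℝ} (hK : ∀ i, R i ^ (((d : ℝ) + 1) / d) = K * (R i * ∑ j, B i j * C j)) :
    ∑ i, R i ^ (((d : ℝ) + 1) / d) = K * ∑ i, ∑ j, R i * B i j * C j := by
  rw [Finset.sum_congr rfl fun i _ => hK i, ← Finset.mul_sum]
  congr 1
  exact Finset.sum_congr rfl fun i _ => by
    rw [Finset.mul_sum]; exact Finset.sum_congr rfl fun j _ => (mul_assoc _ _ _).symm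

/-- Keep both vectors and change the multiplicities to q/2 + δ and q/2 - δ. Maximality makes `PhiS`
stationary at δ = 0; once the p-th powers are replaced by the fixpoint equations, this is the
symmetric relation `hbal`, which forces equal ratios. -/
theorem isBalanced_of_isMaximal {q k d : ℕ} (hq : 4 ≤ q) (hq_even : Even q) (hk : 2 ≤ k)
    (hd : 2 ≤ d) {R C : Fin (q + 1) → ℝ} (hf : IsHalfFixpoint q k d R C)
    (hmax : IsMaximal q k d R C) : IsBalanced R C := by
  have hd1 : 1 ≤ d := by omega
  have hd0 : (0 : ℝ) < d := by positivity
  obtain ⟨s, X, Y, A, A', r₁, r₂, c₁, c₂, h⟩ := exists_halfProfile hq hq_even hk hd1 hf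
  obtain ⟨y, hy, z, hz, hr₁, hr₂, hc₂, hc₁⟩ := h.exists_ratios
  suffices hbal : r₁ + c₁ + ((d : ℝ) - 1) * (r₁ * c₁) = r₂ + c₂ + (d - 1) * (r₂ * c₂) by
    obtain rfl := profile_ratio_eq hd hy hz hr₁ hr₂ hc₂ hc₁ hbal
    exact (h.balancedProfile hy.1 hr₁ hr₂ hc₂ hc₁ hy.2).isBalanced
  obtain ⟨hRX, hCY⟩ := HalfProfile.sum_succ hq_even h
  have hX := h.X_pos
  have hY := h.Y_pos
  have hr₂0 := h.r₂_pos
  have hr₁0 := hr₂0.trans h.r₂_lt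
  have hc₁0 := h.c₁_pos
  have hc₂0 := hc₁0.trans h.c₁_lt
  have hB := interaction_nonneg (q := q) (k := k) (by omega) hk d
  have hBp := interaction_zero_pos (q := q) (k := k) (by omega) hk d
  set t := tParam q k d with ht
  set p := ((d : ℝ) + 1) / d with hp
  obtain ⟨K, hK0, hK⟩ := hf.1.exists_rpow_eq hd1 hB
  obtain ⟨K', hK0', hK'⟩ := hf.1.transpose.exists_rpow_eq hd1 (fun i j => hB j i)
  set S := ∑ i, ∑ j, R i * interaction q k d i j * C j with hS
  have hS0 : 0 < S := by
    rw [hS, Finset.sum_comm' (t' := Finset.univ) (s' := fun _ => Finset.univ) (by simp)]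
    refine Finset.sum_pos (fun j _ => Finset.sum_pos' (fun i _ => mul_nonneg
      (mul_nonneg (hf.1.1 i).le (hB i j)) (hf.1.2.1 j).le) ⟨0, Finset.mem_univ _, ?_⟩)
      Finset.univ_nonempty
    exact mul_pos (mul_pos (hf.1.1 0) (hBp j)) (hf.1.2.1 j)
  have hNR := IsFixpoint.sum_rpow_eq hK
  have hNC : ∑ i, C i ^ p = K' * S := by
    rw [IsFixpoint.sum_rpow_eq hK', hS, Finset.sum_comm]
    congr 1
    exact Finset.sum_congr rfl fun i _ => Finset.sum_congr rfl fun j _ => by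
      ring
  have hNR0 := sum_rpow_pos hf.1.1 p
  have hNC0 := sum_rpow_pos hf.1.2.1 p
  have hKp : 0 < K := (pos_iff_pos_of_mul_pos (hNR ▸ hNR0)).2 hS0
  have hKp' : 0 < K' := (pos_iff_pos_of_mul_pos (hNC ▸ hNC0)).2 hS0
  obtain ⟨i, hi⟩ := Finset.card_pos.1 (h.card_mem ▸ (by omega : 0 < q / 2))
  obtain ⟨j, hj⟩ := Finset.card_pos.1 (h.card_compl ▸ (by omega : 0 < q / 2))
  rw [Finset.mem_compl] at hj
  have hp1 : (X * r₁) ^ p = K * (X * r₁ * (Y - Y * c₁)) := by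
    have := hK i.succ
    rwa [sum_interaction_succ, hCY, h.R_mem i hi, h.C_mem i hi] at this
  have hp2 : (X * r₂) ^ p = K * (X * r₂ * (Y - Y * c₂)) := by
    have := hK j.succ
    rwa [sum_interaction_succ, hCY, h.R_compl j hj, h.C_compl j hj] at this
  have hp3 : (Y * c₁) ^ p = K' * (Y * c₁ * (X - X * r₁)) := by
    have := hK' i.succ
    simp only [interaction_symm q k d _ i.succ] at this
    rwa [sum_interaction_succ, hRX, h.R_mem i hi, h.C_mem i hi] at this
  have hp4 : (Y * c₂) ^ p = K' * (Y * c₂ * (X - X * r₂)) := by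
    have := hK' j.succ
    simp only [interaction_symm q k d _ j.succ] at this
    rwa [sum_interaction_succ, hRX, h.R_compl j hj, h.C_compl j hj] at this
  have hsumR : R 0 ^ p + (q : ℝ) / 2 * ((X * r₁) ^ p + (X * r₂) ^ p) = K * S := by
    rw [← hNR, Fin.sum_univ_succ, sum_two_class hq_even h.card_mem h.card_compl
      (f := fun j : Fin q => R j.succ ^ p) (a := (X * r₁) ^ p) (b := (X * r₂) ^ p)
      (fun i hi => by rw [h.R_mem i hi]) (fun i hi => by rw [h.R_compl i hi])]
  have hsumC : C 0 ^ p + (q : ℝ) / 2 * ((Y * c₁) ^ p + (Y * c₂) ^ p) = K' * S := by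
    rw [← hNC, Fin.sum_univ_succ, sum_two_class hq_even h.card_mem h.card_compl
      (f := fun j : Fin q => C j.succ ^ p) (a := (Y * c₁) ^ p) (b := (Y * c₂) ^ p)
      (fun i hi => by rw [h.C_mem i hi]) (fun i hi => by rw [h.C_compl i hi])]
  have hSe : S = X * Y - (q : ℝ) / 2 * (X * r₁ * (Y * c₁) + X * r₂ * (Y * c₂)) := by
    have e := sum_sum_interaction q k d R C
    rw [hRX, hCY, sum_two_class hq_even h.card_mem h.card_compl
      (f := fun j : Fin q => R j.succ * C j.succ) (a := X * r₁ * (Y * c₁)) (b := X * r₂ * (Y * c₂))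
      (fun i hi => by rw [h.R_mem i hi, h.C_mem i hi])
      (fun i hi => by rw [h.R_compl i hi, h.C_compl i hi])] at e
    rw [← e, hS]
    exact Finset.sum_congr rfl fun i _ => Finset.sum_congr rfl fun j _ => by ring
  set S₁ := (X * r₁ - X * r₂) * Y + X * (Y * c₁ - Y * c₂) -
    (X * r₁ * (Y * c₁) - X * r₂ * (Y * c₂)) with hS₁
  set S₂ := (X * r₁ - X * r₂) * (Y * c₁ - Y * c₂) with hS₂
  -- The terms 0 * δ ^ 2 give all three logarithms the shape of `hasDerivAt_log_quadratic`.
  set F : ℝ → ℝ := fun δ => ((d : ℝ) + 1) * Real.log (S + S₁ * δ + S₂ * δ ^ 2) -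
    d * Real.log (K * S + ((X * r₁) ^ p - (X * r₂) ^ p) * δ + 0 * δ ^ 2) -
    d * Real.log (K' * S + ((Y * c₁) ^ p - (Y * c₂) ^ p) * δ + 0 * δ ^ 2) with hF
  -- The third class has multiplicity 0, so its values, set to 0, play no role.
  have hbil : ∀ δ, bilinS t ![(q : ℝ) / 2 + δ, (q : ℝ) / 2 - δ, 0] (R 0) (C 0)
      ![X * r₁, X * r₂, 0] ![Y * c₁, Y * c₂, 0] = S + S₁ * δ + S₂ * δ ^ 2 := fun δ => by
    simp only [bilinS, Fin.sum_univ_three, Matrix.cons_val_zero, Matrix.cons_val_one,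
      Matrix.cons_val, mul_zero, add_zero]
    have e1 : t * R 0 = X - (q : ℝ) / 2 * (X * r₁ + X * r₂) := by
      rw [sum_two_class hq_even h.card_mem h.card_compl
        (f := fun j : Fin q => R j.succ) h.R_mem h.R_compl] at hRX
      linarith
    have e2 : t * C 0 = Y - (q : ℝ) / 2 * (Y * c₁ + Y * c₂) := by
      rw [sum_two_class hq_even h.card_mem h.card_compl
        (f := fun j : Fin q => C j.succ) h.C_mem h.C_compl] at hCY
      linarith
    have e3 : R 0 * C 0 * t ^ 2 = (t * R 0) * (t * C 0) := by ring
    rw [e3, mul_assoc _ (C 0) t, mul_assoc _ (R 0) t, mul_comm (C 0), mul_comm (R 0), e1, e2, hSe,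
      hS₁, hS₂]
    ring
  have hPhi : ∀ δ, PhiS d t ![(q : ℝ) / 2 + δ, (q : ℝ) / 2 - δ, 0] (R 0) (C 0)
      ![X * r₁, X * r₂, 0] ![Y * c₁, Y * c₂, 0] = F δ := fun δ => by
    rw [PhiS, hbil, hF]
    simp only [Fin.sum_univ_three, Matrix.cons_val_zero, Matrix.cons_val_one,
      Matrix.cons_val, zero_mul, add_zero]
    rw [← hsumR, ← hsumC]
    congr 3
    · congr 1
      ring
    · ring
  have hF0 : Phi d (interaction q k d) R C = F 0 := by
    rw [Phi_eq hS0 hNR0 hNC0, hNR, hNC, hF]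
    simp
    rfl
  have hloc : IsLocalMax F 0 := by
    have hev : ∀ᶠ δ : ℝ in 𝓝 0, 0 < S + S₁ * δ + S₂ * δ ^ 2 := by
      have : ContinuousAt (fun δ : ℝ => S + S₁ * δ + S₂ * δ ^ 2) 0 := by fun_prop
      exact this.eventually (lt_mem_nhds (by simpa using hS0))
    have hq0 : (0 : ℝ) < (q : ℝ) / 2 := by positivity
    filter_upwards [hev, Ioo_mem_nhds (neg_lt_zero.2 hq0) hq0] with δ hδ hδ'
    rw [← hPhi, ← hF0]
    refine hmax _ _ _ _ _ ?_ ?_ (hf.1.1 0).le (hf.1.2.1 0).le ?_ ?_ (by rw [hbil]; exact hδ)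
    · intro i
      fin_cases i
      · simp; linarith [hδ'.1]
      · simp; linarith [hδ'.2]
      · simp
    · simp [Fin.sum_univ_three]
    · intro i
      fin_cases i <;> simp <;> positivity
    · intro i
      fin_cases i <;> simp <;> positivity
  have hder : HasDerivAt F (((d : ℝ) + 1) * (S₁ / S) - d * (((X * r₁) ^ p - (X * r₂) ^ p) / (K * S)) -
      d * (((Y * c₁) ^ p - (Y * c₂) ^ p) / (K' * S))) 0 :=
    (((hasDerivAt_log_quadratic hS0 S₁ S₂).const_mul _).sub
      ((hasDerivAt_log_quadratic (mul_pos hKp hS0) _ 0).const_mul _)).sub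
      ((hasDerivAt_log_quadratic (mul_pos hKp' hS0) _ 0).const_mul _)
  have h0 := hloc.hasDerivAt_eq_zero hder
  rw [hp1, hp2, hp3, hp4, ← mul_sub, ← mul_sub, mul_div_mul_left _ _ hKp.ne',
    mul_div_mul_left _ _ hKp'.ne'] at h0
  field_simp at h0
  have hXY : X * Y ≠ 0 := by positivity
  refine mul_left_cancel₀ hXY ?_
  rw [hS₁] at h0
  linear_combination h0

end Maximal

end SpinPhase

namespace SpinPhase

/-! ### Bounding the growth rate by a bilinear maximum -/

section Duality

variable {I : Type*} [Fintype I]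

/-- Young's inequality with its equality case, from the strict Bernoulli inequality at y/x. The
equality case is what identifies maximizers below. -/
theorem mul_pow_lt_add_pow {d : ℕ} (hd : 1 ≤ d) {x y : ℝ} (hx : 0 ≤ x) (hy : 0 ≤ y) (hxy : x ≠ y) :
    ((d : ℝ) + 1) * (x ^ d * y) < d * x ^ (d + 1) + y ^ (d + 1) := by
  rcases hx.eq_or_lt with rfl | hx
  · have : 0 < y := hy.lt_of_ne hxy
    rw [zero_pow (by omega), zero_pow (by omega)]
    have := pow_pos this (d + 1)
    linarith
  · have hd0 : (0 : ℝ) < d := by exact_mod_cast hd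
    have h := one_add_mul_self_lt_rpow_one_add (s := y / x - 1) (p := ((d + 1 : ℕ) : ℝ))
      (by have : 0 ≤ y / x := by positivity
          linarith)
      (fun h => hxy (by rw [sub_eq_zero, div_eq_one_iff_eq hx.ne'] at h; exact h.symm))
      (by push_cast; linarith)
    rw [Real.rpow_natCast, add_sub_cancel, div_pow, lt_div_iff₀ (by positivity)] at h
    push_cast at h
    have e : (1 + ((d : ℝ) + 1) * (y / x - 1)) * x ^ (d + 1) =
        ((d : ℝ) + 1) * (x ^ d * y) - d * x ^ (d + 1) := by
      field_simp
      ring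
    linarith

theorem mul_pow_le_add_pow {d : ℕ} (hd : 1 ≤ d) {x y : ℝ} (hx : 0 ≤ x) (hy : 0 ≤ y) :
    ((d : ℝ) + 1) * (x ^ d * y) ≤ d * x ^ (d + 1) + y ^ (d + 1) := by
  rcases eq_or_ne x y with rfl | h
  · rw [← pow_succ]; linarith
  · exact (mul_pow_lt_add_pow hd hx hy h).le

/-- A maximizer of `∑ sᵢ^d vᵢ` on the unit sphere of `ℓ^(d+1)` is proportional to `v`. -/
theorem eq_mul_of_isMax {d : ℕ} (hd : 1 ≤ d) {s v : I → ℝ} (hs : ∀ i, 0 ≤ s i) (hv : ∀ i, 0 ≤ v i)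
    (hs1 : ∑ i, s i ^ (d + 1) = 1) (hpos : 0 < ∑ i, s i ^ d * v i)
    (hmax : ∀ s' : I → ℝ, (∀ i, 0 ≤ s' i) → ∑ i, s' i ^ (d + 1) = 1 →
      ∑ i, s' i ^ d * v i ≤ ∑ i, s i ^ d * v i) (i : I) :
    v i = (∑ i, s i ^ d * v i) * s i := by
  set S := ∑ i, s i ^ d * v i with hS
  have hN : 0 < ∑ i, v i ^ (d + 1) := by
    refine (Finset.sum_nonneg fun i _ => pow_nonneg (hv i) _).lt_of_ne' fun h0 => hpos.ne' ?_
    rw [Finset.sum_eq_zero_iff_of_nonneg fun i _ => pow_nonneg (hv i) _] at h0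
    refine Finset.sum_eq_zero fun i hi => ?_
    rw [pow_eq_zero_iff (by omega : d + 1 ≠ 0) |>.1 (h0 i hi), mul_zero]
  set N := ∑ i, v i ^ (d + 1) with hN'
  set l := N ^ (((d + 1 : ℕ) : ℝ)⁻¹) with hl
  have hl0 : 0 < l := Real.rpow_pos_of_pos hN _
  have hlN : l ^ (d + 1) = N := Real.rpow_inv_natCast_pow hN.le (by omega)
  set w : I → ℝ := fun i => v i / l with hw
  have hw0 : ∀ i, 0 ≤ w i := fun i => div_nonneg (hv i) hl0.le
  have hvw : ∀ i, v i = l * w i := fun i => by rw [hw]; field_simp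
  have hw1 : ∑ i, w i ^ (d + 1) = 1 := by
    simp only [hw, div_pow, hlN]
    rw [← Finset.sum_div, div_self hN.ne']
  have hSw : S = l * ∑ i, s i ^ d * w i := by
    rw [hS, Finset.mul_sum]; exact Finset.sum_congr rfl fun i _ => by rw [hvw]; ring
  have hlS : l ≤ S := by
    have := hmax w hw0 hw1
    have e : ∑ i, w i ^ d * v i = l * ∑ i, w i ^ (d + 1) := by
      rw [Finset.mul_sum]; exact Finset.sum_congr rfl fun i _ => by rw [hvw]; ring
    rwa [e, hw1, mul_one] at this
  -- The normalized vector w is itself a competitor, which gives this lower bound. Summing Young's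
  -- inequality gives the upper bound 1, so equality holds in every term and s = w.
  have h1 : 1 ≤ ∑ i, s i ^ d * w i := by
    rw [hSw] at hlS
    exact le_of_mul_le_mul_left (by rwa [mul_one]) hl0
  have htot : ∑ i, (d * s i ^ (d + 1) + w i ^ (d + 1)) = (d : ℝ) + 1 := by
    rw [Finset.sum_add_distrib, ← Finset.mul_sum, hs1, hw1, mul_one]
  have hle : ∑ i, ((d : ℝ) + 1) * (s i ^ d * w i) ≤ (d : ℝ) + 1 := by
    exact (Finset.sum_le_sum fun i _ => mul_pow_le_add_pow hd (hs i) (hw0 i)).trans htot.le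
  have hge : (d : ℝ) + 1 ≤ ∑ i, ((d : ℝ) + 1) * (s i ^ d * w i) := by
    rw [← Finset.mul_sum]; exact le_mul_of_one_le_right (by positivity) h1
  have hsw : s i = w i := by
    by_contra hne
    have : ∑ i, ((d : ℝ) + 1) * (s i ^ d * w i) < ∑ i, (d * s i ^ (d + 1) + w i ^ (d + 1)) :=
      Finset.sum_lt_sum (fun i _ => mul_pow_le_add_pow hd (hs i) (hw0 i))
        ⟨i, Finset.mem_univ _, mul_pow_lt_add_pow hd (hs i) (hw0 i) hne⟩
    linarith
  have h2 : ∑ i, s i ^ d * w i = 1 := by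
    rw [← Finset.mul_sum] at hle
    have : ∑ i, s i ^ d * w i ≤ 1 :=
      le_of_mul_le_mul_left (by rwa [mul_one]) (by positivity : (0 : ℝ) < d + 1)
    linarith
  rw [hSw, h2, mul_one, hsw, hvw]

/-- The nonnegative part of the unit sphere of `ℓ^(d+1)`. -/
def unitSphere (I : Type*) [Fintype I] (d : ℕ) : Set (I → ℝ) :=
  {s | (∀ i, 0 ≤ s i) ∧ ∑ i, s i ^ (d + 1) = 1}

theorem isCompact_unitSphere (d : ℕ) : IsCompact (unitSphere I d) := by
  refine (isCompact_Icc (a := (0 : I → ℝ)) (b := 1)).of_isClosed_subset ?_ ?_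
  · rw [unitSphere, Set.ofPred_and]
    refine IsClosed.inter ?_ (isClosed_eq (by fun_prop) continuous_const)
    rw [Set.ofPred_forall]
    exact isClosed_iInter fun i => isClosed_le continuous_const (continuous_apply i)
  · rintro s ⟨h0, h1⟩
    refine ⟨h0, fun i => ?_⟩
    have : s i ^ (d + 1) ≤ 1 := by
      rw [← h1]
      exact Finset.single_le_sum (f := fun i => s i ^ (d + 1))
        (fun i _ => pow_nonneg (h0 i) _) (Finset.mem_univ i)
    exact (pow_le_one_iff_of_nonneg (h0 i) (by omega)).1 this

/-- The substitution R = s^d turns the unit sphere of ℓ^p into that of ℓ^(d+1). A maximizer exists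
by compactness, and the equality case of Young's inequality yields the fixpoint equations even where
entries vanish, where differentiation would only give inequalities. -/
theorem exists_isMax_bilinear [DecidableEq I] {d : ℕ} (hd : 1 ≤ d) {B : Matrix I I ℝ}
    (hB : ∀ i j, 0 ≤ B i j) {i₀ : I} (h₀ : 0 < B i₀ i₀) :
    ∃ s ∈ unitSphere I d, ∃ u ∈ unitSphere I d, 0 < ∑ i, ∑ j, s i ^ d * B i j * u j ^ d ∧
      (∀ s' ∈ unitSphere I d, ∀ u' ∈ unitSphere I d, ∑ i, ∑ j, s' i ^ d * B i j * u' j ^ d ≤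
        ∑ i, ∑ j, s i ^ d * B i j * u j ^ d) ∧
      (∀ i, ∑ j, B i j * u j ^ d = (∑ i, ∑ j, s i ^ d * B i j * u j ^ d) * s i) ∧
      ∀ j, ∑ i, B i j * s i ^ d = (∑ i, ∑ j, s i ^ d * B i j * u j ^ d) * u j := by
  set f : (I → ℝ) × (I → ℝ) → ℝ := fun w => ∑ i, ∑ j, w.1 i ^ d * B i j * w.2 j ^ d with hf
  have hmem : (Pi.single i₀ 1 : I → ℝ) ∈ unitSphere I d := by
    refine ⟨fun i => ?_, ?_⟩
    · rcases eq_or_ne i i₀ with rfl | h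
      · simp
      · simp [h]
    · rw [Finset.sum_eq_single i₀]
      · simp
      · intro i _ h; simp [h]
      · simp
  obtain ⟨⟨s, u⟩, ⟨hs, hu⟩, hm⟩ := ((isCompact_unitSphere (I := I) d).prod
    (isCompact_unitSphere (I := I) d)).exists_isMaxOn ⟨(_, _), hmem, hmem⟩
    (f := f) (by fun_prop : Continuous f).continuousOn
  have hmax : ∀ s' ∈ unitSphere I d, ∀ u' ∈ unitSphere I d, f (s', u') ≤ f (s, u) :=
    fun s' hs' u' hu' => hm ⟨hs', hu'⟩
  have hpos : 0 < f (s, u) := by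
    refine lt_of_lt_of_le ?_ (hmax _ hmem _ hmem)
    refine Finset.sum_pos' (fun i _ => Finset.sum_nonneg fun j _ => mul_nonneg (mul_nonneg
      (pow_nonneg (hmem.1 i) d) (hB i j)) (pow_nonneg (hmem.1 j) d)) ⟨i₀, Finset.mem_univ _, ?_⟩
    refine Finset.sum_pos' (fun j _ => mul_nonneg (mul_nonneg
      (pow_nonneg (hmem.1 i₀) d) (hB i₀ j)) (pow_nonneg (hmem.1 j) d)) ⟨i₀, Finset.mem_univ _, ?_⟩
    simpa using h₀
  have e1 : ∀ s' u' : I → ℝ, f (s', u') = ∑ i, s' i ^ d * ∑ j, B i j * u' j ^ d := fun s' u' => by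
    refine Finset.sum_congr rfl fun i _ => ?_
    rw [Finset.mul_sum]
    exact Finset.sum_congr rfl fun j _ => mul_assoc _ _ _
  have e2 : ∀ s' u' : I → ℝ, f (s', u') = ∑ j, u' j ^ d * ∑ i, B i j * s' i ^ d := fun s' u' => by
    simp only [hf]
    rw [Finset.sum_comm]
    refine Finset.sum_congr rfl fun i _ => ?_
    rw [Finset.mul_sum]
    exact Finset.sum_congr rfl fun j _ => by ring
  refine ⟨s, hs, u, hu, hpos, hmax, fun i => ?_, fun j => ?_⟩
  · have := eq_mul_of_isMax hd (s := s) (v := fun i => ∑ j, B i j * u j ^ d) hs.1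
      (fun i => Finset.sum_nonneg fun j _ => mul_nonneg (hB i j) (pow_nonneg (hu.1 j) d)) hs.2
      (by rw [← e1]; exact hpos)
      (fun s' h1 h2 => by rw [← e1, ← e1]; exact hmax s' ⟨h1, h2⟩ u hu) i
    rw [← e1] at this
    exact this
  · have := eq_mul_of_isMax hd (s := u) (v := fun j => ∑ i, B i j * s i ^ d) hu.1
      (fun j => Finset.sum_nonneg fun i _ => mul_nonneg (hB i j) (pow_nonneg (hs.1 i) d)) hu.2
      (by rw [← e2]; exact hpos)
      (fun u' h1 h2 => by rw [← e2, ← e2]; exact hmax s hs u' ⟨h1, h2⟩) j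
    rw [← e2] at this
    exact this

theorem log_relative_le {α ε n : ℝ} (hα : 0 ≤ α) (hε : 0 < ε) (hn : 0 ≤ n) :
    α * (Real.log α - Real.log ((α + ε) / (1 + n * ε))) ≤ α * Real.log (1 + n * ε) := by
  rcases hα.eq_or_lt with rfl | h
  · simp
  · refine mul_le_mul_of_nonneg_left ?_ hα
    rw [Real.log_div (by positivity) (by positivity)]
    have := Real.log_le_log h (by linarith : α ≤ α + ε)
    linarith

/-- In the dual bound take ρ = d/(d+1) log α and γ = d/(d+1) log β: the entropies cancel and exp ρ
is the d-th power of a point of the unit sphere. Since α and β may have zeros, they are first mixed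
with a multiple of the uniform distribution, at a cost of 2 d log(1 + nε), which tends to 0. -/
theorem Psi1_le_of_forall_unitSphere [DecidableEq I] [Nonempty I] {d : ℕ} {B : Matrix I I ℝ}
    (hB : ∀ i j, 0 ≤ B i j) {M : ℝ}
    (hM : ∀ s ∈ unitSphere I d, ∀ u ∈ unitSphere I d, (∀ i, 0 < s i) → (∀ i, 0 < u i) →
      ((d : ℝ) + 1) * Real.log (∑ i, ∑ j, s i ^ d * B i j * u j ^ d) ≤ M)
    {α β : I → ℝ} (hα : α ∈ stdSimplex ℝ I) (hβ : β ∈ stdSimplex ℝ I) :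
    Psi1 (d + 1) B α β ≤ (M : EReal) := by
  set n : ℝ := (Fintype.card I : ℝ) with hn
  have hn0 : 0 ≤ n := by positivity
  have hd0 : (0 : ℝ) < (d : ℝ) + 1 := by positivity
  have key : ∀ ε : ℝ, 0 < ε →
      Psi1 (d + 1) B α β ≤ ((M + 2 * d * Real.log (1 + n * ε) : ℝ) : EReal) := by
    intro ε hε
    set sm : (I → ℝ) → I → ℝ := fun α i => (α i + ε) / (1 + n * ε) with hsm
    have hsm0 : ∀ {α : I → ℝ}, α ∈ stdSimplex ℝ I → ∀ i, 0 < sm α i := fun {α} hα i => by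
      have := hα.1 i
      simp only [hsm]
      positivity
    have hsm1 : ∀ {α : I → ℝ}, α ∈ stdSimplex ℝ I → ∑ i, sm α i = 1 := fun {α} hα => by
      simp only [hsm]
      rw [← Finset.sum_div, Finset.sum_add_distrib, hα.2]
      simp only [Finset.sum_const, Finset.card_univ, nsmul_eq_mul]
      exact div_self (by positivity)
    set ρ : (I → ℝ) → I → ℝ := fun α i => d / ((d : ℝ) + 1) * Real.log (sm α i) with hρ
    set s : (I → ℝ) → I → ℝ := fun α i => Real.exp (Real.log (sm α i) / ((d : ℝ) + 1)) with hs
    have hsρ : ∀ α i, Real.exp (ρ α i) = s α i ^ d := fun α i => by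
      rw [hs, ← Real.exp_nat_mul]
      congr 1
      simp only [hρ]
      ring
    have hss : ∀ {α : I → ℝ}, α ∈ stdSimplex ℝ I → s α ∈ unitSphere I d := fun {α} hα => by
      refine ⟨fun i => (Real.exp_pos _).le, ?_⟩
      rw [← hsm1 hα]
      refine Finset.sum_congr rfl fun i _ => ?_
      rw [hs, ← Real.exp_nat_mul]
      push_cast
      rw [mul_div_cancel₀ _ hd0.ne', Real.exp_log (hsm0 hα i)]
    refine (Psi1_le_dualRate d hB α β (ρ α) (ρ β)).trans (EReal.coe_le_coe_iff.2 ?_)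
    have hrel : ∀ {α : I → ℝ}, α ∈ stdSimplex ℝ I →
        -d * entropy α - ((d : ℝ) + 1) * ∑ i, α i * ρ α i ≤ d * Real.log (1 + n * ε) :=
      fun {α} hα => by
        have e : -d * entropy α - ((d : ℝ) + 1) * ∑ i, α i * ρ α i =
            d * ∑ i, α i * (Real.log (α i) - Real.log (sm α i)) := by
          rw [entropy, Finset.mul_sum, Finset.mul_sum, Finset.mul_sum, ← Finset.sum_sub_distrib]
          refine Finset.sum_congr rfl fun i _ => ?_
          simp only [hρ, Real.negMulLog]
          field_simp
        rw [e]
        refine mul_le_mul_of_nonneg_left ?_ (Nat.cast_nonneg d)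
        calc ∑ i, α i * (Real.log (α i) - Real.log (sm α i))
            ≤ ∑ i, α i * Real.log (1 + n * ε) :=
              Finset.sum_le_sum fun i _ => log_relative_le (hα.1 i) hε hn0
          _ = Real.log (1 + n * ε) := by rw [← Finset.sum_mul, hα.2, one_mul]
    have h1 := hM (s α) (hss hα) (s β) (hss hβ) (fun i => Real.exp_pos _) (fun i => Real.exp_pos _)
    have h2 := hrel hα
    have h3 := hrel hβ
    rw [dualRate, logZ]
    simp only [hsρ]
    linarith
  have hlim : Tendsto (fun ε : ℝ => ((M + 2 * d * Real.log (1 + n * ε) : ℝ) : EReal)) (𝓝[>] 0)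
      (𝓝 (M : EReal)) := by
    refine (continuous_coe_real_ereal.tendsto M).comp ?_
    have hc : ContinuousAt (fun ε : ℝ => M + 2 * d * Real.log (1 + n * ε)) 0 := by
      refine ContinuousAt.add continuousAt_const (ContinuousAt.mul continuousAt_const ?_)
      exact ContinuousAt.log (by fun_prop) (by simp)
    have := hc.tendsto
    simp only [mul_zero, add_zero, Real.log_one] at this
    exact this.mono_left nhdsWithin_le_nhds
  exact ge_of_tendsto hlim (eventually_mem_nhdsWithin.mono fun ε hε => key ε hε)

end Duality

end SpinPhase

namespace SpinPhase

/-! ### Maximizers take at most three values; dominance -/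

section Dominance

theorem strictConcaveOn_mul_sub_pow {d : ℕ} (hd : 1 ≤ d) (X : ℝ) :
    StrictConcaveOn ℝ (Set.Ici 0) fun s : ℝ => X * s - s ^ (d + 1) := by
  have h1 : ConcaveOn ℝ (Set.Ici 0) fun s : ℝ => X * s :=
    ⟨convex_Ici 0, fun x _ y _ a b _ _ _ => le_of_eq (by simp only [smul_eq_mul]; ring)⟩
  exact h1.sub_strictConvexOn (strictConvexOn_pow (n := d + 1) (by omega))

theorem not_three_eq {d : ℕ} (hd : 1 ≤ d) {X a b c : ℝ} (ha : 0 ≤ a) (hab : a < b) (hbc : b < c)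
    (h1 : X * a - a ^ (d + 1) = X * b - b ^ (d + 1))
    (h2 : X * b - b ^ (d + 1) = X * c - c ^ (d + 1)) : False := by
  have h := (strictConcaveOn_mul_sub_pow hd X).slope_anti_adjacent
    (show a ∈ Set.Ici 0 from ha) (show c ∈ Set.Ici 0 from (ha.trans hab.le).trans hbc.le) hab hbc
  simp only [← h1, ← h2, sub_self, zero_div] at h
  exact lt_irrefl _ h

/-- The two-step recursion `s ↦ u ↦ s` has at most three nonnegative fixed points. -/
theorem not_four_roots {d : ℕ} (hd : 2 ≤ d) {S X Y : ℝ} (hS : 0 < S) {s : Fin 4 → ℝ}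
    (hmono : StrictMono s) (hs : ∀ i, 0 ≤ s i) (hX : ∀ i, s i ^ d ≤ X)
    (hroot : ∀ i, S * s i + ((X - s i ^ d) / S) ^ d = Y) : False := by
  set g : ℝ → ℝ := fun x => S * x + ((X - x ^ d) / S) ^ d with hg
  have hder : ∀ x, HasDerivAt g (S + d * ((X - x ^ d) / S) ^ (d - 1) * (-(d * x ^ (d - 1)) / S)) x :=
    fun x => by
      have h1 : HasDerivAt (fun x : ℝ => (X - x ^ d) / S) (-(d * x ^ (d - 1)) / S) x :=
        ((hasDerivAt_pow d x).const_sub X).div_const S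
      have h2 := ((hasDerivAt_id x).const_mul S).add (h1.pow d)
      rw [mul_one] at h2
      exact h2
  have hcont : Continuous g := continuous_iff_continuousAt.2 fun x => (hder x).continuousAt
  have hrolle : ∀ i j : Fin 4, i < j → ∃ c ∈ Set.Ioo (s i) (s j),
      S + d * ((X - c ^ d) / S) ^ (d - 1) * (-(d * c ^ (d - 1)) / S) = 0 := fun i j hij =>
    exists_hasDerivAt_eq_zero (hmono hij) hcont.continuousOn ((hroot i).trans (hroot j).symm)
      fun x _ => hder x
  have hcrit : ∀ {c : ℝ}, 0 ≤ c → c ^ d ≤ X →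
      S + d * ((X - c ^ d) / S) ^ (d - 1) * (-(d * c ^ (d - 1)) / S) = 0 →
      (X * c - c ^ (d + 1)) ^ (d - 1) = S ^ (d + 1) / d ^ 2 := fun {c} _ _ h => by
    have hd0 : (d : ℝ) ≠ 0 := by positivity
    have e : X * c - c ^ (d + 1) = (X - c ^ d) * c := by ring
    have e2 : S ^ (d + 1) = S ^ (d - 1) * S * S := by
      rw [← pow_succ, ← pow_succ]; congr 1; omega
    rw [e, mul_pow, e2]
    rw [div_pow] at h
    have hS' : S ^ (d - 1) ≠ 0 := by positivity
    field_simp at h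
    field_simp
    linear_combination -h
  obtain ⟨a, ha, ha'⟩ := hrolle 0 1 (by decide)
  obtain ⟨b, hb, hb'⟩ := hrolle 1 2 (by decide)
  obtain ⟨c, hc, hc'⟩ := hrolle 2 3 (by decide)
  have h0 := hs 0
  have ha0 : 0 ≤ a := h0.trans ha.1.le
  have hb0 : 0 ≤ b := (hs 1).trans hb.1.le
  have hc0 : 0 ≤ c := (hs 2).trans hc.1.le
  have hcX : c ^ d ≤ X := (pow_le_pow_left₀ hc0 hc.2.le d).trans (hX 3)
  have hbX : b ^ d ≤ X := (pow_le_pow_left₀ hb0 hb.2.le d).trans (hX 2)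
  have haX : a ^ d ≤ X := (pow_le_pow_left₀ ha0 ha.2.le d).trans (hX 1)
  have hnn : ∀ {x : ℝ}, 0 ≤ x → x ^ d ≤ X → 0 ≤ X * x - x ^ (d + 1) := fun {x} hx hxX => by
    have : X * x - x ^ (d + 1) = (X - x ^ d) * x := by ring
    rw [this]
    exact mul_nonneg (by linarith) hx
  have h1 := (hcrit ha0 haX ha').trans (hcrit hb0 hbX hb').symm
  have h2 := (hcrit hb0 hbX hb').trans (hcrit hc0 hcX hc').symm
  rw [pow_left_inj₀ (hnn ha0 haX) (hnn hb0 hbX) (by omega)] at h1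
  rw [pow_left_inj₀ (hnn hb0 hbX) (hnn hc0 hcX) (by omega)] at h2
  exact not_three_eq (by omega) ha0 (ha.2.trans hb.1) (hb.2.trans hc.1) h1 h2

/-- Embed the set of values of s into three labels. As u depends only on s, both vectors factor
through the label; unused labels get the value 0. -/
theorem exists_class_of_card_image_le {q : ℕ} {s u : Fin q → ℝ}
    (hcard : (Finset.univ.image s).card ≤ 3) (hs : ∀ i, 0 ≤ s i) (hu : ∀ i, 0 ≤ u i)
    (hsu : ∀ i j, s i = s j → u i = u j) :
    ∃ (φ : Fin q → Fin 3) (r c : Fin 3 → ℝ), (∀ j, 0 ≤ r j) ∧ (∀ j, 0 ≤ c j) ∧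
      (∀ i, r (φ i) = s i) ∧ ∀ i, c (φ i) = u i := by
  obtain ⟨e⟩ : Nonempty ((Finset.univ.image s : Finset ℝ) ↪ Fin 3) := by
    rw [Function.Embedding.nonempty_iff_card_le]
    simpa using hcard
  set φ : Fin q → Fin 3 := fun i => e ⟨s i, Finset.mem_image_of_mem _ (Finset.mem_univ i)⟩ with hφ
  have hφs : ∀ i j, φ i = φ j → s i = s j := fun i j h => by
    have := e.injective h
    exact congrArg Subtype.val this
  classical
  set val : (Fin q → ℝ) → Fin 3 → ℝ := fun f j => if h : ∃ i, φ i = j then f h.choose else 0 with hval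
  have hval0 : ∀ {f : Fin q → ℝ}, (∀ i, 0 ≤ f i) → ∀ j, 0 ≤ val f j := fun {f} hf j => by
    simp only [hval]
    split_ifs with h
    · exact hf _
    · exact le_rfl
  have hval1 : ∀ {f : Fin q → ℝ}, (∀ i j, s i = s j → f i = f j) → ∀ i, val f (φ i) = f i :=
    fun {f} hf i => by
      have h : ∃ i', φ i' = φ i := ⟨i, rfl⟩
      simp only [hval, dif_pos h]
      exact hf _ _ (hφs _ _ h.choose_spec)
  exact ⟨φ, val s, val u, hval0 hs, hval0 hu, hval1 fun _ _ h => h, hval1 hsu⟩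

theorem sum_comp_class {q : ℕ} (φ : Fin q → Fin 3) (f : Fin 3 → ℝ) :
    ∑ j, ((Finset.univ.filter fun i => φ i = j).card : ℝ) * f j = ∑ i, f (φ i) := by
  rw [← Finset.sum_fiberwise Finset.univ φ fun i => f (φ i)]
  refine Finset.sum_congr rfl fun j _ => ?_
  rw [Finset.sum_congr rfl fun i hi => by rw [(Finset.mem_filter.1 hi).2], Finset.sum_const,
    nsmul_eq_mul]

theorem pow_rpow_eq_pow_succ {d : ℕ} (hd : 1 ≤ d) {x : ℝ} (hx : 0 ≤ x) :
    (x ^ d) ^ (((d : ℝ) + 1) / d) = x ^ (d + 1) := by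
  have hd0 : (d : ℝ) ≠ 0 := by positivity
  rw [← Real.rpow_natCast, ← Real.rpow_mul hx, mul_div_cancel₀ _ hd0, ← Real.rpow_natCast]
  push_cast
  rfl

/-- It suffices to treat the maximizer of the bilinear form. Its equations make its entries on the
spins 1, …, q roots of one equation, so they take at most three values, and with the class sizes as
multiplicities it is a competitor in `IsMaximal`. Both norms are 1, so `PhiS` reduces to the
logarithm of the bilinear form. -/
theorem log_bilinear_le_of_isMaximal {q k d : ℕ} (hq : 2 ≤ q) (hk : 2 ≤ k) (hd : 2 ≤ d)
    {R C : Fin (q + 1) → ℝ} (hmax : IsMaximal q k d R C) {s u : Fin (q + 1) → ℝ}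
    (hs : s ∈ unitSphere (Fin (q + 1)) d) (hu : u ∈ unitSphere (Fin (q + 1)) d)
    (hpos : 0 < ∑ i, ∑ j, s i ^ d * interaction q k d i j * u j ^ d) :
    ((d : ℝ) + 1) * Real.log (∑ i, ∑ j, s i ^ d * interaction q k d i j * u j ^ d) ≤
      Phi d (interaction q k d) R C := by
  obtain ⟨s₀, hs₀, u₀, hu₀, hpos₀, hle, hstat, hstat'⟩ := exists_isMax_bilinear (d := d) (by omega)
    (interaction_nonneg hq hk d) (interaction_zero_pos hq hk d 0)
  refine (mul_le_mul_of_nonneg_left (Real.log_le_log hpos (hle s hs u hu)) (by positivity)).trans ?_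
  clear hle hpos hs hu s u
  have hS := sum_sum_interaction q k d (fun i => s₀ i ^ d) fun i => u₀ i ^ d
  have hSe : ∑ i, ∑ j, s₀ i ^ d * interaction q k d i j * u₀ j ^ d =
      ∑ i, ∑ j, interaction q k d i j * s₀ i ^ d * u₀ j ^ d :=
    Finset.sum_congr rfl fun i _ => Finset.sum_congr rfl fun j _ => by ring
  rw [← hSe] at hS
  set S := ∑ i, ∑ j, s₀ i ^ d * interaction q k d i j * u₀ j ^ d with hSdef
  set t := tParam q k d with ht
  set X := t * s₀ 0 ^ d + ∑ i : Fin q, s₀ i.succ ^ d with hX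
  set Y := t * u₀ 0 ^ d + ∑ i : Fin q, u₀ i.succ ^ d with hY
  have h1 : ∀ i : Fin q, Y - u₀ i.succ ^ d = S * s₀ i.succ := fun i => by
    rw [← hstat, sum_interaction_succ q k d fun i => u₀ i ^ d]
  have h2 : ∀ i : Fin q, X - s₀ i.succ ^ d = S * u₀ i.succ := fun i => by
    rw [← hstat']
    simp only [interaction_symm q k d _ i.succ]
    rw [sum_interaction_succ q k d fun i => s₀ i ^ d]
  have h3 : ∀ i : Fin q, u₀ i.succ = (X - s₀ i.succ ^ d) / S := fun i => by
    rw [h2]; field_simp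
  -- Eliminating u₀ between `h1` and `h2` leaves one equation for each entry of s₀; four distinct
  -- values would be four of its roots.
  have hcard : (Finset.univ.image fun i : Fin q => s₀ i.succ).card ≤ 3 := by
    by_contra hcon
    set T := Finset.univ.image fun i : Fin q => s₀ i.succ with hT
    set e := T.orderEmbOfCardLe (k := 4) (by omega) with he
    have hmem : ∀ j, ∃ i : Fin q, s₀ i.succ = e j := fun j => by
      have := T.orderEmbOfCardLe_mem (k := 4) (by omega) j
      simpa [hT] using this
    refine not_four_roots hd hpos₀ (X := X) (Y := Y) (s := e) e.strictMono ?_ ?_ ?_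
    · intro j
      obtain ⟨i, hi⟩ := hmem j
      exact hi ▸ hs₀.1 _
    · intro j
      obtain ⟨i, hi⟩ := hmem j
      rw [← hi]
      have := mul_nonneg hpos₀.le (hu₀.1 i.succ)
      linarith [h2 i]
    · intro j
      obtain ⟨i, hi⟩ := hmem j
      rw [← hi, ← h3, ← h1]
      ring
  obtain ⟨φ, r, c, hr, hc, hφr, hφc⟩ := exists_class_of_card_image_le
    (u := fun i : Fin q => u₀ i.succ) hcard (fun i => hs₀.1 _) (fun i => hu₀.1 _)
    (fun i j h => by simp only [h3, h])
  set m : Fin 3 → ℝ := fun j => ((Finset.univ.filter fun i => φ i = j).card : ℝ) with hm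
  have hsum : ∀ f : Fin 3 → ℝ, ∑ j, m j * f j = ∑ i, f (φ i) := sum_comp_class φ
  have hbil : bilinS t m (s₀ 0 ^ d) (u₀ 0 ^ d) (fun j => r j ^ d) (fun j => c j ^ d) = S := by
    simp only [bilinS, mul_assoc]
    rw [hsum fun j => r j ^ d, hsum fun j => c j ^ d, hsum fun j => r j ^ d * c j ^ d]
    simp only [hφr, hφc]
    rw [hS]
    ring
  have hNs : (s₀ 0 ^ d) ^ (((d : ℝ) + 1) / d) + ∑ j, m j * (r j ^ d) ^ (((d : ℝ) + 1) / d) = 1 := by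
    refine Eq.trans ?_ hs₀.2
    rw [hsum fun j => (r j ^ d) ^ (((d : ℝ) + 1) / d), Fin.sum_univ_succ,
      pow_rpow_eq_pow_succ (by omega) (hs₀.1 0)]
    congr 1
    exact Finset.sum_congr rfl fun i _ => by
      rw [pow_rpow_eq_pow_succ (by omega) (hr _), hφr]
  have hNu : (u₀ 0 ^ d) ^ (((d : ℝ) + 1) / d) + ∑ j, m j * (c j ^ d) ^ (((d : ℝ) + 1) / d) = 1 := by
    refine Eq.trans ?_ hu₀.2
    rw [hsum fun j => (c j ^ d) ^ (((d : ℝ) + 1) / d), Fin.sum_univ_succ,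
      pow_rpow_eq_pow_succ (by omega) (hu₀.1 0)]
    congr 1
    exact Finset.sum_congr rfl fun i _ => by
      rw [pow_rpow_eq_pow_succ (by omega) (hc _), hφc]
  have hfin := hmax m (s₀ 0 ^ d) (u₀ 0 ^ d) (fun j => r j ^ d) (fun j => c j ^ d)
    (fun j => Nat.cast_nonneg _) (by simpa using hsum fun _ => 1) (pow_nonneg (hs₀.1 0) d)
    (pow_nonneg (hu₀.1 0) d) (fun j => pow_nonneg (hr j) d) (fun j => pow_nonneg (hc j) d)
    (by rw [hbil]; exact hpos₀)
  rw [PhiS, hbil, hNs, hNu, Real.log_one, mul_zero, sub_zero, sub_zero] at hfin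
  exact hfin

theorem isDominantPhase_of_isMaximal {q k d : ℕ} (hq : 2 ≤ q) (hk : 2 ≤ k) (hd : 2 ≤ d)
    {R C : Fin (q + 1) → ℝ} (hf : IsFixpoint d (interaction q k d) R C)
    (hmax : IsMaximal q k d R C) :
    IsDominantPhase (d + 1) (interaction q k d) (phaseOf d R) (phaseOf d C) := by
  have hB := interaction_nonneg hq hk d
  have hBp := interaction_zero_pos hq hk d
  refine ⟨phaseOf_mem_stdSimplex d hf.1, phaseOf_mem_stdSimplex d hf.2.1, ?_⟩
  rintro ⟨α, β⟩ ⟨hα, hβ⟩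
  change Psi1 (d + 1) (interaction q k d) α β ≤ Psi1 (d + 1) (interaction q k d) _ _
  rw [hf.Psi1_phaseOf (by omega) hB (hBp 0)]
  refine Psi1_le_of_forall_unitSphere hB (fun s hs u hu hs0 hu0 => ?_) hα hβ
  refine log_bilinear_le_of_isMaximal hq hk hd hmax hs hu ?_
  have hnn : ∀ i j, 0 ≤ s i ^ d * interaction q k d i j * u j ^ d := fun i j =>
    mul_nonneg (mul_nonneg (pow_nonneg (hs.1 i) d) (hB i j)) (pow_nonneg (hu.1 j) d)
  refine Finset.sum_pos' (fun i _ => Finset.sum_nonneg fun j _ => hnn i j)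
    ⟨0, Finset.mem_univ _, Finset.sum_pos' (fun j _ => hnn 0 j) ⟨0, Finset.mem_univ _, ?_⟩⟩
  have := hBp 0
  have := hs0 0
  have := hu0 0
  positivity

end Dominance

end SpinPhase
theorem mainTheorem4 (q k d : ℕ) (hq : 4 ≤ q) (hq_even : Even q) (hk : 2 ≤ k)
    (hd : 5 * q ^ k ≤ d) :
    -- the maximal fixpoints of type `(q/2, q/2, 0)` are balanced, and are dominant phases
    (∀ R C : Fin (q + 1) → ℝ, IsHalfFixpoint q k d R C → IsMaximal q k d R C →
      IsBalanced R C ∧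
      IsDominantPhase (d + 1) (interaction q k d) (phaseOf d R) (phaseOf d C)) ∧
    -- balanced fixpoints of type `(q/2, q/2, 0)` exist
    (∃ R C : Fin (q + 1) → ℝ, IsHalfFixpoint q k d R C ∧ IsBalanced R C) ∧
    -- they are unique up to scaling and permutation symmetric
    (∀ R C R' C' : Fin (q + 1) → ℝ,
      IsHalfFixpoint q k d R C → IsBalanced R C →
      IsHalfFixpoint q k d R' C' → IsBalanced R' C' →
      EqUpToScalingPerm (interaction q k d) R C R' C' ∧
      PermutationSymmetric (interaction q k d)
        (phaseOf d R) (phaseOf d C) (phaseOf d R') (phaseOf d C')) ∧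
    -- they are Hessian dominant maxima, and the second eigenvalue is below `1/d`
    (∀ R C : Fin (q + 1) → ℝ, IsHalfFixpoint q k d R C → IsBalanced R C →
      IsLocalMaxPhase (d + 1) (interaction q k d) (phaseOf d R) (phaseOf d C) ∧
      HessianNegDef (d + 1) (interaction q k d) (phaseOf d R) (phaseOf d C) ∧
      secondEigenvalue (interaction q k d) R C < 1 / (d : ℝ)) := by
  have hd2 : 2 ≤ d := by
    have := Nat.pow_pos (n := k) (show 0 < q by omega)
    omega
  exact ⟨fun R C hf hmax => ⟨isBalanced_of_isMaximal hq hq_even hk hd2 hf hmax,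
      isDominantPhase_of_isMaximal (by omega) hk hd2 hf.1 hmax⟩,
    exists_isBalanced_isHalfFixpoint hq hq_even hk hd,
    fun R C R' C' hf hb hf' hb' => eqUpToScalingPerm_of_balanced hq hq_even hk hd2 hf hb hf' hb',
    fun R C hf hb => balanced_isLocalMaxPhase hq hq_even hk hd2 hf hb⟩
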